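/- Let $k=\mathbb R$ or $\mathbb C$, and let $q\in k$ be nonzero with $q^r\neq 1$ for every nonzero integer $r$. Put $\lambda=q-q^{-1}$, $r_q=\frac{q^r-q^{-r}}{q-q^{-1}}$, $r_q!=1_q2_q\cdots r_q$, $\left[{p\atop k}\right]_q=\frac{p_q!}{k_q!\,(p-k)_q!}$. Let $V=k^n$ and let $R\in\mathrm{End}(V\otimes V)$ satisfy $$R_{12}R_{23}R_{12}=R_{23}R_{12}R_{23},\qquad R^2=\mathrm{id}+\lambda R .$$ Write $R_i$ for $R$ acting in the tensor factors $i,i+1$. Let $P_-^{(l)}$ be the $q$-antisymmetrizer of $V^{\otimes l}$, i.e. $P_-^{(1)}=\mathrm{id}$ and $P_-^{(l+1)}=\frac1{(l+1)_q}P_-^{(l)}\,(q^l\,\mathrm{id}-l_q R_l)\,P_-^{(l)}$ (where $P_-^{(l)}$ acts in the first $l$ factors); it is the projector onto the totally skewsymmetric tensors, those on which every $R_i$ acts as $-q^{-1}$. Suppose that $R$ is an even Hecke symmetry of rank $p$: $P_-^{(p+1)}=0$ and $P_-^{(p)}$ has rank $1$. For $\hbar\in k$ let $\mathcal L_{q,\hbar}(R)$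 be the unital associative $k$-algebra generated by the $n^2$ entries of the matrix $\bar L=\|\bar l^{\,i}_j\|$ subject to $$R_{12}\bar L_1R_{12}\bar L_1-\bar L_1R_{12}\bar L_1R_{12}=\hbar\,(R_{12}\bar L_1-\bar L_1R_{12}),$$ and let $\mathcal L_q(R)=\mathcal L_{q,0}(R)$, with matrix of generators $L=\|l^i_j\|$. For an $n\times n$ matrix $M$ over one of these algebras and $0\le k\le p$ put $$\sigma_k(M)=q^{-k(p-k)}\left[{p\atop k}\right]_q\mathrm{Tr}_{(12\dots p)}\,P_-^{(p)}\,(M_1R_1R_2\cdots R_{k-1})^k .$$ For $0\le k\le s\le p$ put $$\xi^{(p)}_{s,k}=\sum_{r=0}^{s-k}(-1)^rq^{-r(p-1)}\binom{s-r}{k}\binom{p-s+r}{r}\left[{p\atop s-r}\right]_q,\qquad \omega^{(p)}_{s,k}=\frac{\lambda^{k-s}}{\left[{p\atop s}\right]_q}\,\xi^{(p)}_{s,k},$$ and for $0\le k<p$ $$\sigma^{(\hbar)}_{p-k}(\bar L)=\sigma_{p-k}(\bar L)+\sum_{r=1}^{p-k}\hbar^r\,\omega^{(p)}_{r+k,k}\,\sigma_{p-k-r}(\bar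 L).$$ Then the following hold. 1. All $\sigma_k(\bar L)$ with $0\le k\le p$, and all $\sigma^{(\hbar)}_{p-k}(\bar L)$ with $0\le k<p$, are central in $\mathcal L_{q,\hbar}(R)$, and $$(-\bar L)^p+\sum_{k=0}^{p-1}(-\bar L)^k\,\sigma^{(\hbar)}_{p-k}(\bar L)=0 .$$ 2. Put $h=\hbar/\lambda$. There is an algebra isomorphism $\varphi:\mathcal L_q(R)\to\mathcal L_{q,\hbar}(R)$ with $\varphi(l^i_j)=\bar l^{\,i}_j-h\,\delta^i_j$. For $0\le k\le p$, $$\varphi(\sigma_k(L))=\sum_{r=0}^{k}(-h)^r\,q^{-r(p-1)}\binom kr\frac{\left[{p\atop k}\right]_q}{\left[{p\atop k-r}\right]_q}\,\sigma_{k-r}(\bar L).$$ Applying $\varphi$ to the coefficients of the polynomial $(-X)^p+\sum_{k=0}^{p-1}(-X)^k\sigma_{p-k}(L)$ and substituting $X-h$ for $X$ gives $(-X)^p+\sum_{k=0}^{p-1}(-X)^k\sigma^{(\hbar)}_{p-k}(\bar L)$. 3. For all $x,y\in k$, $$\sum_{s=0}^p\sum_{k=0}^s(-x)^{p-s}(-y)^k\,\xi^{(p)}_{s,k}=(-1)^pq^{-p(p-1)}\prod_{k=0}^{p-1}\left(xq^{p-1}+yq^{2k}-\lambda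 q^kk_q\right).$$ 4. For integers $a,b\ge 0$ put $$S(a,b)=\sum\frac{q^{\,l_1+\dots+l_a-r_1-\dots-r_b}}{(l_1)_q\cdots(l_a)_q\,(r_1)_q\cdots(r_b)_q},$$ the sum over all disjoint subsets $\{l_1<\dots<l_a\}$ and $\{r_1<\dots<r_b\}$ of $\{1,\dots,p-1\}$. For $0\le k<s\le p$, $$\omega^{(p)}_{s,k}=q^{\frac{(p-1)(p-2s)}2}\,\frac{(p-1)_q!}{\left[{p\atop s}\right]_q}\,(V_k+V_s),$$ where $V_k=0$ if $k=0$ and $V_k=S(k-1,p-s)$ otherwise, and $V_s=0$ if $s=p$ and $V_s=S(k,p-s-1)$ otherwise. -/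

import Mathlib

open scoped Kronecker

noncomputable section

namespace QuantumMatrix

/-! ### `q`-numbers -/

section QNumbers

variable {𝕜 : Type*} [Field 𝕜]

/-- The `q`-number `r_q = (q ^ r - q ^ (-r)) / (q - q⁻¹)`. -/
def qNum (q : 𝕜) (r : ℕ) : 𝕜 := (q ^ r - (q ^ r)⁻¹) / (q - q⁻¹)

/-- The `q`-factorial `r_q! = 1_q 2_q ⋯ r_q`. -/
def qFact (q : 𝕜) (r : ℕ) : 𝕜 := ∏ i ∈ Finset.range r, qNum q (i + 1)

/-- The symmetric `q`-binomial coefficient `p_q! / (k_q! (p - k)_q!)`; it is only used for `k ≤ p`. -/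
def qBinom (q : 𝕜) (p k : ℕ) : 𝕜 := qFact q p / (qFact q k * qFact q (p - k))

end QNumbers

/-! ### Operators on tensor powers

The space `V ^ ⊗m`, with `dim V = n`, has its basis indexed by `Fin m → Fin n`.
Rows carry the upper indices, columns the lower ones.  Tensor factors are numbered from `0`. -/

section Tensor

variable {𝕜 : Type*} [Field 𝕜] {n : ℕ}

/-- `R` acting in the tensor factors `i` and `i + 1` of `V ^ ⊗m`, and as the identity elsewhere.
It is only used for `i + 1 < m`. -/
def braid (R : Matrix (Fin n × Fin n) (Fin n × Fin n) 𝕜) (m i : ℕ) :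
    Matrix (Fin m → Fin n) (Fin m → Fin n) 𝕜 :=
  if h : i + 1 < m then
    let a : Fin m := ⟨i, Nat.lt_of_succ_lt h⟩
    let b : Fin m := ⟨i + 1, h⟩
    Matrix.of fun x y =>
      if ∀ c, c ≠ a → c ≠ b → x c = y c then R (x a, x b) (y a, y b) else 0
  else 1

/-- The matrix `M_1`: an `n × n` matrix `M` with entries in an algebra, acting in the first tensor
factor of `V ^ ⊗m`, and as the identity elsewhere.  It is only used for `0 < m`. -/
def inFirst {A : Type*} [Ring A] (M : Matrix (Fin n) (Fin n) A) (m : ℕ) :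
    Matrix (Fin m → Fin n) (Fin m → Fin n) A :=
  if h : 0 < m then
    let a : Fin m := ⟨0, h⟩
    Matrix.of fun x y => if ∀ c, c ≠ a → x c = y c then M (x a) (y a) else 0
  else 1

/-- The `q`-antisymmetrizer of the first `l` tensor factors of `V ^ ⊗m`, for `l ≤ m`:
the projector, built from the `R_i`, onto the tensors on which all `R_i` between these factors act
as `-q⁻¹`. -/
def skewProj (R : Matrix (Fin n × Fin n) (Fin n × Fin n) 𝕜) (q : 𝕜) (m : ℕ) :
    ℕ → Matrix (Fin m → Fin n) (Fin m → Fin n) 𝕜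
  | 0 => 1
  | 1 => 1
  | l + 2 => (qNum q (l + 2))⁻¹ •
      (skewProj R q m (l + 1) *
        (q ^ (l + 1) • (1 : Matrix (Fin m → Fin n) (Fin m → Fin n) 𝕜)
          - qNum q (l + 1) • braid R m l) *
        skewProj R q m (l + 1))

/-- `R` is an even Hecke symmetry of rank `p`, with generic parameter `q`. -/
structure IsEvenHeckeSymmetry (R : Matrix (Fin n × Fin n) (Fin n × Fin n) 𝕜) (q : 𝕜) (p : ℕ) :
    Prop where
  q_ne_zero : q ≠ 0
  q_generic : ∀ r : ℤ, r ≠ 0 → q ^ r ≠ 1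
  yangBaxter : braid R 3 0 * braid R 3 1 * braid R 3 0 = braid R 3 1 * braid R 3 0 * braid R 3 1
  hecke : R * R = 1 + (q - q⁻¹) • R
  skewProj_succ : skewProj R q (p + 1) (p + 1) = 0
  rank_skewProj : (skewProj R q p p).rank = 1

end Tensor

/-! ### The quadratic-linear algebra -/

section Algebra

variable {𝕜 : Type*} [Field 𝕜] {n : ℕ}

/-- The `n × n` matrix of generators of the free algebra. -/
def freeGen (𝕜 : Type*) [Field 𝕜] (n : ℕ) :
    Matrix (Fin n) (Fin n) (FreeAlgebra 𝕜 (Fin n × Fin n)) :=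
  Matrix.of fun i j => FreeAlgebra.ι 𝕜 (i, j)

/-- The difference `R_12 L_1 R_12 L_1 - L_1 R_12 L_1 R_12` over the free algebra. -/
def quadraticPart (R : Matrix (Fin n × Fin n) (Fin n × Fin n) 𝕜) :
    Matrix (Fin n × Fin n) (Fin n × Fin n) (FreeAlgebra 𝕜 (Fin n × Fin n)) :=
  let Rf := R.map (algebraMap 𝕜 (FreeAlgebra 𝕜 (Fin n × Fin n)))
  let L₁ := freeGen 𝕜 n ⊗ₖ (1 : Matrix (Fin n) (Fin n) (FreeAlgebra 𝕜 (Fin n × Fin n)))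
  Rf * L₁ * Rf * L₁ - L₁ * Rf * L₁ * Rf

/-- The difference `R_12 L_1 - L_1 R_12` over the free algebra. -/
def linearPart (R : Matrix (Fin n × Fin n) (Fin n × Fin n) 𝕜) :
    Matrix (Fin n × Fin n) (Fin n × Fin n) (FreeAlgebra 𝕜 (Fin n × Fin n)) :=
  let Rf := R.map (algebraMap 𝕜 (FreeAlgebra 𝕜 (Fin n × Fin n)))
  let L₁ := freeGen 𝕜 n ⊗ₖ (1 : Matrix (Fin n) (Fin n) (FreeAlgebra 𝕜 (Fin n × Fin n)))
  Rf * L₁ - L₁ * Rf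

/-- The entries of the matrix relation
`R_12 L_1 R_12 L_1 - L_1 R_12 L_1 R_12 = ħ (R_12 L_1 - L_1 R_12)`. -/
inductive QLRel (R : Matrix (Fin n × Fin n) (Fin n × Fin n) 𝕜) (ħ : 𝕜) :
    FreeAlgebra 𝕜 (Fin n × Fin n) → FreeAlgebra 𝕜 (Fin n × Fin n) → Prop
  | entry (a b : Fin n × Fin n) : QLRel R ħ (quadraticPart R a b) (ħ • linearPart R a b)

/-- The two-parameter quadratic-linear algebra attached to `R` and `ħ`.
For `ħ = 0` it is the reflection equation algebra. -/
abbrev QLAlgebra (R : Matrix (Fin n × Fin n) (Fin n × Fin n) 𝕜) (ħ : 𝕜) : Type _ :=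
  RingQuot (QLRel R ħ)

/-- The matrix of generators of the quadratic-linear algebra. -/
def genMatrix (R : Matrix (Fin n × Fin n) (Fin n × Fin n) 𝕜) (ħ : 𝕜) :
    Matrix (Fin n) (Fin n) (QLAlgebra R ħ) :=
  (freeGen 𝕜 n).map (RingQuot.mkAlgHom 𝕜 (QLRel R ħ))

end Algebra

/-! ### The coefficients of the Cayley-Hamilton identity -/

section Coefficients

variable {𝕜 : Type*} [Field 𝕜] {n : ℕ} {A : Type*} [Ring A] [Algebra 𝕜 A]

/-- The string `R_1 R_2 ⋯ R_{k-1}` on `V ^ ⊗m`. -/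
def braidString (R : Matrix (Fin n × Fin n) (Fin n × Fin n) 𝕜) (m k : ℕ) :
    Matrix (Fin m → Fin n) (Fin m → Fin n) 𝕜 :=
  ((List.range (k - 1)).map (braid R m)).prod

/-- `σ_k(M) = q ^ (-k (p - k)) [p choose k]_q Tr_(1…p) P_-^(p) (M_1 R_1 ⋯ R_{k-1}) ^ k`,
for `k ≤ p`. -/
def sigma (R : Matrix (Fin n × Fin n) (Fin n × Fin n) 𝕜) (q : 𝕜) (p : ℕ)
    (M : Matrix (Fin n) (Fin n) A) (k : ℕ) : A :=
  ((q ^ (k * (p - k)))⁻¹ * qBinom q p k) •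
    Matrix.trace ((skewProj R q p p).map (algebraMap 𝕜 A) *
      (inFirst M p * (braidString R p k).map (algebraMap 𝕜 A)) ^ k)

/-- The sum `ξ_{s,k}`, for `k ≤ s ≤ p`. -/
def xi (q : 𝕜) (p s k : ℕ) : 𝕜 :=
  ∑ r ∈ Finset.range (s - k + 1),
    (-1) ^ r * (q ^ (r * (p - 1)))⁻¹ * ((s - r).choose k : 𝕜) * ((p - s + r).choose r : 𝕜) *
      qBinom q p (s - r)

/-- `ω_{s,k} = λ ^ (k - s) / [p choose s]_q * ξ_{s,k}` with `λ = q - q⁻¹`, for `k ≤ s ≤ p`. -/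
def omega (q : 𝕜) (p s k : ℕ) : 𝕜 :=
  ((q - q⁻¹) ^ (s - k))⁻¹ / qBinom q p s * xi q p s k

/-- The deformed coefficient `σ^(ħ)_j(M)`, for `j ≤ p`; with `j = p - k` it is
`σ_{p-k}(M) + ∑_{r=1}^{p-k} ħ ^ r ω_{r+k,k} σ_{p-k-r}(M)`. -/
def sigmaH (R : Matrix (Fin n × Fin n) (Fin n × Fin n) 𝕜) (q ħ : 𝕜) (p : ℕ)
    (M : Matrix (Fin n) (Fin n) A) (j : ℕ) : A :=
  sigma R q p M j +
    ∑ r ∈ Finset.Icc 1 j,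
      (ħ ^ r * omega q p (r + (p - j)) (p - j)) • sigma R q p M (j - r)

/-- The polynomial `(-X) ^ p + ∑_{k < p} (-X) ^ k c_{p-k}`. -/
def chPoly (p : ℕ) (c : ℕ → A) : Polynomial A :=
  (-Polynomial.X) ^ p + ∑ k ∈ Finset.range p, (-Polynomial.X) ^ k * Polynomial.C (c (p - k))

/-- The sum of `q ^ (∑ l_i - ∑ r_j) / (∏ (l_i)_q ∏ (r_j)_q)` over disjoint subsets
`{l_1 < … < l_a}` and `{r_1 < … < r_b}` of `{1, …, p - 1}`. -/
def pairSum (q : 𝕜) (p a b : ℕ) : 𝕜 :=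
  ∑ S ∈ (Finset.Icc 1 (p - 1)).powersetCard a,
    ∑ T ∈ (Finset.Icc 1 (p - 1)).powersetCard b with Disjoint S T,
      (∏ l ∈ S, q ^ l / qNum q l) * ∏ r ∈ T, (q ^ r)⁻¹ / qNum q r

end Coefficients

end QuantumMatrix

end

/-!
The operators `R_i` on a tensor power of `V` represent a Hecke algebra, and for a solution `M` of
the reflection equation the Jucys-Murphy elements `J_1 = M_1`, `J_{i+1} = R_i J_i R_i` commute
with one another (`IsHecke.jm_comm`; in the code they are numbered from `0`), while their
elementary symmetric polynomials `e_k(J_1, …, J_m)` commute with all `R_i`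
(`IsHecke.esymOrd_comm`).  This gives the structure behind the coefficients `σ_k`.

*The coefficients.*  The power `(M_1 R_1 ⋯ R_{k-1}) ^ k` is the product `J_1 ⋯ J_k`
(`IsHecke.string_pow`).  Next to the antisymmetrizer each `R_i` becomes `-q⁻¹`, so all monomials
of `e_k(J_1, …, J_p)` become proportional to `J_1 ⋯ J_k`, and their sum has precisely the factor
in the definition of `σ_k` (`IsHecke.mul_esymOrd_mul`).  As `P_-^(p) = u v` has rank one, `σ_k` is
the eigenvalue of `e_k(J_1, …, J_p)` on the skewsymmetric covector `v`
(`IsEvenHeckeSymmetry.rowLast_mul_esymOrd`).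

*The identity for `ħ = 0`.*  In `V ^ ⊗(p + 1)`, the characteristic identity
`∑ e_{p-k}(J_1, …, J_p) (-J_1) ^ k = 0` is taken between `v` in the first `p` factors, which turns
the symmetric polynomials into `σ_{p-k}`, and `u` in the last `p` factors, which leaves powers of
`-M`.  What is left over is the contraction of `v` with `u`, a matrix over the ground field, which
is invertible because `P_-^(p+1) = 0` (`IsSkewPair.contraction_mul_upTransport`).  This is
`IsEvenHeckeSymmetry.cayleyHamilton`.

*Centrality for `ħ = 0`.*  The element `e_{j+1}(J_1, …, J_{p+1})` commutes with the string
`R_1 ⋯ R_p`, which carries the skewsymmetric vector in the first `p` factors to the one in the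
last `p` factors.  Splitting off `J_{p+1}` on one side and `J_1` on the other gives
`σ_{j+1} + q ^ 2 σ_j M = D_{j+1} + M D_j`, where the `D_j` commute with `M` because they only
involve `J_2, …, J_{p+1}`. The factor `q ^ 2` is the product of the two transport matrices
(`IsSkewPair.downTransport_mul_upTransport`).  Hence `σ_j` commutes with `M`, by induction on `j`
(`IsEvenHeckeSymmetry.sigma_comm`).

*General `ħ`.*  By the Hecke condition, `M ↦ M - h` with `h = ħ / λ` turns solutions of the
relation with the parameter `ħ` into solutions of the reflection equation
(`SatisfiesQL.sub_smul_one`); this is the isomorphism `φ`.  Its effect on `J_1 ⋯ J_k` next to the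
antisymmetrizer is a binomial expansion (`IsEvenHeckeSymmetry.sigma_sub_smul`), and re-expanding
the identity in powers of `M` produces the numbers `ω` (`IsEvenHeckeSymmetry.sigmaH_eq_sum`).

*The numbers `ξ` and `ω`.*  Summing over the two binomial coefficients reduces the generating
function of `ξ` to the `q`-binomial theorem (`sum_xi_eq_prod`).  Read in a polynomial ring in two
variables, it yields the closed form of `ω` by comparison of coefficients (`omega_eq`): the
factors of the product are trinomials, whose expansion runs over pairs of disjoint subsets.
-/

namespace QuantumMatrix

/-! ### `q`-numbers -/

section QNumbers

variable {𝕜 : Type*} [Field 𝕜] {q : 𝕜}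

theorem qNum_zero (q : 𝕜) : qNum q 0 = 0 := by simp [qNum]

theorem qNum_succ (hq0 : q ≠ 0) (hq1 : q - q⁻¹ ≠ 0) (l : ℕ) :
    qNum q (l + 1) = q ^ l + q⁻¹ * qNum q l := by
  unfold qNum
  rw [div_eq_iff hq1, add_mul, ← mul_div_assoc, div_mul_cancel₀ _ hq1]
  field_simp
  ring

/-- For generic `q` the `q`-numbers do not vanish: `(l + 1)_q = 0` would give
`q ^ (2 * (l + 1)) = 1`. -/
theorem qNum_ne_zero (hq0 : q ≠ 0) (hq : ∀ r : ℤ, r ≠ 0 → q ^ r ≠ 1) (l : ℕ) :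
    qNum q (l + 1) ≠ 0 := by
  have key : ∀ m : ℕ, q ^ (m + 1) - (q ^ (m + 1))⁻¹ ≠ 0 := by
    intro m h
    have h2 : q ^ (m + 1) * q ^ (m + 1) = 1 := by
      have hm : q ^ (m + 1) ≠ 0 := pow_ne_zero _ hq0
      rw [sub_eq_zero] at h
      nth_rewrite 1 [h]
      exact inv_mul_cancel₀ hm
    apply hq ((m + 1 + (m + 1) : ℕ) : ℤ) (by omega)
    rw [zpow_natCast, pow_add, h2]
  have h1 := key 0
  rw [zero_add, pow_one] at h1
  exact div_ne_zero (key l) h1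

end QNumbers

/-! ### Antisymmetrizers in Hecke algebras -/

section Hecke

variable {𝕜 : Type*} [Field 𝕜] {B : Type*} [Ring B] [Algebra 𝕜 B] {q : 𝕜} {m : ℕ} {g : ℕ → B}

/-- The elements `g 0, …, g (m - 2)` satisfy the relations of the Hecke algebra on `m` strands,
with the eigenvalues `q` and `-q⁻¹`; the other values of `g` are not constrained. -/
structure IsHecke (q : 𝕜) (m : ℕ) (g : ℕ → B) : Prop where
  braid : ∀ i, i + 2 < m → g i * g (i + 1) * g i = g (i + 1) * g i * g (i + 1)
  comm : ∀ i j, i + 1 < j → j + 1 < m → g i * g j = g j * g i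
  quad : ∀ i, i + 1 < m → g i * g i = 1 + (q - q⁻¹) • g i

/-- The antisymmetrizer on the first `l` strands, by the recursion that defines `skewProj`. -/
def skew (q : 𝕜) (g : ℕ → B) : ℕ → B
  | 0 => 1
  | 1 => 1
  | l + 2 => (qNum q (l + 2))⁻¹ •
      (skew q g (l + 1) * (q ^ (l + 1) • (1 : B) - qNum q (l + 1) • g l) * skew q g (l + 1))

/-- The alternating sum `q ^ l - q ^ (l - 1) g_{l-1} + … ± g_{l-1} ⋯ g_0` over the shortest coset
representatives of `S_l` in `S_{l+1}`. -/
def cosetSum (q : 𝕜) (g : ℕ → B) : ℕ → B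
  | 0 => 1
  | l + 1 => q ^ (l + 1) • 1 - g l * cosetSum q g l

/-- The Hecke relations are invariant under reversal of products, so that each statement about
multiplication from one side yields the one for the other side. -/
theorem IsHecke.op (h : IsHecke q m g) : IsHecke q m (fun i => MulOpposite.op (g i)) := by
  refine ⟨fun i hi => ?_, fun i j hij hj => ?_, fun i hi => ?_⟩
  · simp only [← MulOpposite.op_mul, ← mul_assoc]
    rw [h.braid i hi]
  · simp only [← MulOpposite.op_mul]
    rw [h.comm i j hij hj]
  · simp only [← MulOpposite.op_mul, h.quad i hi, MulOpposite.op_add, MulOpposite.op_one,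
      MulOpposite.op_smul]

theorem skew_op (q : 𝕜) (g : ℕ → B) : ∀ l,
    skew q (fun i => MulOpposite.op (g i)) l = MulOpposite.op (skew q g l)
  | 0 => rfl
  | 1 => rfl
  | l + 2 => by
    rw [skew, skew, skew_op q g (l + 1)]
    simp only [MulOpposite.op_smul, MulOpposite.op_mul, MulOpposite.op_sub, MulOpposite.op_one,
      mul_assoc]

theorem map_skew {B' : Type*} [Ring B'] [Algebra 𝕜 B'] (f : B →ₐ[𝕜] B') (q : 𝕜) (g : ℕ → B) :
    ∀ l, f (skew q g l) = skew q (fun i => f (g i)) l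
  | 0 => by simp [skew]
  | 1 => by simp [skew]
  | l + 2 => by simp [skew, map_skew f q g (l + 1)]

theorem skew_congr {g' : ℕ → B} : ∀ l, (∀ i, i + 1 < l → g i = g' i) → skew q g l = skew q g' l
  | 0, _ => rfl
  | 1, _ => rfl
  | l + 2, h => by
    rw [skew, skew, skew_congr (l + 1) (fun i hi => h i (by omega)), h l (by omega)]

theorem IsHecke.comm_cosetSum (h : IsHecke q m g) {i : ℕ} (hi : i + 1 < m) :
    ∀ l, l < i → g i * cosetSum q g l = cosetSum q g l * g i
  | 0, _ => by simp [cosetSum]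
  | l + 1, hl => by
    have h1 := h.comm l i (by omega) hi
    have h2 := h.comm_cosetSum hi l (by omega)
    rw [cosetSum, mul_sub, sub_mul, ← mul_assoc, ← h1, mul_assoc, h2]
    simp [mul_assoc]

/-- An element on which the first strands act on the right by the sign character keeps this
property, with one more strand, after multiplication by the coset sum. -/
theorem IsHecke.mul_cosetSum_mul (h : IsHecke q m g) (hq0 : q ≠ 0) : ∀ (l : ℕ), l + 1 ≤ m →
    ∀ X : B, (∀ i, i + 1 < l → X * g i = (-q⁻¹) • X) →
      ∀ i, i < l → X * cosetSum q g l * g i = (-q⁻¹) • (X * cosetSum q g l)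
  | 0, _, _, _, i, hi => by omega
  | l + 1, hl, X, hX, i, hi => by
    rcases Nat.lt_succ_iff_lt_or_eq.mp hi with hi' | rfl
    · have hX' : ∀ j, j + 1 < l → (X * g l) * g j = (-q⁻¹) • (X * g l) := by
        intro j hj
        rw [mul_assoc, ← h.comm j l hj (by omega), ← mul_assoc, hX j (by omega), smul_mul_assoc]
      have := h.mul_cosetSum_mul hq0 l (by omega) (X * g l) hX' i hi'
      rw [cosetSum, mul_sub, sub_mul, ← mul_assoc, this, mul_smul_comm, mul_one, smul_mul_assoc,
        hX i (by omega), smul_comm, smul_sub]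
    · have hquad := h.quad i (by omega)
      have key : X * g i * g i = X + (q - q⁻¹) • (X * g i) := by
        rw [mul_assoc, hquad, mul_add, mul_one, mul_smul_comm]
      rcases i with _ | i
      · simp only [cosetSum, zero_add, pow_one, mul_one, mul_sub, sub_mul, mul_smul_comm,
          smul_mul_assoc, key]
        have : q * q⁻¹ = 1 := mul_inv_cancel₀ hq0
        linear_combination (norm := module) this • X
      · have hc := h.comm_cosetSum (i := i + 1) (by omega) i (by omega)
        have hb := h.braid i (by omega)
        have h3 : X * g (i + 1) * (g i * cosetSum q g i) * g (i + 1)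
            = (-q⁻¹) • (X * g (i + 1) * (g i * cosetSum q g i)) := by
          calc X * g (i + 1) * (g i * cosetSum q g i) * g (i + 1)
              = X * (g (i + 1) * g i * (cosetSum q g i * g (i + 1))) := by
                simp only [mul_assoc]
            _ = X * (g (i + 1) * g i * g (i + 1)) * cosetSum q g i := by
                rw [← hc]; simp only [mul_assoc]
            _ = X * g i * (g (i + 1) * g i) * cosetSum q g i := by
                rw [← hb]; simp only [mul_assoc]
            _ = _ := by
                rw [hX i (by omega)]
                simp only [smul_mul_assoc, mul_assoc]
        rw [cosetSum, cosetSum]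
        simp only [mul_sub, sub_mul, mul_smul_comm, smul_mul_assoc, mul_one, ← mul_assoc, key]
          at h3 ⊢
        rw [h3]
        have : q * q⁻¹ = 1 := mul_inv_cancel₀ hq0
        linear_combination (norm := module) (q ^ (i + 1) * this) • X

/-- The coset sum acts on an element that absorbs its generators by the value of its sign
character. -/
theorem cosetSum_mul (hq0 : q ≠ 0) (hq1 : q - q⁻¹ ≠ 0) {Y : B} : ∀ l : ℕ,
    (∀ i, i < l → g i * Y = (-q⁻¹) • Y) → cosetSum q g l * Y = qNum q (l + 1) • Y
  | 0, _ => by simp [cosetSum, qNum, div_self hq1]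
  | l + 1, hY => by
    rw [cosetSum, sub_mul, mul_assoc, cosetSum_mul hq0 hq1 l (fun i hi => hY i (by omega)),
      mul_smul_comm, hY l (by omega), qNum_succ hq0 hq1 (l + 1), smul_mul_assoc, one_mul]
    module

/-- The antisymmetrizer fixes the elements on which the generators act by `-q⁻¹`. -/
theorem mul_skew (hq0 : q ≠ 0) (hqn : ∀ r, qNum q (r + 1) ≠ 0) (hq1 : q - q⁻¹ ≠ 0) {X : B} :
    ∀ l : ℕ, (∀ i, i + 1 < l → X * g i = (-q⁻¹) • X) → X * skew q g l = X
  | 0, _ => by simp [skew]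
  | 1, _ => by simp [skew]
  | l + 2, hX => by
    have ih := mul_skew hq0 hqn hq1 (l + 1) (fun i hi => hX i (by omega))
    rw [skew, mul_smul_comm, ← mul_assoc, ← mul_assoc, ih, mul_sub, mul_smul_comm, mul_one,
      mul_smul_comm, hX l (by omega), smul_smul, ← sub_smul, smul_mul_assoc, ih, smul_smul]
    have : (qNum q (l + 2))⁻¹ * (q ^ (l + 1) - qNum q (l + 1) * -q⁻¹) = 1 := by
      rw [inv_mul_eq_one₀ (hqn (l + 1)), qNum_succ hq0 hq1 (l + 1)]
      ring
    rw [this, one_smul]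

/-- The induction step for `IsHecke.skew_absorb`: between two shorter antisymmetrizers, the factor
`q ^ l - l_q g_{l-1}` of the recursion may be replaced by the whole coset sum. -/
theorem IsHecke.skew_step (h : IsHecke q m g) (hq0 : q ≠ 0) (hqn : ∀ r, qNum q (r + 1) ≠ 0)
    (hq1 : q - q⁻¹ ≠ 0) (l : ℕ) (hl : l + 2 ≤ m)
    (hr : ∀ i, i + 1 < l + 1 → skew q g (l + 1) * g i = (-q⁻¹) • skew q g (l + 1))
    (hll : ∀ i, i + 1 < l + 1 → g i * skew q g (l + 1) = (-q⁻¹) • skew q g (l + 1)) :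
    ∀ i, i + 1 < l + 2 → skew q g (l + 2) * g i = (-q⁻¹) • skew q g (l + 2) := by
  have habs := h.mul_cosetSum_mul hq0 (l + 1) (by omega) (skew q g (l + 1))
    (fun i hi => hr i (by omega))
  have h2 : (q ^ (l + 1) • (1 : B) - qNum q (l + 1) • g l) * skew q g (l + 1)
      = cosetSum q g (l + 1) * skew q g (l + 1) := by
    rw [cosetSum, sub_mul, sub_mul, mul_assoc,
      cosetSum_mul hq0 hq1 l (fun i hi => hll i (by omega)), smul_mul_assoc, smul_mul_assoc,
      mul_smul_comm]
  have h1 : skew q g (l + 2)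
      = (qNum q (l + 2))⁻¹ • (skew q g (l + 1) * cosetSum q g (l + 1)) := by
    rw [skew, mul_assoc, h2, ← mul_assoc,
      mul_skew hq0 hqn hq1 (l + 1) (fun i hi => habs i (by omega))]
  intro i hi
  rw [h1, smul_mul_assoc, habs i (by omega), smul_comm]

/-- The generators act on the antisymmetrizer by `-q⁻¹`, from either side. -/
theorem IsHecke.skew_absorb (h : IsHecke q m g) (hq0 : q ≠ 0) (hqn : ∀ r, qNum q (r + 1) ≠ 0)
    (hq1 : q - q⁻¹ ≠ 0) : ∀ l, l ≤ m →
    (∀ i, i + 1 < l → skew q g l * g i = (-q⁻¹) • skew q g l) ∧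
    (∀ i, i + 1 < l → g i * skew q g l = (-q⁻¹) • skew q g l)
  | 0, _ => ⟨fun i hi => by omega, fun i hi => by omega⟩
  | 1, _ => ⟨fun i hi => by omega, fun i hi => by omega⟩
  | l + 2, hl => by
    obtain ⟨h1, h2⟩ := h.skew_absorb hq0 hqn hq1 (l + 1) (by omega)
    refine ⟨h.skew_step hq0 hqn hq1 l hl h1 h2, fun i hi => ?_⟩
    have := h.op.skew_step hq0 hqn hq1 l hl
      (fun i hi => by rw [skew_op, ← MulOpposite.op_mul, h2 i hi, MulOpposite.op_smul])
      (fun i hi => by rw [skew_op, ← MulOpposite.op_mul, h1 i hi, MulOpposite.op_smul]) i hi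
    rw [skew_op, ← MulOpposite.op_mul, ← MulOpposite.op_smul] at this
    exact MulOpposite.op_injective this

end Hecke

/-! ### Jucys-Murphy elements -/

section Affine

variable {𝕜 : Type*} [Field 𝕜] {B : Type*} [Ring B] [Algebra 𝕜 B] {q : 𝕜} {m : ℕ} {g : ℕ → B}
  {L : B}

/-- The Jucys-Murphy elements `J_0 = L`, `J_{i+1} = g_i J_i g_i`. -/
def jm (g : ℕ → B) (L : B) : ℕ → B
  | 0 => L
  | i + 1 => g i * jm g L i * g i

/-- The ordered product `J_0 J_1 ⋯ J_{k-1}` of Jucys-Murphy elements. -/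
def jmProd (g : ℕ → B) (L : B) : ℕ → B
  | 0 => 1
  | k + 1 => jmProd g L k * jm g L k

/-- The string `g_0 g_1 ⋯ g_{k-1}`. -/
def upString (g : ℕ → B) : ℕ → B
  | 0 => 1
  | k + 1 => upString g k * g k

/-- The string `g_{k-1} g_{k-2} ⋯ g_{k-j}` of length `j`, for `j ≤ k`. -/
def downString (g : ℕ → B) : ℕ → ℕ → B
  | _, 0 => 1
  | 0, _ + 1 => 1
  | k + 1, j + 1 => g k * downString g k j

/-- The elementary symmetric polynomial of degree `j` in `f 0, …, f (m - 1)`, each monomial being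
multiplied in increasing order. -/
def esymOrd (f : ℕ → B) : ℕ → ℕ → B
  | _, 0 => 1
  | 0, _ + 1 => 0
  | m + 1, j + 1 => esymOrd f m (j + 1) + esymOrd f m j * f m

theorem jm_eq_strings (g : ℕ → B) (L : B) : ∀ k,
    jm g L k = downString g k k * L * upString g k
  | 0 => by simp [jm, downString, upString]
  | k + 1 => by
    rw [jm, jm_eq_strings g L k, downString, upString]
    simp only [mul_assoc]

theorem IsHecke.comm_upString (h : IsHecke q m g) {i : ℕ} (hi : i + 1 < m) :
    ∀ k, k < i → g i * upString g k = upString g k * g i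
  | 0, _ => by simp [upString]
  | k + 1, hk => by
    rw [upString, ← mul_assoc, h.comm_upString hi k (by omega), mul_assoc,
      ← h.comm k i (by omega) hi, mul_assoc]

theorem IsHecke.comm_downString (h : IsHecke q m g) {i : ℕ} (hi : i + 1 < m) :
    ∀ k j, k < i → g i * downString g k j = downString g k j * g i
  | _, 0, _ => by simp [downString]
  | 0, j + 1, _ => by simp [downString]
  | k + 1, j + 1, hk => by
    rw [downString, ← mul_assoc, ← h.comm k i (by omega) hi, mul_assoc,
      h.comm_downString hi k j (by omega), mul_assoc]

/-- Conjugation by a string shifts the indices of the generators. -/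
theorem IsHecke.mul_upString (h : IsHecke q m g) : ∀ k i, i + 1 < k → k < m →
    g (i + 1) * upString g k = upString g k * g i
  | 0, _, h1, _ => by omega
  | k + 1, i, h1, h2 => by
    rcases Nat.lt_or_ge (i + 1) k with h3 | h3
    · rw [upString, ← mul_assoc, h.mul_upString k i h3 (by omega), mul_assoc,
        h.comm i k h3 (by omega), mul_assoc]
    · obtain rfl : k = i + 1 := by omega
      rw [upString, upString]
      calc g (i + 1) * (upString g i * g i * g (i + 1))
          = g (i + 1) * upString g i * (g i * g (i + 1)) := by simp only [mul_assoc]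
        _ = upString g i * (g (i + 1) * g i * g (i + 1)) := by
          rw [h.comm_upString (by omega) i (by omega)]; simp only [mul_assoc]
        _ = _ := by rw [← h.braid i (by omega)]; simp only [mul_assoc]

theorem IsHecke.downString_mul (h : IsHecke q m g) : ∀ k i, i + 1 < k → k < m →
    g i * downString g k k = downString g k k * g (i + 1)
  | 0, _, h1, _ => by omega
  | k + 1, i, h1, h2 => by
    rcases Nat.lt_or_ge (i + 1) k with h3 | h3
    · rw [downString, ← mul_assoc, h.comm i k h3 (by omega), mul_assoc,
        h.downString_mul k i h3 (by omega), mul_assoc]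
    · obtain rfl : k = i + 1 := by omega
      rw [downString, downString]
      calc g i * (g (i + 1) * (g i * downString g i i))
          = g i * g (i + 1) * g i * downString g i i := by simp only [mul_assoc]
        _ = g (i + 1) * g i * (g (i + 1) * downString g i i) := by
          rw [h.braid i (by omega)]; simp only [mul_assoc]
        _ = _ := by rw [h.comm_downString (by omega) i i (by omega)]; simp only [mul_assoc]

theorem IsHecke.jm_comm_far (h : IsHecke q m g)
    (hL : ∀ i, 1 ≤ i → i + 1 < m → L * g i = g i * L) {i : ℕ} (hi : i + 1 < m) :
    ∀ k, k < i → Commute (jm g L k) (g i)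
  | 0, hk => hL i hk hi
  | k + 1, hk => by
    have h1 : Commute (g k) (g i) := h.comm k i hk hi
    exact (h1.mul_left (h.jm_comm_far hL hi k (by omega))).mul_left h1

/-- `J_k` commutes with the generators `g_i` for `i + 1 < k`; only `g_{k-1}` and `g_k` move it. -/
theorem IsHecke.jm_comm_near (h : IsHecke q m g)
    (hL : ∀ i, 1 ≤ i → i + 1 < m → L * g i = g i * L) : ∀ k i, i + 1 < k → k < m →
    Commute (jm g L k) (g i)
  | 0, _, h1, _ => by omega
  | k + 1, i, h1, h2 => by
    rcases Nat.lt_or_ge (i + 1) k with h3 | h3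
    · have h4 : Commute (g k) (g i) := (h.comm i k h3 (by omega)).symm
      exact (h4.mul_left (h.jm_comm_near hL k i h3 (by omega))).mul_left h4
    · obtain rfl : k = i + 1 := by omega
      have h5 := (h.jm_comm_far hL (i := i + 1) (by omega) i (by omega)).eq
      have hb := h.braid i (by omega)
      change g (i + 1) * (g i * jm g L i * g i) * g (i + 1) * g i
        = g i * (g (i + 1) * (g i * jm g L i * g i) * g (i + 1))
      calc g (i + 1) * (g i * jm g L i * g i) * g (i + 1) * g i
          = g (i + 1) * g i * jm g L i * (g i * g (i + 1) * g i) := by simp only [mul_assoc]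
        _ = g (i + 1) * g i * (jm g L i * g (i + 1)) * (g i * g (i + 1)) := by
          rw [hb]; simp only [mul_assoc]
        _ = (g (i + 1) * g i * g (i + 1)) * jm g L i * (g i * g (i + 1)) := by
          rw [h5]; simp only [mul_assoc]
        _ = _ := by rw [← hb]; simp only [mul_assoc]

theorem IsHecke.jmProd_comm_far (h : IsHecke q m g)
    (hL : ∀ i, 1 ≤ i → i + 1 < m → L * g i = g i * L) {i : ℕ} (hi : i + 1 < m) :
    ∀ k, k ≤ i → Commute (jmProd g L k) (g i)
  | 0, _ => Commute.one_left _
  | k + 1, hk => (h.jmProd_comm_far hL hi k (by omega)).mul_left (h.jm_comm_far hL hi k (by omega))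

theorem IsHecke.downString_comm (h : IsHecke q m g)
    (hL : ∀ i, 1 ≤ i → i + 1 < m → L * g i = g i * L) : ∀ k j, j < k → k < m →
    downString g k j * L = L * downString g k j
  | _, 0, _, _ => by simp [downString]
  | 0, j + 1, h1, _ => by omega
  | k + 1, j + 1, h1, h2 => by
    rw [downString, mul_assoc, h.downString_comm hL k j (by omega) (by omega), ← mul_assoc,
      ← hL k (by omega) (by omega), mul_assoc]

/-- A string running down passes through a longer one running up, its indices being lowered by
one. -/
theorem IsHecke.downString_mul_upString (h : IsHecke q m g) : ∀ k j, j ≤ k → k + 1 < m →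
    downString g (k + 1) j * upString g (k + 1) = upString g (k + 1) * downString g k j
  | _, 0, _, _ => by simp [downString]
  | 0, j + 1, h1, _ => by omega
  | k + 1, j + 1, h1, h2 => by
    have h3 := h.downString_mul_upString k j (by omega) (by omega)
    have h4 := h.comm_downString (i := k + 1) (by omega) k j (by omega)
    have h5 := h.mul_upString (k + 2) k (by omega) (by omega)
    rw [downString, upString]
    calc g (k + 1) * downString g (k + 1) j * (upString g (k + 1) * g (k + 1))
        = g (k + 1) * (downString g (k + 1) j * upString g (k + 1)) * g (k + 1) := by
          simp only [mul_assoc]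
      _ = g (k + 1) * upString g (k + 1) * (downString g k j * g (k + 1)) := by
          rw [h3]; simp only [mul_assoc]
      _ = g (k + 1) * upString g (k + 2) * downString g k j := by
          rw [← h4, show upString g (k + 2) = upString g (k + 1) * g (k + 1) from rfl]
          simp only [mul_assoc]
      _ = _ := by
          rw [h5, show upString g (k + 2) = upString g (k + 1) * g (k + 1) from rfl, downString,
            upString]
          simp only [mul_assoc]

/-- Powers of strings of consecutive lengths are compared by collecting the additional generators on
the right. -/
theorem IsHecke.string_pow_aux (h : IsHecke q m g)
    (hL : ∀ i, 1 ≤ i → i + 1 < m → L * g i = g i * L) {k : ℕ} (hk : k + 1 < m) :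
    ∀ j, j ≤ k + 1 →
      (L * upString g (k + 1)) ^ j = (L * upString g k) ^ j * downString g (k + 1) j
  | 0, _ => by simp [downString]
  | j + 1, hj => by
    rw [pow_succ, h.string_pow_aux hL hk j (by omega), pow_succ]
    calc (L * upString g k) ^ j * downString g (k + 1) j * (L * upString g (k + 1))
        = (L * upString g k) ^ j * (downString g (k + 1) j * L) * upString g (k + 1) := by
          simp only [mul_assoc]
      _ = (L * upString g k) ^ j * L * (downString g (k + 1) j * upString g (k + 1)) := by
          rw [h.downString_comm hL (k + 1) j (by omega) hk]; simp only [mul_assoc]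
      _ = _ := by
          rw [h.downString_mul_upString k j (by omega) hk, upString, downString]
          simp only [mul_assoc]

/-- The power of a string that enters the definition of `sigma` is a product of Jucys-Murphy
elements.  This only needs `L` to commute with the generators beyond the first one. -/
theorem IsHecke.string_pow (h : IsHecke q m g)
    (hL : ∀ i, 1 ≤ i → i + 1 < m → L * g i = g i * L) : ∀ k, k ≤ m →
    (L * upString g (k - 1)) ^ k = jmProd g L k
  | 0, _ => by simp [jmProd]
  | 1, _ => by simp [jmProd, upString, jm]
  | k + 2, hk => by
    have ih := h.string_pow hL (k + 1) (by omega)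
    simp only [Nat.add_sub_cancel] at ih
    change (L * upString g (k + 1)) ^ (k + 1 + 1) = _
    rw [pow_succ, h.string_pow_aux hL (by omega) (k + 1) le_rfl, ih,
      show jmProd g L (k + 2) = jmProd g L (k + 1) * jm g L (k + 1) from rfl, jm_eq_strings]
    simp only [mul_assoc]

/-- Between elements that absorb the generators, the Jucys-Murphy element `J_k` may be replaced by
`J_j`, at the cost of a power of `q`. -/
theorem IsHecke.jmProd_slide (h : IsHecke q m g)
    (hL : ∀ i, 1 ≤ i → i + 1 < m → L * g i = g i * L) {X : B}
    (hX : ∀ i, i + 1 < m → X * g i = (-q⁻¹) • X) (j : ℕ) : ∀ d, j + d < m → ∀ Y : B,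
    (∀ i, i < j + d → g i * Y = (-q⁻¹) • Y) →
    X * (jmProd g L j * jm g L (j + d)) * Y = ((q⁻¹) ^ 2) ^ d • (X * jmProd g L (j + 1) * Y)
  | 0, _, Y, _ => by simp [jmProd]
  | d + 1, hd, Y, hY => by
    have ih := h.jmProd_slide hL hX j d (by omega) Y (fun i hi => hY i (by omega))
    have h1 := (h.jmProd_comm_far hL (i := j + d) (by omega) j (by omega)).eq
    change X * (jmProd g L j * (g (j + d) * jm g L (j + d) * g (j + d))) * Y = _
    calc X * (jmProd g L j * (g (j + d) * jm g L (j + d) * g (j + d))) * Y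
        = X * (jmProd g L j * g (j + d)) * jm g L (j + d) * (g (j + d) * Y) := by
          simp only [mul_assoc]
      _ = (-q⁻¹) • (X * g (j + d) * (jmProd g L j * jm g L (j + d)) * Y) := by
          rw [h1, hY (j + d) (by omega), mul_smul_comm]; simp only [mul_assoc]
      _ = _ := by
          rw [hX (j + d) (by omega), smul_mul_assoc, smul_mul_assoc, ih, smul_smul, smul_smul]
          ring_nf

theorem jm_smul_sub (g : ℕ → B) (L : B) (c : 𝕜) : ∀ k,
    jm g (L - c • 1) k = jm g L k - c • jm g 1 k
  | 0 => by simp [jm]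
  | k + 1 => by
    rw [jm, jm_smul_sub g L c k, jm, jm]
    simp only [mul_sub, sub_mul, mul_smul_comm, smul_mul_assoc]

/-- For `L = 1`, the Jucys-Murphy element `J_k` is a palindrome of `2 k` generators, which
contribute `-q⁻¹` each. -/
theorem jm_one_mul {Y : B} : ∀ k, (∀ i, i < k → g i * Y = (-q⁻¹) • Y) →
    jm g 1 k * Y = ((q⁻¹) ^ 2) ^ k • Y
  | 0, _ => by simp [jm]
  | k + 1, hY => by
    rw [jm, mul_assoc, hY k (by omega), mul_smul_comm, mul_assoc,
      jm_one_mul k (fun i hi => hY i (by omega)), mul_smul_comm, hY k (by omega), smul_smul,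
      smul_smul]
    ring_nf

end Affine

/-! ### `q`-binomial coefficients -/

section QNumbers

variable {𝕜 : Type*} [Field 𝕜] {q : 𝕜}

theorem qFact_succ (q : 𝕜) (r : ℕ) : qFact q (r + 1) = qFact q r * qNum q (r + 1) := by
  rw [qFact, Finset.prod_range_succ]; rfl

theorem qFact_ne_zero (hqn : ∀ r, qNum q (r + 1) ≠ 0) (r : ℕ) : qFact q r ≠ 0 :=
  Finset.prod_ne_zero_iff.mpr fun i _ => hqn i

theorem qBinom_ne_zero (hqn : ∀ r, qNum q (r + 1) ≠ 0) (p k : ℕ) : qBinom q p k ≠ 0 :=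
  div_ne_zero (qFact_ne_zero hqn _) (mul_ne_zero (qFact_ne_zero hqn _) (qFact_ne_zero hqn _))

theorem qBinom_zero (hqn : ∀ r, qNum q (r + 1) ≠ 0) (p : ℕ) : qBinom q p 0 = 1 := by
  simp [qBinom, qFact, div_self (show ∏ i ∈ Finset.range p, qNum q (i + 1) ≠ 0 from
    qFact_ne_zero hqn p)]

theorem qBinom_self (hqn : ∀ r, qNum q (r + 1) ≠ 0) (p : ℕ) : qBinom q p p = 1 := by
  simp [qBinom, qFact, div_self (show ∏ i ∈ Finset.range p, qNum q (i + 1) ≠ 0 from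
    qFact_ne_zero hqn p)]

theorem qNum_add (hq0 : q ≠ 0) (a b : ℕ) :
    qNum q (a + b) = q ^ a * qNum q b + (q ^ b)⁻¹ * qNum q a := by
  unfold qNum
  rw [← mul_div_assoc, ← mul_div_assoc, ← add_div]
  congr 1
  field_simp
  ring

/-- The `q`-Pascal rule. -/
theorem qBinom_succ_succ (hq0 : q ≠ 0) (hqn : ∀ r, qNum q (r + 1) ≠ 0) {m j : ℕ} (hj : j < m) :
    qBinom q (m + 1) (j + 1) =
      q ^ (j + 1) * qBinom q m (j + 1) + (q ^ (m - j))⁻¹ * qBinom q m j := by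
  obtain ⟨d, rfl⟩ : ∃ d, m = j + 1 + d := ⟨m - (j + 1), by omega⟩
  have h1 := qNum_add hq0 (j + 1) (d + 1)
  rw [show j + 1 + (d + 1) = j + 1 + d + 1 by ring] at h1
  have h2 : j + 1 + d - j = d + 1 := by omega
  have h3 : j + 1 + d + 1 - (j + 1) = d + 1 := by omega
  rw [qBinom, qBinom, qBinom, h2, h3, Nat.add_sub_cancel_left, qFact_succ q (j + 1 + d), h1,
    qFact_succ q j, qFact_succ q d]
  have h4 := qFact_ne_zero hqn j
  have h5 := qFact_ne_zero hqn d
  have h6 := hqn j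
  have h7 := hqn d
  field_simp

end QNumbers

/-! ### Elementary symmetric polynomials of the Jucys-Murphy elements -/

section Affine

variable {𝕜 : Type*} [Field 𝕜] {B : Type*} [Ring B] [Algebra 𝕜 B] {q : 𝕜} {m : ℕ} {g : ℕ → B}
  {L : B}

theorem esymOrd_zero (f : ℕ → B) (l : ℕ) : esymOrd f l 0 = 1 := by cases l <;> rfl

theorem esymOrd_eq_zero (f : ℕ → B) : ∀ l j, l < j → esymOrd f l j = 0
  | _, 0, h => by omega
  | 0, j + 1, _ => rfl
  | l + 1, j + 1, h => by
    rw [esymOrd, esymOrd_eq_zero f l (j + 1) (by omega), esymOrd_eq_zero f l j (by omega), zero_mul,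
      add_zero]

theorem esymOrd_self (g : ℕ → B) (L : B) : ∀ l, esymOrd (jm g L) l l = jmProd g L l
  | 0 => rfl
  | l + 1 => by rw [esymOrd, esymOrd_eq_zero _ _ _ l.lt_succ_self, esymOrd_self, zero_add, jmProd]

/-- The recursion of `esymOrd` at the first variable instead of the last one. -/
theorem esymOrd_succ' (f : ℕ → B) : ∀ l j, esymOrd f (l + 1) (j + 1) =
    esymOrd (fun i => f (i + 1)) l (j + 1) + f 0 * esymOrd (fun i => f (i + 1)) l j
  | 0, 0 => by simp [esymOrd]
  | 0, j + 1 => by simp [esymOrd]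
  | l + 1, 0 => by
    have h1 := esymOrd_succ' f l 0
    have h2 : esymOrd f (l + 2) 1 = esymOrd f (l + 1) 1 + esymOrd f (l + 1) 0 * f (l + 1) := rfl
    have h3 : esymOrd (fun i => f (i + 1)) (l + 1) 1 = esymOrd (fun i => f (i + 1)) l 1 +
        esymOrd (fun i => f (i + 1)) l 0 * f (l + 1) := rfl
    simp only [zero_add, esymOrd_zero, one_mul, mul_one] at h1 h2 h3 ⊢
    rw [h2, h1, h3]
    abel
  | l + 1, j + 1 => by
    rw [esymOrd, esymOrd_succ' f l (j + 1), esymOrd_succ' f l j, esymOrd, esymOrd]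
    noncomm_ring

theorem map_jm {B' : Type*} [Ring B'] (f : B →+* B') (g : ℕ → B) (L : B) : ∀ k,
    f (jm g L k) = jm (fun i => f (g i)) (f L) k
  | 0 => rfl
  | k + 1 => by simp [jm, map_jm f g L k]

theorem map_esymOrd {B' : Type*} [Ring B'] (f : B →+* B') (x : ℕ → B) : ∀ l j,
    f (esymOrd x l j) = esymOrd (fun i => f (x i)) l j
  | _, 0 => by simp [esymOrd_zero]
  | 0, j + 1 => by simp [esymOrd]
  | l + 1, j + 1 => by simp [esymOrd, map_esymOrd f x l]

theorem jm_congr {g' : ℕ → B} : ∀ k, (∀ i, i < k → g i = g' i) → jm g L k = jm g' L k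
  | 0, _ => rfl
  | k + 1, h => by rw [jm, jm, jm_congr k (fun i hi => h i (by omega)), h k (by omega)]

theorem esymOrd_congr {f f' : ℕ → B} : ∀ l j, (∀ i, i < l → f i = f' i) →
    esymOrd f l j = esymOrd f' l j
  | _, 0, _ => by rw [esymOrd_zero, esymOrd_zero]
  | 0, j + 1, _ => rfl
  | l + 1, j + 1, h => by
    rw [esymOrd, esymOrd, esymOrd_congr l _ (fun i hi => h i (by omega)),
      esymOrd_congr l _ (fun i hi => h i (by omega)), h l (by omega)]

/-- Between elements that absorb the generators, all monomials of the elementary symmetric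
polynomial of the Jucys-Murphy elements become proportional to the leading one. -/
theorem IsHecke.mul_esymOrd_mul (h : IsHecke q m g) (hq0 : q ≠ 0)
    (hqn : ∀ r, qNum q (r + 1) ≠ 0)
    (hL : ∀ i, 1 ≤ i → i + 1 < m → L * g i = g i * L) {X : B}
    (hX : ∀ i, i + 1 < m → X * g i = (-q⁻¹) • X) : ∀ l j, j ≤ l → l ≤ m → ∀ Y : B,
    (∀ i, i + 1 < l → g i * Y = (-q⁻¹) • Y) →
    X * esymOrd (jm g L) l j * Y =
      ((q ^ (j * (l - j)))⁻¹ * qBinom q l j) • (X * jmProd g L j * Y)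
  | l, 0, _, _, Y, _ => by simp [esymOrd_zero, jmProd, qBinom_zero hqn]
  | 0, j + 1, hj, _, _, _ => by omega
  | l + 1, j + 1, hj, hl, Y, hY => by
    rcases Nat.lt_or_ge j l with hjl | hjl
    · have h1 := h.mul_esymOrd_mul hq0 hqn hL hX l (j + 1) (by omega) (by omega) Y
        (fun i hi => hY i (by omega))
      have h2 : X * (esymOrd (jm g L) l j * jm g L l) * Y =
          ((q ^ (j * (l - j)))⁻¹ * qBinom q l j) • (X * jmProd g L j * (jm g L l * Y)) := by
        rw [← h.mul_esymOrd_mul hq0 hqn hL hX l j (by omega) (by omega) (jm g L l * Y)]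
        · simp only [mul_assoc]
        · intro i hi
          rw [← mul_assoc, ← (h.jm_comm_near hL l i hi (by omega)).eq, mul_assoc,
            hY i (by omega), mul_smul_comm]
      have h3 := h.jmProd_slide hL hX j (l - j) (by omega) Y (fun i hi => hY i (by omega))
      rw [show j + (l - j) = l by omega] at h3
      have h4 : X * jmProd g L j * (jm g L l * Y) =
          ((q⁻¹) ^ 2) ^ (l - j) • (X * jmProd g L (j + 1) * Y) := by
        rw [← h3]; simp only [mul_assoc]
      rw [esymOrd, mul_add, add_mul, h1, h2, h4, smul_smul, ← add_smul]
      congr 1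
      rw [qBinom_succ_succ hq0 hqn hjl]
      obtain ⟨d, rfl⟩ : ∃ d, l = j + 1 + d := ⟨l - (j + 1), by omega⟩
      have e1 : j + 1 + d - j = d + 1 := by omega
      have e2 : j + 1 + d + 1 - (j + 1) = d + 1 := by omega
      rw [e1, e2, Nat.add_sub_cancel_left]
      simp only [inv_pow]
      field_simp
      ring
    · obtain rfl : j = l := by omega
      rw [esymOrd_self]
      simp [qBinom_self hqn]

/-- The rearrangement of sums behind the induction step of `IsHecke.mul_jmProd_shift_mul`. -/
theorem sum_smul_shift {k : ℕ} (b b' s : ℕ → 𝕜) (d : 𝕜) (F : ℕ → B) (h0 : b' 0 = -(d * b 0))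
    (hs : ∀ j, j ≤ k → b' (j + 1) = b j * s j - d * b (j + 1)) (hk : b (k + 1) = 0) :
    ∑ j ∈ Finset.range (k + 1), b j • (s j • F (j + 1) - d • F j) =
      ∑ j ∈ Finset.range (k + 1 + 1), b' j • F j := by
  have h1 : ∑ j ∈ Finset.range (k + 1), (d * b j) • F j =
      ∑ j ∈ Finset.range (k + 1), (d * b (j + 1)) • F (j + 1) + (d * b 0) • F 0 := by
    rw [← Finset.sum_range_succ' (fun j => (d * b j) • F j), Finset.sum_range_succ _ (k + 1), hk,
      mul_zero, zero_smul, add_zero]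
  have h2 : ∑ j ∈ Finset.range (k + 1), b j • (s j • F (j + 1) - d • F j) =
      ∑ j ∈ Finset.range (k + 1), (b j * s j) • F (j + 1) -
        ∑ j ∈ Finset.range (k + 1), (d * b j) • F j := by
    rw [← Finset.sum_sub_distrib]
    exact Finset.sum_congr rfl fun j _ => by module
  have h3 : ∑ j ∈ Finset.range (k + 1), b' (j + 1) • F (j + 1) =
      ∑ j ∈ Finset.range (k + 1), (b j * s j) • F (j + 1) -
        ∑ j ∈ Finset.range (k + 1), (d * b (j + 1)) • F (j + 1) := by
    rw [← Finset.sum_sub_distrib]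
    exact Finset.sum_congr rfl fun j hj => by
      rw [hs j (Nat.lt_succ_iff.mp (Finset.mem_range.mp hj))]; module
  rw [Finset.sum_range_succ' _ (k + 1), h2, h1, h3, h0]
  module

/-- The effect on a product of Jucys-Murphy elements of shifting `L` by a scalar.  The elements `X`
and `Y` absorb generators, so that the shifted factor `J_k - c J_k(1)`, where `J_k(1)` belongs to
`L = 1`, contributes `J_j` and `c` with powers of `q` only. -/
theorem IsHecke.mul_jmProd_shift_mul (h : IsHecke q m g) (hq0 : q ≠ 0)
    (hL : ∀ i, 1 ≤ i → i + 1 < m → L * g i = g i * L) {X : B}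
    (hX : ∀ i, i + 1 < m → X * g i = (-q⁻¹) • X) (c : 𝕜) : ∀ k, k ≤ m → ∀ Y : B,
    (∀ i, i + 1 < k → g i * Y = (-q⁻¹) • Y) →
    X * jmProd g (L - c • 1) k * Y = ∑ j ∈ Finset.range (k + 1),
      ((k.choose j : 𝕜) * (-c) ^ (k - j) * ((q ^ (j * (j - 1))) / q ^ (k * (k - 1)))) •
        (X * jmProd g L j * Y)
  | 0, _, Y, _ => by simp [jmProd]
  | k + 1, hk, Y, hY => by
    have hY' : ∀ i, i + 1 < k → g i * (jm g L k * Y - (c * ((q⁻¹) ^ 2) ^ k) • Y) =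
        (-q⁻¹) • (jm g L k * Y - (c * ((q⁻¹) ^ 2) ^ k) • Y) := by
      intro i hi
      rw [mul_sub, ← mul_assoc, ← (h.jm_comm_near hL k i hi (by omega)).eq, mul_assoc,
        mul_smul_comm, hY i (by omega), mul_smul_comm]
      module
    have h1 : X * jmProd g (L - c • 1) (k + 1) * Y =
        X * jmProd g (L - c • 1) k * (jm g L k * Y - (c * ((q⁻¹) ^ 2) ^ k) • Y) := by
      rw [jmProd, mul_assoc, mul_assoc, jm_smul_sub, sub_mul, smul_mul_assoc,
        jm_one_mul k (fun i hi => hY i (by omega)), smul_smul, mul_assoc]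
    have h2 : ∀ j ∈ Finset.range (k + 1),
        X * jmProd g L j * (jm g L k * Y - (c * ((q⁻¹) ^ 2) ^ k) • Y) =
        ((q⁻¹) ^ 2) ^ (k - j) • (X * jmProd g L (j + 1) * Y)
          - (c * ((q⁻¹) ^ 2) ^ k) • (X * jmProd g L j * Y) := by
      intro j hj
      have hj := Finset.mem_range.mp hj
      have h3 := h.jmProd_slide hL hX j (k - j) (by omega) Y (fun i hi => hY i (by omega))
      rw [show j + (k - j) = k by omega] at h3
      rw [mul_sub, mul_smul_comm, ← h3]
      simp only [mul_assoc]
    rw [h1, h.mul_jmProd_shift_mul hq0 hL hX c k (by omega) _ hY']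
    refine (Finset.sum_congr rfl fun j hj => by rw [h2 j hj]).trans (sum_smul_shift
      (fun j => (k.choose j : 𝕜) * (-c) ^ (k - j) * (q ^ (j * (j - 1)) / q ^ (k * (k - 1))))
      (fun j => ((k + 1).choose j : 𝕜) * (-c) ^ (k + 1 - j) *
        (q ^ (j * (j - 1)) / q ^ ((k + 1) * (k + 1 - 1))))
      (fun j => (q⁻¹ ^ 2) ^ (k - j)) (c * (q⁻¹ ^ 2) ^ k) (fun j => X * jmProd g L j * Y)
      ?_ (fun j hj => ?_) ?_)
    · rcases k with _ | k
      · simp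
      · simp only [Nat.choose_zero_right, Nat.cast_one, Nat.sub_zero, zero_mul, pow_zero,
          Nat.add_sub_cancel, inv_pow]
        field_simp
        ring
    · rcases Nat.lt_or_ge j k with hjk | hjk
      · obtain ⟨d, rfl⟩ : ∃ d, k = j + 1 + d := ⟨k - (j + 1), by omega⟩
        have e1 : j + 1 + d - j = d + 1 := by omega
        have e2 : j + 1 + d + 1 - (j + 1) = d + 1 := by omega
        rw [Nat.choose_succ_succ, e1, e2, Nat.add_sub_cancel_left, Nat.add_sub_cancel,
          Nat.add_sub_cancel, Nat.cast_add, show j + 1 + d - 1 = j + d by omega]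
        rcases j with _ | j
        · simp only [zero_mul, pow_zero, inv_pow]
          field_simp
          ring
        · rw [Nat.add_sub_cancel]
          simp only [inv_pow]
          field_simp
          ring
      · obtain rfl : j = k := by omega
        rcases j with _ | j
        · simp
        · simp [div_self (pow_ne_zero _ hq0 : q ^ ((j + 1) * j) ≠ 0),
            div_self (pow_ne_zero _ hq0 : q ^ ((j + 1 + 1) * (j + 1)) ≠ 0)]
    · simp

end Affine

/-! ### Commuting Jucys-Murphy elements -/

section Affine

variable {𝕜 : Type*} [Field 𝕜] {B : Type*} [Ring B] [Algebra 𝕜 B] {q : 𝕜} {m : ℕ} {g : ℕ → B}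
  {L : B}

/-- For `L = 1` the Jucys-Murphy elements lie in the Hecke algebra itself; on elements that absorb
all generators but the last one they reduce to that generator. -/
theorem IsHecke.mul_jm_one_mul (h : IsHecke q m g) (hq0 : q ≠ 0) (hq1 : q - q⁻¹ ≠ 0) :
    ∀ l, l + 1 < m → ∀ X Y : B, (∀ i, i < l → X * g i = (-q⁻¹) • X) →
    (∀ i, i < l → g i * Y = (-q⁻¹) • Y) →
    X * jm g 1 (l + 1) * Y =
      X * Y + ((q - q⁻¹) * (q⁻¹) ^ l * qNum q (l + 1)) • (X * g l * Y)
  | 0, hl, X, Y, _, _ => by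
    rw [jm, jm, mul_one, h.quad 0 hl, qNum_succ hq0 hq1, qNum_zero, mul_add, add_mul, mul_one,
      mul_smul_comm, smul_mul_assoc]
    simp
  | l + 1, hl, X, Y, hX, hY => by
    have ih := h.mul_jm_one_mul hq0 hq1 l (by omega) (X * g (l + 1)) (g (l + 1) * Y)
      (fun i hi => by
        rw [mul_assoc, ← h.comm i (l + 1) (by omega) (by omega), ← mul_assoc, hX i (by omega),
          smul_mul_assoc])
      (fun i hi => by
        rw [← mul_assoc, h.comm i (l + 1) (by omega) (by omega), mul_assoc, hY i (by omega),
          mul_smul_comm])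
    have hb := h.braid l (by omega)
    have hquad := h.quad (l + 1) (by omega)
    have h1 : X * g (l + 1) * (g (l + 1) * Y) = X * Y + (q - q⁻¹) • (X * g (l + 1) * Y) := by
      calc X * g (l + 1) * (g (l + 1) * Y) = X * (g (l + 1) * g (l + 1)) * Y := by
            simp only [mul_assoc]
        _ = _ := by
            rw [hquad, mul_add, mul_one, add_mul, mul_smul_comm, smul_mul_assoc]
    have h2 : X * g (l + 1) * g l * (g (l + 1) * Y) = (q⁻¹ ^ 2) • (X * g (l + 1) * Y) := by
      calc X * g (l + 1) * g l * (g (l + 1) * Y)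
          = X * (g (l + 1) * g l * g (l + 1)) * Y := by simp only [mul_assoc]
        _ = X * g l * g (l + 1) * (g l * Y) := by rw [← hb]; simp only [mul_assoc]
        _ = _ := by
          rw [hX l (by omega), hY l (by omega), mul_smul_comm, smul_mul_assoc, smul_mul_assoc,
            smul_smul]
          ring_nf
    rw [jm]
    calc X * (g (l + 1) * jm g 1 (l + 1) * g (l + 1)) * Y
        = X * g (l + 1) * jm g 1 (l + 1) * (g (l + 1) * Y) := by simp only [mul_assoc]
      _ = _ := by
        rw [ih, h1, h2, smul_smul, add_assoc, ← add_smul]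
        congr 2
        have e : qNum q (l + 1 + 1) = q ^ (l + 1) + q⁻¹ * qNum q (l + 1) :=
          qNum_succ hq0 hq1 (l + 1)
        rw [e]
        have : q⁻¹ ^ (l + 1) * q ^ (l + 1) = 1 := by
          rw [← mul_pow, inv_mul_cancel₀ hq0, one_pow]
        linear_combination (-(q - q⁻¹)) * this

/-- The reflection equation propagates from `L = J_0` to all Jucys-Murphy elements. -/
theorem IsHecke.jm_reflection (h : IsHecke q m g)
    (hL : ∀ i, 1 ≤ i → i + 1 < m → L * g i = g i * L)
    (hRE : 1 < m → g 0 * L * g 0 * L = L * g 0 * L * g 0) : ∀ k, k + 1 < m →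
    g k * jm g L k * g k * jm g L k = jm g L k * g k * jm g L k * g k
  | 0, hk => hRE hk
  | k + 1, hk => by
    have ih := h.jm_reflection hL hRE k (by omega)
    have hb := h.braid k hk
    have hf := (h.jm_comm_far hL hk k (by omega)).eq
    rw [jm]
    set J := jm g L k
    set a := g k
    set b := g (k + 1)
    calc b * (a * J * a) * b * (a * J * a) = b * a * J * (a * b * a) * J * a := by
          simp only [mul_assoc]
      _ = b * a * (J * b) * a * (b * J) * a := by rw [hb]; simp only [mul_assoc]
      _ = (b * a * b) * J * a * (b * J) * a := by rw [hf]; simp only [mul_assoc]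
      _ = (b * a * b) * J * a * J * b * a := by rw [← hf]; simp only [mul_assoc]
      _ = a * b * (a * J * a * J) * b * a := by rw [← hb]; simp only [mul_assoc]
      _ = a * (b * J) * a * J * (a * b * a) := by rw [ih]; simp only [mul_assoc]
      _ = a * J * b * a * (J * b) * a * b := by rw [hb, ← hf]; simp only [mul_assoc]
      _ = a * J * (b * a * b) * J * a * b := by rw [hf]; simp only [mul_assoc]
      _ = _ := by rw [← hb]; simp only [mul_assoc]

/-- The Jucys-Murphy elements commute. -/
theorem IsHecke.jm_comm (h : IsHecke q m g)
    (hL : ∀ i, 1 ≤ i → i + 1 < m → L * g i = g i * L)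
    (hRE : 1 < m → g 0 * L * g 0 * L = L * g 0 * L * g 0) (i : ℕ) : ∀ d, i + d < m →
    Commute (jm g L i) (jm g L (i + d))
  | 0, _ => Commute.refl _
  | 1, hd => by
    have := h.jm_reflection hL hRE i hd
    change jm g L i * (g i * jm g L i * g i) = g i * jm g L i * g i * jm g L i
    rw [this]
    simp only [mul_assoc]
  | d + 2, hd => by
    have h1 : Commute (jm g L i) (g (i + d + 1)) :=
      h.jm_comm_far hL (i := i + d + 1) (by omega) i (by omega)
    have h2 := h.jm_comm hL hRE i (d + 1) (by omega)
    exact (h1.mul_right h2).mul_right h1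

theorem IsHecke.esymOrd_comm_far (h : IsHecke q m g)
    (hL : ∀ i, 1 ≤ i → i + 1 < m → L * g i = g i * L)
    {i : ℕ} (hi : i + 1 < m) : ∀ l j, l ≤ i →
    Commute (esymOrd (jm g L) l j) (g i)
  | l, 0, _ => by rw [esymOrd_zero]; exact Commute.one_left _
  | 0, j + 1, _ => Commute.zero_left _
  | l + 1, j + 1, hl =>
    (h.esymOrd_comm_far hL hi l (j + 1) (by omega)).add_left
      ((h.esymOrd_comm_far hL hi l j (by omega)).mul_left (h.jm_comm_far hL hi l (by omega)))

/-- The elementary symmetric polynomials of the Jucys-Murphy elements commute with the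
generators. -/
theorem IsHecke.esymOrd_comm (h : IsHecke q m g)
    (hL : ∀ i, 1 ≤ i → i + 1 < m → L * g i = g i * L)
    (hRE : 1 < m → g 0 * L * g 0 * L = L * g 0 * L * g 0) : ∀ l j i, i + 1 < l → l ≤ m →
    Commute (esymOrd (jm g L) l j) (g i)
  | l, 0, _, _, _ => by rw [esymOrd_zero]; exact Commute.one_left _
  | 0, j + 1, _, _, _ => Commute.zero_left _
  | l + 1, j + 1, i, hi, hl => by
    rcases Nat.lt_or_ge (i + 1) l with h1 | h1
    · exact (h.esymOrd_comm hL hRE l (j + 1) i h1 (by omega)).add_left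
        ((h.esymOrd_comm hL hRE l j i h1 (by omega)).mul_left (h.jm_comm_near hL l i h1 (by omega)))
    · obtain rfl : l = i + 1 := by omega
      have hre := h.jm_reflection hL hRE i (by omega)
      have hquad := h.quad i (by omega)
      -- the two remaining elements enter through their sum and product, which commute with `g i`
      have hsum : Commute (jm g L i + jm g L (i + 1)) (g i) := by
        change (jm g L i + g i * jm g L i * g i) * g i = g i * (jm g L i + g i * jm g L i * g i)
        calc (jm g L i + g i * jm g L i * g i) * g i
            = jm g L i * g i + g i * jm g L i * (g i * g i) := by
              rw [add_mul]; simp only [mul_assoc]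
          _ = g i * jm g L i + (g i * g i) * (jm g L i * g i) := by
              rw [hquad]
              simp only [mul_add, add_mul, mul_one, one_mul, mul_smul_comm, smul_mul_assoc,
                mul_assoc]
              abel
          _ = _ := by rw [mul_add]; simp only [mul_assoc]
      have hprod : Commute (jm g L i * jm g L (i + 1)) (g i) := by
        change jm g L i * (g i * jm g L i * g i) * g i = g i * (jm g L i * (g i * jm g L i * g i))
        calc jm g L i * (g i * jm g L i * g i) * g i
            = (jm g L i * g i * jm g L i * g i) * g i := by simp only [mul_assoc]
          _ = g i * jm g L i * (g i * jm g L i * g i) := by rw [← hre]; simp only [mul_assoc]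
          _ = _ := by simp only [mul_assoc]
      have hf := fun j => h.esymOrd_comm_far hL (i := i) (by omega) i j le_rfl
      rcases j with _ | j
      · have e : esymOrd (jm g L) (i + 1 + 1) (0 + 1) =
            esymOrd (jm g L) i 1 + (jm g L i + jm g L (i + 1)) := by
          simp only [esymOrd, esymOrd_zero, one_mul, add_assoc]
        rw [e]
        exact (hf 1).add_left hsum
      · have e : esymOrd (jm g L) (i + 1 + 1) (j + 1 + 1) =
            esymOrd (jm g L) i (j + 2) + esymOrd (jm g L) i (j + 1) * (jm g L i + jm g L (i + 1)) +
              esymOrd (jm g L) i j * (jm g L i * jm g L (i + 1)) := by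
          simp only [esymOrd]
          noncomm_ring
        rw [e]
        exact ((hf _).add_left ((hf _).mul_left hsum)).add_left ((hf _).mul_left hprod)

/-- The characteristic identity for the first of several elements that commute with it; the others
need not commute with one another. -/
theorem sum_esymOrd_mul_pow (f : ℕ → B) : ∀ l, (∀ i, i ≤ l → Commute (f 0) (f i)) →
    ∑ k ∈ Finset.range (l + 1 + 1), esymOrd f (l + 1) (l + 1 - k) * (-f 0) ^ k = 0
  | 0, _ => by simp [Finset.sum_range_succ, esymOrd]
  | l + 1, hf => by
    have ih := sum_esymOrd_mul_pow f l (fun i hi => hf i (by omega))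
    have h1 : ∑ k ∈ Finset.range (l + 1 + 1 + 1),
        esymOrd f (l + 1 + 1) (l + 1 + 1 - k) * (-f 0) ^ k =
        ∑ k ∈ Finset.range (l + 1 + 1 + 1), esymOrd f (l + 1) (l + 1 + 1 - k) * (-f 0) ^ k +
        ∑ k ∈ Finset.range (l + 1 + 1),
          esymOrd f (l + 1) (l + 1 - k) * (-f 0) ^ k * f (l + 1) := by
      rw [Finset.sum_range_succ _ (l + 1 + 1), Finset.sum_range_succ _ (l + 1 + 1),
        add_right_comm (Finset.sum _ _),
        ← Finset.sum_add_distrib]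
      congr 1
      · refine Finset.sum_congr rfl fun k hk => ?_
        have hk := Finset.mem_range.mp hk
        rw [show l + 1 + 1 - k = l + 1 - k + 1 by omega, esymOrd, add_mul, mul_assoc, mul_assoc,
          (((hf (l + 1) le_rfl).neg_left).pow_left k).eq]
      · simp [esymOrd_zero]
    rw [h1, ← Finset.sum_mul, ih, zero_mul, add_zero, Finset.sum_range_succ',
      show l + 1 + 1 - 0 = l + 1 + 1 from rfl, esymOrd_eq_zero f (l + 1) (l + 1 + 1) (by omega),
      zero_mul, add_zero]
    simp only [Nat.add_sub_add_right, pow_succ, ← mul_assoc]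
    rw [← Finset.sum_mul, ih, zero_mul]

end Affine

/-! ### Operators acting in some of the tensor factors -/

section Loc

variable {ι κ μ α A : Type*}

open Classical in
/-- The matrix `T` acting in the tensor factors listed by `f`, and as the identity elsewhere. -/
noncomputable def loc [Zero A] (f : κ → ι) (T : Matrix (κ → α) (κ → α) A) :
    Matrix (ι → α) (ι → α) A :=
  Matrix.of fun x y => if ∀ c, c ∉ Set.range f → x c = y c then T (x ∘ f) (y ∘ f) else 0

theorem loc_apply_pos [Zero A] {f : κ → ι} {T : Matrix (κ → α) (κ → α) A} {x y : ι → α}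
    (h : ∀ c, c ∉ Set.range f → x c = y c) : loc f T x y = T (x ∘ f) (y ∘ f) := if_pos h

theorem loc_apply_neg [Zero A] {f : κ → ι} {T : Matrix (κ → α) (κ → α) A} {x y : ι → α}
    (h : ¬ ∀ c, c ∉ Set.range f → x c = y c) : loc f T x y = 0 := if_neg h

theorem extend_comp_off {f : κ → ι} (w : κ → α) (x : ι → α) {c : ι} (hc : c ∉ Set.range f) :
    Function.extend f w x c = x c :=
  Function.extend_apply' _ _ _ (fun ⟨a, ha⟩ => hc ⟨a, ha⟩)

theorem eq_extend {f : κ → ι} (hf : Function.Injective f) {x z : ι → α}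
    (h : ∀ c, c ∉ Set.range f → x c = z c) : z = Function.extend f (z ∘ f) x := by
  funext c
  by_cases hc : c ∈ Set.range f
  · obtain ⟨k, rfl⟩ := hc
    rw [hf.extend_apply]; rfl
  · rw [extend_comp_off _ _ hc, h c hc]

theorem loc_mul [Fintype ι] [Fintype κ] [Fintype α] [DecidableEq ι] [DecidableEq κ] [Ring A]
    {f : κ → ι} (hf : Function.Injective f) (S T : Matrix (κ → α) (κ → α) A) :
    loc f (S * T) = loc f S * loc f T := by
  ext x y
  rw [Matrix.mul_apply]
  by_cases h : ∀ c, c ∉ Set.range f → x c = y c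
  · rw [loc_apply_pos h, Matrix.mul_apply]
    refine Finset.sum_of_injOn (fun w => Function.extend f w x) ?_ (fun _ _ => by simp) ?_ ?_
    · intro w _ w' _ hw
      funext k
      have := congrFun hw (f k)
      simpa [hf.extend_apply] using this
    · intro z _ hz
      rw [loc_apply_neg, zero_mul]
      intro hxz
      exact hz ⟨z ∘ f, by simp, (eq_extend hf hxz).symm⟩
    · intro w _
      have e : Function.extend f w x ∘ f = w := funext fun k => hf.extend_apply _ _ _
      rw [loc_apply_pos (fun c hc => (extend_comp_off w x hc).symm),
        loc_apply_pos (fun c hc => by rw [extend_comp_off w x hc, h c hc]), e]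
  · rw [loc_apply_neg h, eq_comm]
    refine Finset.sum_eq_zero fun z _ => ?_
    by_cases h1 : ∀ c, c ∉ Set.range f → x c = z c
    · rw [loc_apply_neg (x := z), mul_zero]
      exact fun h2 => h fun c hc => (h1 c hc).trans (h2 c hc)
    · rw [loc_apply_neg h1, zero_mul]

theorem loc_one [DecidableEq α] [Fintype ι] [Fintype κ] [DecidableEq ι] [DecidableEq κ] [Ring A]
    (f : κ → ι) : loc f (1 : Matrix (κ → α) (κ → α) A) = 1 := by
  ext x y
  by_cases h : ∀ c, c ∉ Set.range f → x c = y c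
  · rw [loc_apply_pos h, Matrix.one_apply, Matrix.one_apply]
    congr 1
    refine propext ⟨fun h2 => funext fun c => ?_, fun h2 => by rw [h2]⟩
    by_cases hc : c ∈ Set.range f
    · obtain ⟨k, rfl⟩ := hc
      exact congrFun h2 k
    · exact h c hc
  · rw [loc_apply_neg h, Matrix.one_apply_ne]
    rintro rfl
    exact h fun _ _ => rfl

/-- `loc f` as a homomorphism of algebras. -/
noncomputable def locHom (𝕜 : Type*) [Field 𝕜] [Fintype ι] [Fintype κ] [Fintype α] [DecidableEq ι]
    [DecidableEq κ] [DecidableEq α] [Ring A] [Algebra 𝕜 A] {f : κ → ι}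
    (hf : Function.Injective f) :
    Matrix (κ → α) (κ → α) A →ₐ[𝕜] Matrix (ι → α) (ι → α) A :=
  AlgHom.ofLinearMap
    { toFun := loc f
      map_add' := fun S T => by
        ext x y
        by_cases h : ∀ c, c ∉ Set.range f → x c = y c
        · simp [loc_apply_pos h]
        · simp [loc_apply_neg h]
      map_smul' := fun r T => by
        ext x y
        by_cases h : ∀ c, c ∉ Set.range f → x c = y c
        · simp [loc_apply_pos h]
        · simp [loc_apply_neg h] }
    (loc_one f) (loc_mul hf)

theorem loc_loc [Zero A] {f : κ → ι} {e : μ → κ} (hf : Function.Injective f)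
    (T : Matrix (μ → α) (μ → α) A) : loc f (loc e T) = loc (f ∘ e) T := by
  ext x y
  have key : (∀ c, c ∉ Set.range (f ∘ e) → x c = y c) ↔
      (∀ c, c ∉ Set.range f → x c = y c) ∧
        ∀ k, k ∉ Set.range e → (x ∘ f) k = (y ∘ f) k := by
    constructor
    · refine fun h => ⟨fun c hc => h c ?_, fun k hk => h (f k) ?_⟩
      · rintro ⟨j, rfl⟩
        exact hc ⟨e j, rfl⟩
      · rintro ⟨j, hj⟩
        exact hk ⟨j, hf hj⟩
    · rintro ⟨h1, h2⟩ c hc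
      by_cases hcf : c ∈ Set.range f
      · obtain ⟨k, rfl⟩ := hcf
        refine h2 k ?_
        rintro ⟨j, rfl⟩
        exact hc ⟨j, rfl⟩
      · exact h1 c hcf
  by_cases h : ∀ c, c ∉ Set.range (f ∘ e) → x c = y c
  · rw [loc_apply_pos h, loc_apply_pos (key.mp h).1, loc_apply_pos (key.mp h).2]
    rfl
  · rw [loc_apply_neg h]
    by_cases h1 : ∀ c, c ∉ Set.range f → x c = y c
    · rw [loc_apply_pos h1, loc_apply_neg]
      exact fun h2 => h (key.mpr ⟨h1, h2⟩)
    · rw [loc_apply_neg h1]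

/-- The product of two operators acting in disjoint sets of tensor factors. -/
theorem loc_mul_loc_apply [Fintype ι] [Fintype α] [DecidableEq ι] [Ring A]
    {f : κ → ι} {e : μ → ι} (hf : Function.Injective f) (hfe : ∀ a b, f a ≠ e b)
    (S : Matrix (κ → α) (κ → α) A) (T : Matrix (μ → α) (μ → α) A) (x y : ι → α) [Decidable
      (∀ c, c ∉ Set.range f → c ∉ Set.range e → x c = y c)] :
    (loc f S * loc e T) x y = if ∀ c, c ∉ Set.range f → c ∉ Set.range e → x c = y c then
      S (x ∘ f) (y ∘ f) * T (x ∘ e) (y ∘ e) else 0 := by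
  rw [Matrix.mul_apply]
  have e1 : Function.extend f (y ∘ f) x ∘ f = y ∘ f := funext fun k => hf.extend_apply _ _ _
  have e2 : Function.extend f (y ∘ f) x ∘ e = x ∘ e :=
    funext fun k => extend_comp_off _ _ (by rintro ⟨a, ha⟩; exact hfe a k ha)
  rw [Finset.sum_eq_single (Function.extend f (y ∘ f) x)]
  · rw [loc_apply_pos (fun c hc => (extend_comp_off _ x hc).symm), e1]
    split_ifs with h
    · rw [loc_apply_pos, e2]
      intro c hc
      by_cases hcf : c ∈ Set.range f
      · obtain ⟨k, rfl⟩ := hcf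
        rw [hf.extend_apply]; rfl
      · rw [extend_comp_off _ _ hcf, h c hcf hc]
    · rw [loc_apply_neg, mul_zero]
      intro h2
      refine h fun c hcf hce => ?_
      rw [← h2 c hce, extend_comp_off _ _ hcf]
  · intro z _ hz
    by_cases h1 : ∀ c, c ∉ Set.range f → x c = z c
    · rw [loc_apply_neg (x := z), mul_zero]
      intro h2
      apply hz
      rw [eq_extend hf h1]
      congr 1
      funext k
      exact h2 (f k) (by rintro ⟨a, ha⟩; exact hfe k a ha.symm)
    · rw [loc_apply_neg h1, zero_mul]
  · simp

theorem loc_comm [Fintype ι] [Fintype α] [DecidableEq ι] [Ring A]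
    {f : κ → ι} {e : μ → ι} (hf : Function.Injective f) (he : Function.Injective e)
    (hfe : ∀ a b, f a ≠ e b)
    {S : Matrix (κ → α) (κ → α) A} {T : Matrix (μ → α) (μ → α) A}
    (hST : ∀ a b c d, S a b * T c d = T c d * S a b) :
    loc f S * loc e T = loc e T * loc f S := by
  classical
  ext x y
  rw [loc_mul_loc_apply hf hfe, loc_mul_loc_apply he (fun a b => (hfe b a).symm), hST]
  congr 1
  exact propext ⟨fun h c h1 h2 => h c h2 h1, fun h c h1 h2 => h c h2 h1⟩

theorem loc_map {A' : Type*} [Zero A] [Zero A'] (φ : A → A') (hφ : φ 0 = 0) (f : κ → ι)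
    (T : Matrix (κ → α) (κ → α) A) : (loc f T).map φ = loc f (T.map φ) := by
  ext x y
  by_cases h : ∀ c, c ∉ Set.range f → x c = y c
  · rw [Matrix.map_apply, loc_apply_pos h, loc_apply_pos h, Matrix.map_apply]
  · rw [Matrix.map_apply, loc_apply_neg h, loc_apply_neg h, hφ]

end Loc

/-! ### Vectors and covectors inserted into all tensor factors but one -/

section Rect

variable {α A : Type*} [Ring A] {p : ℕ}

/-- The covector `v` on `V ^ ⊗p`, applied to all tensor factors of `V ^ ⊗(p + 1)` except the factor
`i`. -/
def rowAt [DecidableEq α] (i : Fin (p + 1)) (v : (Fin p → α) → A) : Matrix α (Fin (p + 1) → α) A :=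
  Matrix.of fun a y => if y i = a then v (i.removeNth y) else 0

/-- The vector `u` of `V ^ ⊗p`, inserted into all tensor factors of `V ^ ⊗(p + 1)` except the
factor `i`. -/
def colAt [DecidableEq α] (i : Fin (p + 1)) (u : (Fin p → α) → A) : Matrix (Fin (p + 1) → α) α A :=
  Matrix.of fun x a => if x i = a then u (i.removeNth x) else 0

theorem sum_insertNth [Fintype α] (i : Fin (p + 1)) (F : (Fin (p + 1) → α) → A) :
    ∑ y, F y = ∑ a, ∑ z, F (i.insertNth a z) := by
  rw [← (Fin.insertNthEquiv (fun _ => α) i).sum_comp, Fintype.sum_prod_type]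
  rfl

theorem loc_succAbove_apply [DecidableEq α] (i : Fin (p + 1)) (T : Matrix (Fin p → α) (Fin p → α) A)
    (x y : Fin (p + 1) → α) :
    loc i.succAbove T x y = if x i = y i then T (i.removeNth x) (i.removeNth y) else 0 := by
  have : (∀ c, c ∉ Set.range i.succAbove → x c = y c) ↔ x i = y i := by
    simp [Fin.range_succAbove]
  split_ifs with h
  · exact loc_apply_pos (this.mpr h)
  · exact loc_apply_neg (fun h2 => h (this.mp h2))

theorem rowAt_mul_loc [Fintype α] [DecidableEq α] (i : Fin (p + 1)) (v : (Fin p → α) → A)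
    (T : Matrix (Fin p → α) (Fin p → α) A) :
    rowAt i v * loc i.succAbove T = rowAt i (Matrix.vecMul v T) := by
  ext a y
  rw [Matrix.mul_apply, sum_insertNth i]
  simp [rowAt, loc_succAbove_apply, Matrix.vecMul, dotProduct, Finset.sum_ite_eq', eq_comm]

theorem loc_mul_colAt [Fintype α] [DecidableEq α] (i : Fin (p + 1)) (u : (Fin p → α) → A)
    (T : Matrix (Fin p → α) (Fin p → α) A) :
    loc i.succAbove T * colAt i u = colAt i (Matrix.mulVec T u) := by
  ext x a
  rw [Matrix.mul_apply, sum_insertNth i]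
  simp [colAt, loc_succAbove_apply, Matrix.mulVec, dotProduct]

theorem rowAt_mul_colAt [Fintype α] [DecidableEq α] (i : Fin (p + 1)) (v u : (Fin p → α) → A) :
    rowAt i v * colAt i u = Matrix.scalar α (v ⬝ᵥ u) := by
  ext a b
  rw [Matrix.mul_apply, sum_insertNth i, Matrix.scalar_apply, Matrix.diagonal_apply]
  simp [colAt, rowAt, dotProduct, eq_comm]

theorem colAt_mul_rowAt [Fintype α] [DecidableEq α] (i : Fin (p + 1)) (v u : (Fin p → α) → A) :
    colAt i u * rowAt i v = loc i.succAbove (Matrix.vecMulVec u v) := by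
  ext x y
  rw [Matrix.mul_apply, loc_succAbove_apply]
  simp [colAt, rowAt, Matrix.vecMulVec_apply]

end Rect

/-! ### The operators `R_i` on tensor powers -/

section Braid

variable {𝕜 : Type*} [Field 𝕜] {n : ℕ}

/-- A matrix on `V ⊗ V`, with the basis of `V ⊗ V` indexed by functions on `Fin 2`. -/
def pairMatrix {A : Type*} (R : Matrix (Fin n × Fin n) (Fin n × Fin n) A) :
    Matrix (Fin 2 → Fin n) (Fin 2 → Fin n) A :=
  R.submatrix (finTwoArrowEquiv (Fin n)) (finTwoArrowEquiv (Fin n))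

theorem pairMatrix_mul {A : Type*} [Ring A] (R S : Matrix (Fin n × Fin n) (Fin n × Fin n) A) :
    pairMatrix (R * S) = pairMatrix R * pairMatrix S :=
  (Matrix.submatrix_mul_equiv R S _ _ _).symm

theorem braid_eq_loc (R : Matrix (Fin n × Fin n) (Fin n × Fin n) 𝕜) {m i : ℕ} (h : i + 1 < m) :
    braid R m i = loc ![(⟨i, Nat.lt_of_succ_lt h⟩ : Fin m), ⟨i + 1, h⟩] (pairMatrix R) := by
  ext x y
  rw [braid, dif_pos h]
  have key : (∀ c, c ≠ (⟨i, Nat.lt_of_succ_lt h⟩ : Fin m) → c ≠ ⟨i + 1, h⟩ → x c = y c) ↔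
      ∀ c, c ∉ Set.range ![(⟨i, Nat.lt_of_succ_lt h⟩ : Fin m), ⟨i + 1, h⟩] → x c = y c := by
    simp only [Matrix.range_cons, Matrix.range_empty, Set.union_empty, Set.mem_union,
      Set.mem_singleton_iff, not_or, and_imp]
  by_cases hc : ∀ c, c ∉ Set.range ![(⟨i, Nat.lt_of_succ_lt h⟩ : Fin m), ⟨i + 1, h⟩] → x c = y c
  · rw [loc_apply_pos hc]
    exact if_pos (key.mpr hc)
  · rw [loc_apply_neg hc]
    exact if_neg (fun h2 => hc (key.mp h2))

theorem inFirst_eq_loc {A : Type*} [Ring A] (M : Matrix (Fin n) (Fin n) A) {m : ℕ} (h : 0 < m) :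
    inFirst M m = loc (fun _ : Fin 1 => (⟨0, h⟩ : Fin m)) (M.submatrix (· 0) (· 0)) := by
  ext x y
  rw [inFirst, dif_pos h]
  have key : (∀ c, c ≠ (⟨0, h⟩ : Fin m) → x c = y c) ↔
      ∀ c, c ∉ Set.range (fun _ : Fin 1 => (⟨0, h⟩ : Fin m)) → x c = y c := by
    simp only [Set.range_const, Set.mem_singleton_iff, ne_eq]
  by_cases hc : ∀ c, c ∉ Set.range (fun _ : Fin 1 => (⟨0, h⟩ : Fin m)) → x c = y c
  · rw [loc_apply_pos hc]
    exact if_pos (key.mpr hc)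
  · rw [loc_apply_neg hc]
    exact if_neg (fun h2 => hc (key.mp h2))

theorem loc_braid (R : Matrix (Fin n × Fin n) (Fin n × Fin n) 𝕜) {s m k i : ℕ} {e : Fin s → Fin m}
    (he : Function.Injective e) (hk : k + 1 < s) (hi : i + 1 < m)
    (h0 : e ⟨k, Nat.lt_of_succ_lt hk⟩ = ⟨i, Nat.lt_of_succ_lt hi⟩)
    (h1 : e ⟨k + 1, hk⟩ = ⟨i + 1, hi⟩) :
    loc e (braid R s k) = braid R m i := by
  rw [braid_eq_loc R hk, braid_eq_loc R hi, loc_loc he]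
  congr 1
  funext j
  fin_cases j
  · exact h0
  · exact h1

theorem loc_inFirst {A : Type*} [Ring A] (M : Matrix (Fin n) (Fin n) A) {s m : ℕ}
    {e : Fin s → Fin m} (he : Function.Injective e) (hs : 0 < s) (hm : 0 < m)
    (h0 : e ⟨0, hs⟩ = ⟨0, hm⟩) :
    loc e (inFirst M s) = inFirst M m := by
  rw [inFirst_eq_loc M hs, inFirst_eq_loc M hm, loc_loc he]
  congr 1
  funext j
  exact h0

theorem injective_pair {m : ℕ} {a b : Fin m} (h : a ≠ b) : Function.Injective ![a, b] := by
  intro i j hij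
  fin_cases i <;> fin_cases j <;> simp_all

/-- The operators `R_i` on `V ^ ⊗m` satisfy the relations of the Hecke algebra: the relations on two
and three tensor factors are carried to `V ^ ⊗m` by `loc`. -/
theorem isHecke_braid {R : Matrix (Fin n × Fin n) (Fin n × Fin n) 𝕜} {q : 𝕜}
    (hYB : braid R 3 0 * braid R 3 1 * braid R 3 0 = braid R 3 1 * braid R 3 0 * braid R 3 1)
    (hH : R * R = 1 + (q - q⁻¹) • R) (m : ℕ) : IsHecke q m (braid R m) := by
  refine ⟨fun i hi => ?_, fun i j hij hj => ?_, fun i hi => ?_⟩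
  · let e : Fin 3 → Fin m := fun k => ⟨i + k, by omega⟩
    have he : Function.Injective e := fun a b hab => by
      have := congrArg Fin.val hab
      simp only [e] at this
      exact Fin.ext (by omega)
    have h0 : loc e (braid R 3 0) = braid R m i :=
      loc_braid R he (by omega) (by omega) rfl rfl
    have h1 : loc e (braid R 3 1) = braid R m (i + 1) :=
      loc_braid R he (by omega) (by omega) rfl rfl
    have := congrArg (loc e) hYB
    simpa only [loc_mul he, h0, h1] using this
  · rw [braid_eq_loc R (show i + 1 < m by omega), braid_eq_loc R hj]
    refine loc_comm (injective_pair ?_) (injective_pair ?_) ?_ fun a b c d => mul_comm _ _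
    · simp
    · simp
    · intro a b
      fin_cases a <;> fin_cases b <;> simp <;> omega
  · rw [braid_eq_loc R hi]
    have hinj : Function.Injective
        ![(⟨i, Nat.lt_of_succ_lt hi⟩ : Fin m), ⟨i + 1, hi⟩] := injective_pair (by simp)
    have h1 : pairMatrix R * pairMatrix R = 1 + (q - q⁻¹) • pairMatrix R := by
      rw [← pairMatrix_mul, hH]
      ext x y
      simp [pairMatrix, Matrix.one_apply, funext_iff, Fin.forall_fin_two]
    have := congrArg (locHom 𝕜 hinj) h1
    rwa [map_mul, map_add, map_one, map_smul] at this

theorem IsHecke.map {B B' : Type*} [Ring B] [Algebra 𝕜 B] [Ring B'] [Algebra 𝕜 B'] {q : 𝕜} {m : ℕ}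
    {g : ℕ → B} (h : IsHecke q m g) (f : B →ₐ[𝕜] B') : IsHecke q m (fun i => f (g i)) := by
  refine ⟨fun i hi => ?_, fun i j hij hj => ?_, fun i hi => ?_⟩
  · simp only [← map_mul, h.braid i hi]
  · simp only [← map_mul, h.comm i j hij hj]
  · simp only [← map_mul, h.quad i hi, map_add, map_one, map_smul]

theorem skewProj_eq_skew (R : Matrix (Fin n × Fin n) (Fin n × Fin n) 𝕜) (q : 𝕜) (m : ℕ) :
    ∀ l, skewProj R q m l = skew q (braid R m) l
  | 0 => rfl
  | 1 => rfl
  | l + 2 => by rw [skewProj, skew, skewProj_eq_skew R q m (l + 1)]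

theorem braidString_eq (R : Matrix (Fin n × Fin n) (Fin n × Fin n) 𝕜) (m k : ℕ) :
    braidString R m k = upString (braid R m) (k - 1) := by
  rw [braidString]
  induction k - 1 with
  | zero => rfl
  | succ l ih => rw [List.range_succ, List.map_append, List.prod_append, ih, upString]; simp

variable (A : Type*) [Ring A] [Algebra 𝕜 A]

/-- The operator `R_i` over the algebra `A`. -/
def braidOver (R : Matrix (Fin n × Fin n) (Fin n × Fin n) 𝕜) (m i : ℕ) :
    Matrix (Fin m → Fin n) (Fin m → Fin n) A :=
  (braid R m i).map (algebraMap 𝕜 A)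

/-- The extension of scalars to `A`, for square matrices. -/
def scalarExt (ι : Type*) [Fintype ι] [DecidableEq ι] : Matrix ι ι 𝕜 →ₐ[𝕜] Matrix ι ι A :=
  (Algebra.ofId 𝕜 A).mapMatrix

theorem isHecke_braidOver {R : Matrix (Fin n × Fin n) (Fin n × Fin n) 𝕜} {q : 𝕜}
    (hYB : braid R 3 0 * braid R 3 1 * braid R 3 0 = braid R 3 1 * braid R 3 0 * braid R 3 1)
    (hH : R * R = 1 + (q - q⁻¹) • R) (m : ℕ) : IsHecke q m (braidOver A R m) :=
  (isHecke_braid hYB hH m).map (scalarExt A _)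

variable {A}

theorem inFirst_comm_braidOver (M : Matrix (Fin n) (Fin n) A)
    (R : Matrix (Fin n × Fin n) (Fin n × Fin n) 𝕜) (m : ℕ) : ∀ i, 1 ≤ i → i + 1 < m →
    inFirst M m * braidOver A R m i = braidOver A R m i * inFirst M m := by
  intro i h1 hi
  rw [braidOver, braid_eq_loc R hi, inFirst_eq_loc M (by omega), loc_map _ (map_zero _)]
  refine loc_comm (fun _ _ _ => Subsingleton.elim _ _) (injective_pair (by simp)) ?_
    fun a b c d => (Algebra.commutes _ _).symm
  intro a b
  fin_cases b <;> simp
  omega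

theorem inFirst_two (M : Matrix (Fin n) (Fin n) A) :
    inFirst M 2 = pairMatrix (M ⊗ₖ (1 : Matrix (Fin n) (Fin n) A)) := by
  ext x y
  rw [inFirst, dif_pos (by omega)]
  simp [pairMatrix, Matrix.one_apply, finTwoArrowEquiv]

/-- The reflection equation on `V ⊗ V` holds on all tensor powers. -/
theorem reflection_inFirst {R : Matrix (Fin n × Fin n) (Fin n × Fin n) 𝕜}
    {M : Matrix (Fin n) (Fin n) A}
    (hRE : R.map (algebraMap 𝕜 A) * (M ⊗ₖ (1 : Matrix (Fin n) (Fin n) A)) *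
        R.map (algebraMap 𝕜 A) * (M ⊗ₖ (1 : Matrix (Fin n) (Fin n) A)) =
      (M ⊗ₖ (1 : Matrix (Fin n) (Fin n) A)) * R.map (algebraMap 𝕜 A) *
        (M ⊗ₖ (1 : Matrix (Fin n) (Fin n) A)) * R.map (algebraMap 𝕜 A)) (m : ℕ) (hm : 1 < m) :
    braidOver A R m 0 * inFirst M m * braidOver A R m 0 * inFirst M m =
      inFirst M m * braidOver A R m 0 * inFirst M m * braidOver A R m 0 := by
  have he : Function.Injective ![(⟨0, by omega⟩ : Fin m), ⟨1, hm⟩] := injective_pair (by simp)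
  have h1 : loc ![(⟨0, by omega⟩ : Fin m), ⟨1, hm⟩] (inFirst M 2) = inFirst M m :=
    loc_inFirst M he (by omega) (by omega) rfl
  have h2 : loc ![(⟨0, by omega⟩ : Fin m), ⟨1, hm⟩] (pairMatrix (R.map (algebraMap 𝕜 A))) =
      braidOver A R m 0 := by
    rw [braidOver, braid_eq_loc R hm, loc_map _ (map_zero _)]
    rfl
  have h3 := congrArg (fun T => loc ![(⟨0, by omega⟩ : Fin m), ⟨1, hm⟩] (pairMatrix T)) hRE
  simpa only [pairMatrix_mul, ← inFirst_two, loc_mul he, h1, h2] using h3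

end Braid

/-! ### The rank-one antisymmetrizer -/

section RankOne

variable {𝕜 : Type*} [Field 𝕜]

theorem exists_vecMulVec_of_rank_eq_one {ι : Type*} [Fintype ι] [DecidableEq ι] {P : Matrix ι ι 𝕜}
    (h : P.rank = 1) : ∃ u v : ι → 𝕜, P = Matrix.vecMulVec u v := by
  obtain ⟨u, -, hu⟩ := finrank_eq_one_iff'.mp h
  choose c hc using fun j : ι => hu ⟨P.mulVecLin (Pi.single j 1), LinearMap.mem_range_self _ _⟩
  refine ⟨u, c, ?_⟩
  ext i j
  have := congrFun (congrArg Subtype.val (hc j)) i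
  simp at this
  rw [Matrix.vecMulVec_apply, ← this, mul_comm]

end RankOne

section Rect

variable {𝕜 : Type*} [Field 𝕜] {A : Type*} [Ring A] [Algebra 𝕜 A] {q : 𝕜}
  {ι κ : Type*} [Fintype ι] [DecidableEq ι] {g : ℕ → Matrix ι ι A}

/-- The analogue of `mul_skew` for rectangular matrices. -/
theorem rect_mul_skew (hq0 : q ≠ 0) (hqn : ∀ r, qNum q (r + 1) ≠ 0) (hq1 : q - q⁻¹ ≠ 0)
    {X : Matrix κ ι A} : ∀ l : ℕ, (∀ i, i + 1 < l → X * g i = (-q⁻¹) • X) → X * skew q g l = X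
  | 0, _ => by simp [skew]
  | 1, _ => by simp [skew]
  | l + 2, hX => by
    have ih := rect_mul_skew hq0 hqn hq1 (l + 1) (fun i hi => hX i (by omega))
    rw [skew, Matrix.mul_smul, ← Matrix.mul_assoc, ← Matrix.mul_assoc, ih, Matrix.mul_sub,
      Matrix.mul_smul, Matrix.mul_one, Matrix.mul_smul, hX l (by omega), smul_smul, ← sub_smul,
      Matrix.smul_mul, ih, smul_smul]
    have : (qNum q (l + 2))⁻¹ * (q ^ (l + 1) - qNum q (l + 1) * -q⁻¹) = 1 := by
      rw [inv_mul_eq_one₀ (hqn (l + 1)), qNum_succ hq0 hq1 (l + 1)]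
      ring
    rw [this, one_smul]

/-- The analogue of `rect_mul_skew` for multiplication from the left. -/
theorem skew_mul_rect (hq0 : q ≠ 0) (hqn : ∀ r, qNum q (r + 1) ≠ 0) (hq1 : q - q⁻¹ ≠ 0)
    {X : Matrix ι κ A} : ∀ l : ℕ, (∀ i, i + 1 < l → g i * X = (-q⁻¹) • X) → skew q g l * X = X
  | 0, _ => by simp [skew]
  | 1, _ => by simp [skew]
  | l + 2, hX => by
    have ih := skew_mul_rect hq0 hqn hq1 (l + 1) (fun i hi => hX i (by omega))
    rw [skew, Matrix.smul_mul, Matrix.mul_assoc, Matrix.mul_assoc, ih, Matrix.sub_mul,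
      Matrix.smul_mul, Matrix.one_mul, Matrix.smul_mul, hX l (by omega), smul_smul, ← sub_smul,
      Matrix.mul_smul, ih, smul_smul]
    have : (qNum q (l + 2))⁻¹ * (q ^ (l + 1) - qNum q (l + 1) * -q⁻¹) = 1 := by
      rw [inv_mul_eq_one₀ (hqn (l + 1)), qNum_succ hq0 hq1 (l + 1)]
      ring
    rw [this, one_smul]

end Rect

section Even

variable {𝕜 : Type*} [Field 𝕜] {n p : ℕ} {R : Matrix (Fin n × Fin n) (Fin n × Fin n) 𝕜} {q : 𝕜}

theorem IsEvenHeckeSymmetry.qNum_ne_zero (hR : IsEvenHeckeSymmetry R q p) (r : ℕ) :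
    qNum q (r + 1) ≠ 0 := QuantumMatrix.qNum_ne_zero hR.q_ne_zero hR.q_generic r

theorem IsEvenHeckeSymmetry.sub_inv_ne_zero (hR : IsEvenHeckeSymmetry R q p) : q - q⁻¹ ≠ 0 := by
  intro h
  apply hR.qNum_ne_zero 0
  rw [qNum, h, div_zero]

theorem IsEvenHeckeSymmetry.isHecke (hR : IsEvenHeckeSymmetry R q p) (A : Type*) [Ring A]
    [Algebra 𝕜 A] (m : ℕ) : IsHecke q m (braidOver A R m) :=
  isHecke_braidOver A hR.yangBaxter hR.hecke m

variable (A : Type*) [Ring A] [Algebra 𝕜 A]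

/-- The antisymmetrizer over `A` is the image of the one over the ground field. -/
theorem skew_braidOver (R : Matrix (Fin n × Fin n) (Fin n × Fin n) 𝕜) (q : 𝕜) (m l : ℕ) :
    skew q (braidOver A R m) l = (skewProj R q m l).map (algebraMap 𝕜 A) := by
  rw [skewProj_eq_skew]
  exact (map_skew (scalarExt A (Fin m → Fin n)) q (braid R m) l).symm

variable {A}

/-- A pair of a vector and a covector through which the rank-one antisymmetrizer factors.  Their
entries lie in a possibly noncommutative algebra `A`, and are required to be central there. -/
structure IsSkewPair (R : Matrix (Fin n × Fin n) (Fin n × Fin n) 𝕜) (q : 𝕜) (p : ℕ)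
    (u v : (Fin p → Fin n) → A) : Prop where
  eq_vecMulVec : skew q (braidOver A R p) p = Matrix.vecMulVec u v
  dot_eq_one : v ⬝ᵥ u = 1
  comm_u : ∀ x (a : A), u x * a = a * u x
  comm_v : ∀ x (a : A), v x * a = a * v x

theorem IsEvenHeckeSymmetry.exists_skewPair (hR : IsEvenHeckeSymmetry R q p) :
    ∃ u v : (Fin p → Fin n) → 𝕜, IsSkewPair R q p u v := by
  obtain ⟨u, v, h⟩ := exists_vecMulVec_of_rank_eq_one hR.rank_skewProj
  have hq0 := hR.q_ne_zero
  have hqn := hR.qNum_ne_zero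
  have hq1 := hR.sub_inv_ne_zero
  have h1 : skewProj R q p p * skewProj R q p p = skewProj R q p p := by
    rw [skewProj_eq_skew]
    exact mul_skew hq0 hqn hq1 p
      (((isHecke_braid hR.yangBaxter hR.hecke p).skew_absorb hq0 hqn hq1 p le_rfl).1)
  have h2 : v ⬝ᵥ u = 1 := by
    have hne : skewProj R q p p ≠ 0 := by
      intro h0
      have := hR.rank_skewProj
      rw [h0, Matrix.rank_zero] at this
      exact zero_ne_one this
    obtain ⟨i, j, hij⟩ : ∃ i j, skewProj R q p p i j ≠ 0 := by
      by_contra! hc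
      exact hne (Matrix.ext hc)
    have h3 := congrFun (congrFun h1 i) j
    rw [h, Matrix.vecMulVec_mul_vecMulVec] at h3
    rw [h] at hij
    simp only [Matrix.vecMulVec_apply, smul_eq_mul, Pi.smul_apply] at h3 hij
    have h4 : (v ⬝ᵥ u - 1) * (u i * v j) = 0 := by linear_combination h3
    rcases mul_eq_zero.mp h4 with h5 | h5
    · exact sub_eq_zero.mp h5
    · exact absurd h5 hij
  refine ⟨u, v, ?_, h2, fun x a => mul_comm _ _, fun x a => mul_comm _ _⟩
  rw [skew_braidOver, h]
  rfl

theorem IsSkewPair.extend {u v : (Fin p → Fin n) → 𝕜} (h : IsSkewPair R q p u v) (A : Type*)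
    [Ring A] [Algebra 𝕜 A] :
    IsSkewPair R q p (algebraMap 𝕜 A ∘ u) (algebraMap 𝕜 A ∘ v) := by
  refine ⟨?_, ?_, fun x a => Algebra.commutes _ _, fun x a => Algebra.commutes _ _⟩
  · have h1 := h.eq_vecMulVec
    rw [skew_braidOver] at h1 ⊢
    ext x y
    have h2 := congrFun (congrFun h1 x) y
    simp only [Matrix.map_apply, Algebra.algebraMap_self, RingHom.id_apply] at h2
    rw [Matrix.map_apply, h2]
    simp [Matrix.vecMulVec_apply]
  · rw [← map_one (algebraMap 𝕜 A), ← h.dot_eq_one]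
    simp [dotProduct]

end Even

/-! ### The coefficients as elementary symmetric polynomials -/

section Sigma

variable {𝕜 : Type*} [Field 𝕜] {n p : ℕ} {R : Matrix (Fin n × Fin n) (Fin n × Fin n) 𝕜} {q : 𝕜}
  {A : Type*} [Ring A] [Algebra 𝕜 A]

theorem map_upString {B B' : Type*} [Ring B] [Ring B'] (f : B →+* B') (g : ℕ → B) : ∀ k,
    f (upString g k) = upString (fun i => f (g i)) k
  | 0 => by simp [upString]
  | k + 1 => by simp [upString, map_upString f g k]

theorem map_downString {B B' : Type*} [Ring B] [Ring B'] (f : B →+* B') (g : ℕ → B) : ∀ k j,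
    f (downString g k j) = downString (fun i => f (g i)) k j
  | _, 0 => by simp [downString]
  | 0, j + 1 => by simp [downString]
  | k + 1, j + 1 => by simp [downString, map_downString f g k j]

theorem IsEvenHeckeSymmetry.string_pow (hR : IsEvenHeckeSymmetry R q p)
    (M : Matrix (Fin n) (Fin n) A) {k : ℕ} (hk : k ≤ p) :
    (inFirst M p * (braidString R p k).map (algebraMap 𝕜 A)) ^ k =
      jmProd (braidOver A R p) (inFirst M p) k := by
  rw [← (hR.isHecke A p).string_pow (inFirst_comm_braidOver M R p) k hk, braidString_eq]
  congr 2
  exact map_upString (scalarExt A (Fin p → Fin n)).toRingHom (braid R p) (k - 1)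

/-- Because the entries of `u` are central, the trace of the rank-one matrix times `X` is a matrix
element of `X`, although `A` need not be commutative. -/
theorem IsSkewPair.trace_mul {u v : (Fin p → Fin n) → A} (h : IsSkewPair R q p u v)
    (X : Matrix (Fin p → Fin n) (Fin p → Fin n) A) :
    Matrix.trace (skew q (braidOver A R p) p * X) = v ⬝ᵥ X.mulVec u := by
  rw [h.eq_vecMulVec, Matrix.trace]
  simp only [Matrix.diag_apply, Matrix.mul_apply, Matrix.vecMulVec_apply, dotProduct,
    Matrix.mulVec, Finset.mul_sum]
  rw [Finset.sum_comm]
  refine Finset.sum_congr rfl fun i _ => Finset.sum_congr rfl fun j _ => ?_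
  rw [mul_assoc, h.comm_u, mul_assoc]

theorem IsSkewPair.skew_mulVec {u v : (Fin p → Fin n) → A} (h : IsSkewPair R q p u v) :
    (skew q (braidOver A R p) p).mulVec u = u := by
  rw [h.eq_vecMulVec]
  ext x
  simp only [Matrix.mulVec, dotProduct, Matrix.vecMulVec_apply, mul_assoc, ← Finset.mul_sum]
  have := h.dot_eq_one
  rw [dotProduct] at this
  rw [this, mul_one]

theorem IsSkewPair.vecMul_skew {u v : (Fin p → Fin n) → A} (h : IsSkewPair R q p u v) :
    Matrix.vecMul v (skew q (braidOver A R p) p) = v := by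
  rw [h.eq_vecMulVec]
  ext x
  simp only [Matrix.vecMul, dotProduct, Matrix.vecMulVec_apply, ← mul_assoc, ← Finset.sum_mul]
  have := h.dot_eq_one
  rw [dotProduct] at this
  rw [this, one_mul]

theorem IsSkewPair.trace_mul_eq {u v : (Fin p → Fin n) → A} (h : IsSkewPair R q p u v)
    (X : Matrix (Fin p → Fin n) (Fin p → Fin n) A) :
    v ⬝ᵥ X.mulVec u = Matrix.trace (skew q (braidOver A R p) p *
      (skew q (braidOver A R p) p * X * skew q (braidOver A R p) p)) := by
  rw [h.trace_mul, ← Matrix.mulVec_mulVec, h.skew_mulVec, ← Matrix.mulVec_mulVec,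
    Matrix.dotProduct_mulVec v (skew q _ p), h.vecMul_skew]

/-- The coefficient `sigma` in terms of the product of Jucys-Murphy elements. -/
theorem IsEvenHeckeSymmetry.sigma_eq_trace (hR : IsEvenHeckeSymmetry R q p)
    {u v : (Fin p → Fin n) → A} (h : IsSkewPair R q p u v)
    (M : Matrix (Fin n) (Fin n) A) {k : ℕ} (hk : k ≤ p) :
    sigma R q p M k = ((q ^ (k * (p - k)))⁻¹ * qBinom q p k) •
      Matrix.trace (skew q (braidOver A R p) p * (skew q (braidOver A R p) p *
        jmProd (braidOver A R p) (inFirst M p) k * skew q (braidOver A R p) p)) := by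
  rw [← h.trace_mul_eq, sigma, hR.string_pow M hk, ← skew_braidOver, h.trace_mul]

/-- The coefficients are the eigenvalues of the elementary symmetric polynomials of the
Jucys-Murphy elements on the totally skewsymmetric covector. -/
theorem IsEvenHeckeSymmetry.sigma_eq (hR : IsEvenHeckeSymmetry R q p)
    {u v : (Fin p → Fin n) → A} (h : IsSkewPair R q p u v)
    (M : Matrix (Fin n) (Fin n) A) {k : ℕ} (hk : k ≤ p) :
    sigma R q p M k =
      v ⬝ᵥ (esymOrd (jm (braidOver A R p) (inFirst M p)) p k).mulVec u := by
  have habs := (hR.isHecke A p).skew_absorb hR.q_ne_zero hR.qNum_ne_zero hR.sub_inv_ne_zero p le_rfl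
  rw [h.trace_mul_eq, (hR.isHecke A p).mul_esymOrd_mul hR.q_ne_zero hR.qNum_ne_zero
    (inFirst_comm_braidOver M R p) habs.1 p k hk le_rfl _ habs.2, hR.sigma_eq_trace h M hk,
    mul_smul_comm, Matrix.trace_smul]

theorem inFirst_sub_smul (M : Matrix (Fin n) (Fin n) A) (c : 𝕜) (hp : 0 < p) :
    inFirst (M - c • 1) p = inFirst M p - c • 1 := by
  have h0 : Function.Injective (fun _ : Fin 1 => (⟨0, hp⟩ : Fin p)) :=
    fun _ _ _ => Subsingleton.elim _ _
  rw [inFirst_eq_loc _ hp, inFirst_eq_loc _ hp]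
  have := map_sub (locHom 𝕜 h0) (M.submatrix (fun x : Fin 1 → Fin n => x 0) (· 0)) (c • 1)
  rw [map_smul, map_one] at this
  refine Eq.trans ?_ this
  change _ = loc _ _
  congr 1
  ext x y
  simp [Matrix.one_apply, funext_iff]

/-- The comparison of coefficients in `IsEvenHeckeSymmetry.sigma_sub_smul`, for `k = r + d` and
`p = r + d + e`. -/
theorem shift_coeff (hq0 : q ≠ 0) (c : 𝕜) (r d e : ℕ) (b : 𝕜) {b' : 𝕜} (hb : b' ≠ 0) :
    (q ^ ((r + d) * e))⁻¹ * b *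
      (((r + d).choose d : 𝕜) * (-c) ^ r * (q ^ (d * (d - 1)) / q ^ ((r + d) * (r + d - 1)))) =
    (-c) ^ r * (q ^ (r * (r + d + e - 1)))⁻¹ * ((r + d).choose r : 𝕜) * (b / b') *
      ((q ^ (d * (r + e)))⁻¹ * b') := by
  have key : q ^ (d * (d - 1)) * q ^ (r * (r + d + e - 1)) * q ^ (d * (r + e)) =
      q ^ ((r + d) * (r + d - 1)) * q ^ ((r + d) * e) := by
    rw [← pow_add, ← pow_add, ← pow_add]
    congr 1
    rcases d with _ | d
    · rcases r with _ | r
      · simp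
      · simp only [Nat.add_zero, Nat.add_sub_cancel, show r + 1 + e - 1 = r + e by omega]
        ring
    · rw [show r + (d + 1) + e - 1 = r + d + e by omega, show r + (d + 1) - 1 = r + d by omega,
        Nat.add_sub_cancel]
      ring
  rw [← Nat.choose_symm_add]
  have h1 : ∀ k, q ^ k ≠ 0 := fun k => pow_ne_zero k hq0
  generalize q ^ (d * (d - 1)) = x1 at *
  rw [div_eq_mul_inv, div_eq_mul_inv, mul_comm b b'⁻¹]
  have h2 : x1 * (q ^ ((r + d) * (r + d - 1)))⁻¹ * (q ^ ((r + d) * e))⁻¹ =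
      (q ^ (r * (r + d + e - 1)))⁻¹ * (q ^ (d * (r + e)))⁻¹ := by
    rw [← mul_inv, mul_assoc, ← mul_inv, ← div_eq_mul_inv, div_eq_iff (mul_ne_zero (h1 _) (h1 _)),
      ← key]
    rw [mul_comm, mul_assoc, mul_assoc, ← mul_assoc (q ^ (r * _)), mul_inv_cancel₀
      (mul_ne_zero (h1 _) (h1 _)), mul_one]
  linear_combination (b * ((r + d).choose r : 𝕜) * (-c) ^ r) * h2 -
    ((-c) ^ r * (q ^ (r * (r + d + e - 1)))⁻¹ * ((r + d).choose r : 𝕜) * b *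
      (q ^ (d * (r + e)))⁻¹) * inv_mul_cancel₀ hb

/-- The transformation of the coefficients under a shift of the matrix by a scalar. -/
theorem IsEvenHeckeSymmetry.sigma_sub_smul (hR : IsEvenHeckeSymmetry R q p)
    (M : Matrix (Fin n) (Fin n) A) (c : 𝕜) {k : ℕ} (hk : k ≤ p) :
    sigma R q p (M - c • 1) k = ∑ r ∈ Finset.range (k + 1),
      ((-c) ^ r * (q ^ (r * (p - 1)))⁻¹ * (k.choose r : 𝕜) *
        (qBinom q p k / qBinom q p (k - r))) • sigma R q p M (k - r) := by
  obtain ⟨u, v, huv⟩ := hR.exists_skewPair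
  have h := huv.extend A
  have hq0 := hR.q_ne_zero
  rcases k with _ | k
  · simp [hR.sigma_eq_trace h, jmProd, qBinom_zero hR.qNum_ne_zero]
  have habs := (hR.isHecke A p).skew_absorb hR.q_ne_zero hR.qNum_ne_zero hR.sub_inv_ne_zero p le_rfl
  rw [hR.sigma_eq_trace h _ hk, inFirst_sub_smul M c (by omega),
    (hR.isHecke A p).mul_jmProd_shift_mul hq0 (inFirst_comm_braidOver M R p) habs.1 c
      (k + 1) hk _ (fun i hi => habs.2 i (by omega)), Finset.mul_sum, Matrix.trace_sum,
    Finset.smul_sum, ← Finset.sum_range_reflect]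
  refine Finset.sum_congr rfl fun r hr => ?_
  obtain ⟨d, hd⟩ : ∃ d, k + 1 = r + d := ⟨k + 1 - r, by have := Finset.mem_range.mp hr; omega⟩
  obtain ⟨e, rfl⟩ : ∃ e, p = r + d + e := ⟨p - (r + d), by omega⟩
  rw [hd, show r + d + 1 - 1 - r = d by omega, Nat.add_sub_cancel_left,
    show r + d - d = r by omega, hR.sigma_eq_trace h _ (by omega), mul_smul_comm,
    Matrix.trace_smul, smul_smul, smul_smul, show r + d - r = d by omega,
    show r + d + e - d = r + e by omega,
    shift_coeff hq0 c r d e _ (qBinom_ne_zero hR.qNum_ne_zero (r + d + e) d)]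

end Sigma

/-! ### One more tensor factor -/

section Strands

variable {𝕜 : Type*} [Field 𝕜] {n p : ℕ} {R : Matrix (Fin n × Fin n) (Fin n × Fin n) 𝕜} {q : 𝕜}
  {A : Type*} [Ring A] [Algebra 𝕜 A] {κ : Type*}

theorem loc_castSucc_braidOver (R : Matrix (Fin n × Fin n) (Fin n × Fin n) 𝕜) {i : ℕ}
    (hi : i + 1 < p) :
    loc (Fin.last p).succAbove (braidOver A R p i) = braidOver A R (p + 1) i := by
  rw [braidOver, braidOver, ← loc_map _ (map_zero _),
    loc_braid R Fin.succAbove_right_injective hi (show i + 1 < p + 1 by omega)]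
  · simp
  · simp

theorem loc_succ_braidOver (R : Matrix (Fin n × Fin n) (Fin n × Fin n) 𝕜) {i : ℕ}
    (hi : i + 1 < p) :
    loc (0 : Fin (p + 1)).succAbove (braidOver A R p i) = braidOver A R (p + 1) (i + 1) := by
  rw [braidOver, braidOver, ← loc_map _ (map_zero _),
    loc_braid R Fin.succAbove_right_injective hi (show i + 1 + 1 < p + 1 by omega)]
  · simp
  · simp

theorem loc_castSucc_skew (R : Matrix (Fin n × Fin n) (Fin n × Fin n) 𝕜) (q : 𝕜) :
    loc (Fin.last p).succAbove (skew q (braidOver A R p) p) =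
      skew q (braidOver A R (p + 1)) p := by
  have := map_skew (locHom (A := A) (α := Fin n) 𝕜
    (Fin.succAbove_right_injective (p := Fin.last p))) q (braidOver A R p) p
  refine Eq.trans this (skew_congr p fun i hi => loc_castSucc_braidOver R hi)

theorem loc_succ_skew (R : Matrix (Fin n × Fin n) (Fin n × Fin n) 𝕜) (q : 𝕜) :
    loc (0 : Fin (p + 1)).succAbove (skew q (braidOver A R p) p) =
      skew q (fun i => braidOver A R (p + 1) (i + 1)) p := by
  have := map_skew (locHom (A := A) (α := Fin n) 𝕜
    (Fin.succAbove_right_injective (p := (0 : Fin (p + 1))))) q (braidOver A R p) p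
  refine Eq.trans this (skew_congr p fun i hi => loc_succ_braidOver R hi)

theorem loc_castSucc_esymOrd (M : Matrix (Fin n) (Fin n) A) (hp : 0 < p) (j : ℕ) :
    loc (Fin.last p).succAbove (esymOrd (jm (braidOver A R p) (inFirst M p)) p j) =
      esymOrd (jm (braidOver A R (p + 1)) (inFirst M (p + 1))) p j := by
  let f := (locHom (A := A) (α := Fin n) 𝕜
    (Fin.succAbove_right_injective (p := Fin.last p))).toRingHom
  refine Eq.trans (map_esymOrd f _ p j) (esymOrd_congr p j fun i hi => ?_)
  refine Eq.trans (map_jm f _ _ i) ?_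
  have h1 : f (inFirst M p) = inFirst M (p + 1) :=
    loc_inFirst M Fin.succAbove_right_injective hp (by omega) (by simp)
  rw [h1]
  exact jm_congr i fun k hk => loc_castSucc_braidOver R (by omega)

theorem inFirst_succ_apply (M : Matrix (Fin n) (Fin n) A) (x z : Fin (p + 1) → Fin n) :
    inFirst M (p + 1) x z =
      if Fin.removeNth 0 x = Fin.removeNth 0 z then M (x 0) (z 0) else 0 := by
  rw [inFirst, dif_pos (by omega)]
  refine if_congr ?_ rfl rfl
  rw [funext_iff]
  exact ⟨fun h c => h _ (Fin.succ_ne_zero c), fun h c hc => by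
    obtain ⟨d, rfl⟩ := Fin.exists_succ_eq.mpr hc
    exact h d⟩

section Pair

variable {u v : (Fin p → Fin n) → A}

theorem IsSkewPair.vecMul_braidOver (h : IsSkewPair R q p u v) (hR : IsEvenHeckeSymmetry R q p)
    {i : ℕ} (hi : i + 1 < p) : Matrix.vecMul v (braidOver A R p i) = (-q⁻¹) • v := by
  have habs := (hR.isHecke A p).skew_absorb hR.q_ne_zero hR.qNum_ne_zero hR.sub_inv_ne_zero p le_rfl
  rw [← h.vecMul_skew, Matrix.vecMul_vecMul, habs.1 i hi, Matrix.vecMul_smul, h.vecMul_skew]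

theorem IsSkewPair.braidOver_mulVec (h : IsSkewPair R q p u v) (hR : IsEvenHeckeSymmetry R q p)
    {i : ℕ} (hi : i + 1 < p) : Matrix.mulVec (braidOver A R p i) u = (-q⁻¹) • u := by
  have habs := (hR.isHecke A p).skew_absorb hR.q_ne_zero hR.qNum_ne_zero hR.sub_inv_ne_zero p le_rfl
  rw [← h.skew_mulVec, Matrix.mulVec_mulVec, habs.2 i hi, Matrix.smul_mulVec, h.skew_mulVec]

theorem rowAt_smul (i : Fin (p + 1)) (c : 𝕜) (v : (Fin p → Fin n) → A) :
    rowAt i (c • v) = c • rowAt i v := by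
  ext a y
  simp [rowAt]

theorem colAt_smul (i : Fin (p + 1)) (c : 𝕜) (v : (Fin p → Fin n) → A) :
    colAt i (c • v) = c • colAt i v := by
  ext a y
  simp [colAt]

theorem IsSkewPair.rowLast_mul (h : IsSkewPair R q p u v) (hR : IsEvenHeckeSymmetry R q p)
    (i : ℕ) (hi : i + 1 < p) :
    rowAt (Fin.last p) v * braidOver A R (p + 1) i = (-q⁻¹) • rowAt (Fin.last p) v := by
  rw [← loc_castSucc_braidOver R hi, rowAt_mul_loc, h.vecMul_braidOver hR hi, rowAt_smul]

theorem IsSkewPair.rowZero_mul (h : IsSkewPair R q p u v) (hR : IsEvenHeckeSymmetry R q p)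
    (i : ℕ) (hi : i + 1 < p) :
    rowAt 0 v * braidOver A R (p + 1) (i + 1) = (-q⁻¹) • rowAt 0 v := by
  rw [← loc_succ_braidOver R hi, rowAt_mul_loc, h.vecMul_braidOver hR hi, rowAt_smul]

theorem IsSkewPair.mul_colLast (h : IsSkewPair R q p u v) (hR : IsEvenHeckeSymmetry R q p)
    (i : ℕ) (hi : i + 1 < p) :
    braidOver A R (p + 1) i * colAt (Fin.last p) u = (-q⁻¹) • colAt (Fin.last p) u := by
  rw [← loc_castSucc_braidOver R hi, loc_mul_colAt, h.braidOver_mulVec hR hi, colAt_smul]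

theorem IsSkewPair.row_mul_col (h : IsSkewPair R q p u v) (i : Fin (p + 1)) :
    rowAt i v * colAt i u = 1 := by
  rw [rowAt_mul_colAt, h.dot_eq_one, map_one]

theorem IsSkewPair.colLast_mul_rowLast (h : IsSkewPair R q p u v) :
    colAt (Fin.last p) u * rowAt (Fin.last p) v = skew q (braidOver A R (p + 1)) p := by
  rw [colAt_mul_rowAt, ← h.eq_vecMulVec, loc_castSucc_skew]

theorem IsSkewPair.colZero_mul_rowZero (h : IsSkewPair R q p u v) :
    colAt 0 u * rowAt 0 v = skew q (fun i => braidOver A R (p + 1) (i + 1)) p := by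
  rw [colAt_mul_rowAt, ← h.eq_vecMulVec, loc_succ_skew]

/-- A row that absorbs the generators of the first `p` factors is a multiple of the skewsymmetric
covector there. -/
theorem IsSkewPair.eq_mul_rowLast (h : IsSkewPair R q p u v) (hR : IsEvenHeckeSymmetry R q p)
    {X : Matrix κ (Fin (p + 1) → Fin n) A}
    (hX : ∀ i, i + 1 < p → X * braidOver A R (p + 1) i = (-q⁻¹) • X) :
    X = X * colAt (Fin.last p) u * rowAt (Fin.last p) v := by
  rw [Matrix.mul_assoc, h.colLast_mul_rowLast,
    rect_mul_skew hR.q_ne_zero hR.qNum_ne_zero hR.sub_inv_ne_zero p hX]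

theorem IsSkewPair.eq_mul_rowZero (h : IsSkewPair R q p u v) (hR : IsEvenHeckeSymmetry R q p)
    {X : Matrix κ (Fin (p + 1) → Fin n) A}
    (hX : ∀ i, i + 1 < p → X * braidOver A R (p + 1) (i + 1) = (-q⁻¹) • X) :
    X = X * colAt 0 u * rowAt 0 v := by
  rw [Matrix.mul_assoc, h.colZero_mul_rowZero,
    rect_mul_skew hR.q_ne_zero hR.qNum_ne_zero hR.sub_inv_ne_zero p hX]

theorem IsSkewPair.eq_colZero_mul (h : IsSkewPair R q p u v) (hR : IsEvenHeckeSymmetry R q p)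
    {X : Matrix (Fin (p + 1) → Fin n) κ A}
    (hX : ∀ i, i + 1 < p → braidOver A R (p + 1) (i + 1) * X = (-q⁻¹) • X) :
    X = colAt 0 u * (rowAt 0 v * X) := by
  rw [← Matrix.mul_assoc, h.colZero_mul_rowZero,
    skew_mul_rect hR.q_ne_zero hR.qNum_ne_zero hR.sub_inv_ne_zero p hX]

/-- The covector in the last `p` factors commutes with `M_1`, because its entries are central. -/
theorem IsSkewPair.rowZero_mul_inFirst (h : IsSkewPair R q p u v) (M : Matrix (Fin n) (Fin n) A) :
    rowAt 0 v * inFirst M (p + 1) = M * rowAt 0 v := by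
  ext a y
  rw [Matrix.mul_apply, Matrix.mul_apply, sum_insertNth 0]
  simp [inFirst_succ_apply, rowAt, h.comm_v]

theorem IsSkewPair.inFirst_mul_colZero (h : IsSkewPair R q p u v) (M : Matrix (Fin n) (Fin n) A) :
    inFirst M (p + 1) * colAt 0 u = colAt 0 u * M := by
  ext y a
  rw [Matrix.mul_apply, Matrix.mul_apply, sum_insertNth 0]
  simp [inFirst_succ_apply, colAt, h.comm_u]

end Pair

end Strands

/-! ### Transport of skewsymmetric vectors along strings -/

section Transport

variable {𝕜 : Type*} [Field 𝕜] {n p : ℕ} {R : Matrix (Fin n × Fin n) (Fin n × Fin n) 𝕜} {q : 𝕜}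
  {A : Type*} [Ring A] [Algebra 𝕜 A] {u v : (Fin p → Fin n) → A}

/-- The matrix by which the string `R_1 ⋯ R_p` carries the skewsymmetric vector in the first `p`
factors of `V ^ ⊗(p + 1)` to the one in the last `p` factors. -/
def upTransport (R : Matrix (Fin n × Fin n) (Fin n × Fin n) 𝕜) (u v : (Fin p → Fin n) → A) :
    Matrix (Fin n) (Fin n) A :=
  rowAt 0 v * upString (braidOver A R (p + 1)) p * colAt (Fin.last p) u

/-- The matrix by which the string `R_p ⋯ R_1` carries the skewsymmetric vector in the last `p`
factors of `V ^ ⊗(p + 1)` to the one in the first `p` factors. -/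
def downTransport (R : Matrix (Fin n × Fin n) (Fin n × Fin n) 𝕜) (u v : (Fin p → Fin n) → A) :
    Matrix (Fin n) (Fin n) A :=
  rowAt (Fin.last p) v * downString (braidOver A R (p + 1)) p p * colAt 0 u

theorem IsSkewPair.rowZero_mul_upString (h : IsSkewPair R q p u v)
    (hR : IsEvenHeckeSymmetry R q p) :
    rowAt 0 v * upString (braidOver A R (p + 1)) p =
      upTransport R u v * rowAt (Fin.last p) v := by
  refine h.eq_mul_rowLast hR fun i hi => ?_
  rw [Matrix.mul_assoc, ← (hR.isHecke A (p + 1)).mul_upString p i hi p.lt_succ_self,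
    ← Matrix.mul_assoc, h.rowZero_mul hR i hi, Matrix.smul_mul]

theorem IsSkewPair.upString_mul_colLast (h : IsSkewPair R q p u v)
    (hR : IsEvenHeckeSymmetry R q p) :
    upString (braidOver A R (p + 1)) p * colAt (Fin.last p) u =
      colAt 0 u * upTransport R u v := by
  rw [upTransport, Matrix.mul_assoc]
  refine h.eq_colZero_mul hR fun i hi => ?_
  rw [← Matrix.mul_assoc, (hR.isHecke A (p + 1)).mul_upString p i hi p.lt_succ_self,
    Matrix.mul_assoc, h.mul_colLast hR i hi, Matrix.mul_smul]

theorem IsSkewPair.rowLast_mul_downString (h : IsSkewPair R q p u v)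
    (hR : IsEvenHeckeSymmetry R q p) :
    rowAt (Fin.last p) v * downString (braidOver A R (p + 1)) p p =
      downTransport R u v * rowAt 0 v := by
  refine h.eq_mul_rowZero hR fun i hi => ?_
  rw [Matrix.mul_assoc, ← (hR.isHecke A (p + 1)).downString_mul p i hi p.lt_succ_self,
    ← Matrix.mul_assoc, h.rowLast_mul hR i hi, Matrix.smul_mul]

theorem IsSkewPair.rowLast_mul_skew (h : IsSkewPair R q p u v) :
    rowAt (Fin.last p) v * skew q (braidOver A R (p + 1)) p = rowAt (Fin.last p) v := by
  rw [← h.colLast_mul_rowLast, ← Matrix.mul_assoc, h.row_mul_col, Matrix.one_mul]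

theorem IsSkewPair.skew_mul_colLast (h : IsSkewPair R q p u v) :
    skew q (braidOver A R (p + 1)) p * colAt (Fin.last p) u = colAt (Fin.last p) u := by
  rw [← h.colLast_mul_rowLast, Matrix.mul_assoc, h.row_mul_col, Matrix.mul_one]

/-- The vanishing of the antisymmetrizer on `p + 1` factors determines the last generator between
skewsymmetric vectors. -/
theorem IsSkewPair.rowLast_mul_braid_mul_colLast (h : IsSkewPair R q p u v)
    (hR : IsEvenHeckeSymmetry R q p) {r : ℕ} (hp : p = r + 1) :
    rowAt (Fin.last p) v * braidOver A R (p + 1) r * colAt (Fin.last p) u =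
      ((qNum q p)⁻¹ * q ^ p) • (1 : Matrix (Fin n) (Fin n) A) := by
  have h0 : skew q (braidOver A R (p + 1)) (p + 1) = 0 := by
    rw [skew_braidOver, hR.skewProj_succ]
    exact Matrix.map_zero _ (map_zero _)
  subst hp
  have hn := hR.qNum_ne_zero r
  rw [skew, smul_eq_zero, inv_eq_zero] at h0
  replace h0 := h0.resolve_left (hR.qNum_ne_zero (r + 1))
  have h1 : rowAt (Fin.last (r + 1)) v * (q ^ (r + 1) • 1 -
      qNum q (r + 1) • braidOver A R (r + 1 + 1) r) * colAt (Fin.last (r + 1)) u = 0 := by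
    have := congrArg (fun X => rowAt (Fin.last (r + 1)) v * X * colAt (Fin.last (r + 1)) u) h0
    simp only [Matrix.mul_zero, Matrix.zero_mul] at this
    rw [Matrix.mul_assoc (rowAt _ _), Matrix.mul_assoc (_ * _ : Matrix _ _ A), h.skew_mul_colLast,
      ← Matrix.mul_assoc, ← Matrix.mul_assoc, h.rowLast_mul_skew] at this
    exact this
  rw [Matrix.mul_sub, Matrix.sub_mul, Matrix.mul_smul, Matrix.mul_smul, Matrix.mul_one,
    Matrix.smul_mul, Matrix.smul_mul, h.row_mul_col, sub_eq_zero] at h1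
  rw [mul_smul, h1, smul_smul, inv_mul_cancel₀ hn, one_smul]

theorem IsSkewPair.rowLast_mul_upString (h : IsSkewPair R q p u v)
    (hR : IsEvenHeckeSymmetry R q p) : ∀ k, k < p →
    rowAt (Fin.last p) v * upString (braidOver A R (p + 1)) k =
      (-q⁻¹) ^ k • rowAt (Fin.last p) v
  | 0, _ => by simp [upString]
  | k + 1, hk => by
    rw [upString, ← Matrix.mul_assoc, h.rowLast_mul_upString hR k (by omega), Matrix.smul_mul,
      h.rowLast_mul hR k hk, smul_smul, pow_succ]

/-- The contraction of the covector in the first factors with the vector in the last ones is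
inverse, up to a scalar, to the transport. -/
theorem IsSkewPair.contraction_mul_upTransport (h : IsSkewPair R q p u v)
    (hR : IsEvenHeckeSymmetry R q p) {r : ℕ} (hp : p = r + 1) :
    rowAt (Fin.last p) v * colAt 0 u * upTransport R u v =
      ((-q⁻¹) ^ r * ((qNum q p)⁻¹ * q ^ p)) • (1 : Matrix (Fin n) (Fin n) A) := by
  have h1 := h.rowLast_mul_braid_mul_colLast hR hp
  rw [Matrix.mul_assoc, ← h.upString_mul_colLast hR, ← Matrix.mul_assoc]
  have h2 := h.rowLast_mul_upString hR r (by omega)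
  rw [show upString (braidOver A R (p + 1)) p =
    upString (braidOver A R (p + 1)) r * braidOver A R (p + 1) r by rw [← upString, hp],
    ← Matrix.mul_assoc, h2, Matrix.smul_mul, Matrix.smul_mul, h1, smul_smul]

theorem jm_one_eq_strings {B : Type*} [Ring B] (g : ℕ → B) (k : ℕ) :
    jm g 1 k = downString g k k * upString g k := by
  rw [jm_eq_strings, mul_one]

/-- The two transports are inverse to each other up to the value `q ^ 2` of the last Jucys-Murphy
element of the Hecke algebra. -/
theorem IsSkewPair.downTransport_mul_upTransport (h : IsSkewPair R q p u v)
    (hR : IsEvenHeckeSymmetry R q p) {r : ℕ} (hp : p = r + 1) :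
    downTransport R u v * upTransport R u v = q ^ 2 • (1 : Matrix (Fin n) (Fin n) A) := by
  have hq0 := hR.q_ne_zero
  have hn := hR.qNum_ne_zero r
  have habs := ((hR.isHecke A (p + 1)).skew_absorb hR.q_ne_zero hR.qNum_ne_zero
    hR.sub_inv_ne_zero p (by omega))
  have h1 := (hR.isHecke A (p + 1)).mul_jm_one_mul hq0 hR.sub_inv_ne_zero r (by omega) _ _
    (fun i hi => habs.1 i (by omega)) (fun i hi => habs.2 i (by omega))
  have h2 := congrArg (fun X => rowAt (Fin.last p) v * X * colAt (Fin.last p) u) h1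
  have h3 : ∀ X : Matrix (Fin (p + 1) → Fin n) (Fin (p + 1) → Fin n) A,
      rowAt (Fin.last p) v * (skew q (braidOver A R (p + 1)) p * X *
        skew q (braidOver A R (p + 1)) p) * colAt (Fin.last p) u =
      rowAt (Fin.last p) v * X * colAt (Fin.last p) u := by
    intro X
    rw [Matrix.mul_assoc (rowAt _ _), Matrix.mul_assoc (_ * _ : Matrix _ _ A), h.skew_mul_colLast,
      ← Matrix.mul_assoc, ← Matrix.mul_assoc, h.rowLast_mul_skew]
  have h4 : rowAt (Fin.last p) v * (skew q (braidOver A R (p + 1)) p *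
        skew q (braidOver A R (p + 1)) p) * colAt (Fin.last p) u = 1 := by
    rw [← Matrix.mul_assoc, h.rowLast_mul_skew, h.rowLast_mul_skew, h.row_mul_col]
  simp only [Matrix.mul_add, Matrix.add_mul, Matrix.mul_smul, Matrix.smul_mul, h3, h4,
    h.rowLast_mul_braid_mul_colLast hR hp] at h2
  have h5 : downTransport R u v * upTransport R u v =
      rowAt (Fin.last p) v * jm (braidOver A R (p + 1)) 1 (r + 1) * colAt (Fin.last p) u := by
    rw [jm_one_eq_strings, ← hp, Matrix.mul_assoc, Matrix.mul_assoc, h.upString_mul_colLast hR,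
      ← Matrix.mul_assoc, ← Matrix.mul_assoc, h.rowLast_mul_downString hR,
      Matrix.mul_assoc _ _ (colAt 0 u), h.row_mul_col, Matrix.mul_one]
  rw [h5, h2, smul_smul]
  have h6 : (q - q⁻¹) * q⁻¹ ^ r * qNum q (r + 1) * ((qNum q p)⁻¹ * q ^ p) = q ^ 2 - 1 := by
    subst hp
    rw [inv_pow]
    field_simp
    ring
  rw [h6]
  module

end Transport

/-! ### The Cayley-Hamilton identity and centrality for the reflection equation -/

section Main

variable {𝕜 : Type*} [Field 𝕜] {n p : ℕ} {R : Matrix (Fin n × Fin n) (Fin n × Fin n) 𝕜} {q : 𝕜}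

theorem rowAt_map {A : Type*} [Ring A] [Algebra 𝕜 A] (i : Fin (p + 1)) (v : (Fin p → Fin n) → 𝕜) :
    rowAt i (algebraMap 𝕜 A ∘ v) = (rowAt i v).map (algebraMap 𝕜 A) := by
  ext a y
  simp [rowAt, apply_ite (algebraMap 𝕜 A)]

theorem colAt_map {A : Type*} [Ring A] [Algebra 𝕜 A] (i : Fin (p + 1)) (v : (Fin p → Fin n) → 𝕜) :
    colAt i (algebraMap 𝕜 A ∘ v) = (colAt i v).map (algebraMap 𝕜 A) := by
  ext a y
  simp [colAt, apply_ite (algebraMap 𝕜 A)]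

theorem upTransport_map (A : Type*) [Ring A] [Algebra 𝕜 A] (u v : (Fin p → Fin n) → 𝕜) :
    upTransport R (algebraMap 𝕜 A ∘ u) (algebraMap 𝕜 A ∘ v) =
      (upTransport R u v).map (algebraMap 𝕜 A) := by
  rw [upTransport, upTransport, Matrix.map_mul, Matrix.map_mul, rowAt_map, colAt_map]
  congr 2
  exact (map_upString (scalarExt A (Fin (p + 1) → Fin n)).toRingHom (braidOver 𝕜 R (p + 1)) p).symm

theorem downTransport_map (A : Type*) [Ring A] [Algebra 𝕜 A] (u v : (Fin p → Fin n) → 𝕜) :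
    downTransport R (algebraMap 𝕜 A ∘ u) (algebraMap 𝕜 A ∘ v) =
      (downTransport R u v).map (algebraMap 𝕜 A) := by
  rw [downTransport, downTransport, Matrix.map_mul, Matrix.map_mul, rowAt_map, colAt_map]
  congr 2
  exact (map_downString (scalarExt A (Fin (p + 1) → Fin n)).toRingHom
    (braidOver 𝕜 R (p + 1)) p p).symm

theorem scalar_mul_map {A : Type*} [Ring A] [Algebra 𝕜 A] (N : Matrix (Fin n) (Fin n) 𝕜) (a : A) :
    Matrix.scalar (Fin n) a * N.map (algebraMap 𝕜 A) =
      N.map (algebraMap 𝕜 A) * Matrix.scalar (Fin n) a := by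
  ext i j
  simp [Matrix.scalar_apply, Algebra.commutes]

theorem map_smul_one (A : Type*) [Ring A] [Algebra 𝕜 A] (c : 𝕜) :
    (c • (1 : Matrix (Fin n) (Fin n) 𝕜)).map (algebraMap 𝕜 A) = c • 1 := by
  ext i j
  by_cases hij : i = j
  · subst hij; simp [Algebra.algebraMap_eq_smul_one]
  · simp [hij]

variable {A : Type*} [Ring A] [Algebra 𝕜 A] {M : Matrix (Fin n) (Fin n) A}

theorem commute_esymOrd {B : Type*} [Ring B] {f : ℕ → B} {x : B} : ∀ l j,
    (∀ i, i < l → Commute x (f i)) → Commute x (esymOrd f l j)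
  | _, 0, _ => by rw [esymOrd_zero]; exact Commute.one_right _
  | 0, j + 1, _ => Commute.zero_right _
  | l + 1, j + 1, h =>
    (commute_esymOrd l (j + 1) (fun i hi => h i (by omega))).add_right
      ((commute_esymOrd l j (fun i hi => h i (by omega))).mul_right (h l (by omega)))

theorem commute_upString {B : Type*} [Ring B] {g : ℕ → B} {x : B} : ∀ k,
    (∀ i, i < k → Commute x (g i)) → Commute x (upString g k)
  | 0, _ => Commute.one_right _
  | k + 1, h => (commute_upString k (fun i hi => h i (by omega))).mul_right (h k (by omega))

/-- The skewsymmetric covector is an eigenvector of the elementary symmetric polynomials of the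
Jucys-Murphy elements, the eigenvalue being a coefficient. -/
theorem IsEvenHeckeSymmetry.rowLast_mul_esymOrd (hR : IsEvenHeckeSymmetry R q p) (hp : 0 < p)
    {u v : (Fin p → Fin n) → A} (h : IsSkewPair R q p u v)
    (hRE : ∀ m, 1 < m → braidOver A R m 0 * inFirst M m * braidOver A R m 0 * inFirst M m =
      inFirst M m * braidOver A R m 0 * inFirst M m * braidOver A R m 0) {j : ℕ} (hj : j ≤ p) :
    rowAt (Fin.last p) v * esymOrd (jm (braidOver A R (p + 1)) (inFirst M (p + 1))) p j =
      Matrix.scalar (Fin n) (sigma R q p M j) * rowAt (Fin.last p) v := by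
  have h1 := h.eq_mul_rowLast hR (X := rowAt (Fin.last p) v *
    esymOrd (jm (braidOver A R (p + 1)) (inFirst M (p + 1))) p j) (fun i hi => by
      have h2 := ((hR.isHecke A (p + 1)).esymOrd_comm
        (inFirst_comm_braidOver M R (p + 1)) (hRE (p + 1)) p j i hi (by omega)).eq
      rw [Matrix.mul_assoc, h2, ← Matrix.mul_assoc, h.rowLast_mul hR i hi, Matrix.smul_mul])
  rw [h1, ← loc_castSucc_esymOrd M hp j, rowAt_mul_loc, rowAt_mul_colAt, hR.sigma_eq h M hj,
    Matrix.dotProduct_mulVec]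

/-- The Cayley-Hamilton identity for solutions of the reflection equation, with the coefficients on
the left.  The characteristic identity of the first of the commuting Jucys-Murphy elements is
sandwiched between the covector in the first `p` factors, on which their symmetric polynomials act
by the coefficients, and the vector in the last `p` factors, which commutes with `M_1`. -/
theorem IsEvenHeckeSymmetry.cayleyHamilton (hR : IsEvenHeckeSymmetry R q p) (hp : 0 < p)
    (hRE : ∀ m, 1 < m → braidOver A R m 0 * inFirst M m * braidOver A R m 0 * inFirst M m =
      inFirst M m * braidOver A R m 0 * inFirst M m * braidOver A R m 0) :
    ∑ k ∈ Finset.range (p + 1), Matrix.scalar (Fin n) (sigma R q p M (p - k)) * (-M) ^ k = 0 := by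
  obtain ⟨u, v, huv⟩ := hR.exists_skewPair
  obtain ⟨r, rfl⟩ : ∃ r, p = r + 1 := ⟨p - 1, by omega⟩
  have h := huv.extend A
  set v' := algebraMap 𝕜 A ∘ v
  set u' := algebraMap 𝕜 A ∘ u
  have hL := inFirst_comm_braidOver M R (r + 1 + 1)
  have h1 := sum_esymOrd_mul_pow (jm (braidOver A R (r + 1 + 1)) (inFirst M (r + 1 + 1))) r
    (fun i hi => by
      have := (hR.isHecke A (r + 1 + 1)).jm_comm hL (hRE _) 0 i (by omega)
      rwa [Nat.zero_add] at this)
  have hpow : ∀ k, (-inFirst M (r + 1 + 1)) ^ k * colAt 0 u' = colAt 0 u' * (-M) ^ k := by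
    intro k
    induction k with
    | zero => simp
    | succ k ih =>
      rw [pow_succ, Matrix.mul_assoc, Matrix.neg_mul, h.inFirst_mul_colZero, ← Matrix.mul_neg,
        ← Matrix.mul_assoc, ih, Matrix.mul_assoc, ← pow_succ]
  have h2 := congrArg (fun X => rowAt (Fin.last (r + 1)) v' * X * colAt 0 u') h1
  simp only [Matrix.mul_zero, Matrix.zero_mul, Matrix.mul_sum, Matrix.sum_mul] at h2
  -- `K` has entries in the ground field, so that a one-sided inverse is two-sided
  set K := rowAt (Fin.last (r + 1)) v * colAt 0 u with hK
  have hKA : rowAt (Fin.last (r + 1)) v' * colAt 0 u' = K.map (algebraMap 𝕜 A) := by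
    rw [hK, Matrix.map_mul, ← rowAt_map, ← colAt_map]
  have h3 : K.map (algebraMap 𝕜 A) * ∑ k ∈ Finset.range (r + 1 + 1),
      Matrix.scalar (Fin n) (sigma R q (r + 1) M (r + 1 - k)) * (-M) ^ k = 0 := by
    rw [← h2, Matrix.mul_sum]
    refine Finset.sum_congr rfl fun k _ => ?_
    rw [← Matrix.mul_assoc (rowAt _ _), hR.rowLast_mul_esymOrd hp h hRE (by omega),
      Matrix.mul_assoc, show jm (braidOver A R (r + 1 + 1)) (inFirst M (r + 1 + 1)) 0 =
        inFirst M (r + 1 + 1) from rfl, hpow, Matrix.mul_assoc,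
      ← Matrix.mul_assoc (rowAt _ _), hKA, ← Matrix.mul_assoc, ← Matrix.mul_assoc, scalar_mul_map]
  have h4 := huv.contraction_mul_upTransport hR rfl
  set c := (-q⁻¹) ^ r * ((qNum q (r + 1))⁻¹ * q ^ (r + 1))
  have hc : c ≠ 0 := mul_ne_zero (pow_ne_zero _ (neg_ne_zero.mpr (inv_ne_zero hR.q_ne_zero)))
    (mul_ne_zero (inv_ne_zero (hR.qNum_ne_zero r)) (pow_ne_zero _ hR.q_ne_zero))
  have h5 : K * (c⁻¹ • upTransport R u v) = 1 := by
    rw [Matrix.mul_smul, h4, smul_smul, inv_mul_cancel₀ hc, one_smul]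
  have h6 := congrArg
    (fun X : Matrix (Fin n) (Fin n) 𝕜 => X.map (algebraMap 𝕜 A)) (mul_eq_one_comm.mp h5)
  simp only [Matrix.map_mul] at h6
  have h7 := congrArg (fun X => (c⁻¹ • upTransport R u v).map (algebraMap 𝕜 A) * X) h3
  simp only [← Matrix.mul_assoc, h6, Matrix.mul_zero] at h7
  simpa using h7

/-- The coefficients commute with the entries of a solution of the reflection equation.  The
symmetric polynomials of all `p + 1` Jucys-Murphy elements commute with the strings that transport
the skewsymmetric vectors; splitting off the last or the first of these elements expresses each
coefficient through the preceding one and through elements that commute with `M`. -/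
theorem IsEvenHeckeSymmetry.sigma_comm (hR : IsEvenHeckeSymmetry R q p) (hp : 0 < p)
    (hRE : ∀ m, 1 < m → braidOver A R m 0 * inFirst M m * braidOver A R m 0 * inFirst M m =
      inFirst M m * braidOver A R m 0 * inFirst M m * braidOver A R m 0) : ∀ j, j ≤ p →
    Matrix.scalar (Fin n) (sigma R q p M j) * M = M * Matrix.scalar (Fin n) (sigma R q p M j) := by
  obtain ⟨u, v, huv⟩ := hR.exists_skewPair
  obtain ⟨r, hr⟩ : ∃ r, p = r + 1 := ⟨p - 1, by omega⟩
  have h := huv.extend A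
  set v' := algebraMap 𝕜 A ∘ v with hv'
  set u' := algebraMap 𝕜 A ∘ u with hu'
  set g := braidOver A R (p + 1) with hg
  set L := inFirst M (p + 1) with hLdef
  have hH := hR.isHecke A (p + 1)
  have hL := inFirst_comm_braidOver M R (p + 1)
  set N := upTransport R u' v' with hN
  set N' := downTransport R u' v' with hN'
  -- over the ground field `N' * N = q ^ 2 • 1` implies `N * N' = q ^ 2 • 1`
  have hNN : N * N' = q ^ 2 • 1 := by
    have h1 := huv.downTransport_mul_upTransport hR hr
    have hq2 : q ^ 2 ≠ 0 := pow_ne_zero _ hR.q_ne_zero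
    have h2 : ((q ^ 2)⁻¹ • downTransport R u v) * upTransport R u v = 1 := by
      rw [Matrix.smul_mul, h1, smul_smul, inv_mul_cancel₀ hq2, one_smul]
    have h3 := mul_eq_one_comm.mp h2
    have h4 : upTransport R u v * downTransport R u v = q ^ 2 • 1 := by
      rw [← h3, Matrix.mul_smul, smul_smul, mul_inv_cancel₀ hq2, one_smul]
    rw [hN, hN', hu', hv', upTransport_map, downTransport_map, ← Matrix.map_mul, h4, map_smul_one]
  have hNs : ∀ a : A, Matrix.scalar (Fin n) a * N = N * Matrix.scalar (Fin n) a := by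
    intro a
    rw [hN, hu', hv', upTransport_map, scalar_mul_map]
  -- `D j` involves the Jucys-Murphy elements after the first one, which commute with `L`
  let D : ℕ → Matrix (Fin n) (Fin n) A := fun j =>
    rowAt 0 v' * esymOrd (fun i => jm g L (i + 1)) p j * colAt 0 u'
  have hD : ∀ j, M * D j = D j * M := by
    intro j
    have hc : Commute L (esymOrd (fun i => jm g L (i + 1)) p j) :=
      commute_esymOrd p j fun i hi => by
        have := hH.jm_comm hL (hRE _) 0 (i + 1) (by omega)
        rwa [Nat.zero_add] at this
    calc M * D j = (M * rowAt 0 v') * esymOrd (fun i => jm g L (i + 1)) p j * colAt 0 u' := by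
          simp only [D, Matrix.mul_assoc]
      _ = rowAt 0 v' * (L * esymOrd (fun i => jm g L (i + 1)) p j) * colAt 0 u' := by
          rw [← h.rowZero_mul_inFirst]; simp only [Matrix.mul_assoc, hLdef]
      _ = rowAt 0 v' * esymOrd (fun i => jm g L (i + 1)) p j * (L * colAt 0 u') := by
          rw [hc.eq]; simp only [Matrix.mul_assoc]
      _ = _ := by
          rw [hLdef, h.inFirst_mul_colZero]; simp only [D, Matrix.mul_assoc, hLdef]
  have hstep : ∀ j, j + 1 ≤ p → D (j + 1) + M * D j =
      Matrix.scalar (Fin n) (sigma R q p M (j + 1)) +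
        q ^ 2 • (Matrix.scalar (Fin n) (sigma R q p M j) * M) := by
    intro j hj
    set E := esymOrd (jm g L) (p + 1) (j + 1) with hE
    have hcomm : Commute E (upString g p) :=
      commute_upString p fun i hi => hH.esymOrd_comm hL (hRE _) (p + 1) (j + 1) i (by omega) le_rfl
    -- split off the first Jucys-Murphy element, which is `L`
    have e1 : rowAt 0 v' * E * colAt 0 u' = D (j + 1) + M * D j := by
      rw [hE, esymOrd_succ', Matrix.mul_add, Matrix.add_mul]
      congr 1
      rw [← Matrix.mul_assoc, show jm g L 0 = L from rfl, hLdef, h.rowZero_mul_inFirst]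
      simp only [D, Matrix.mul_assoc, hLdef]
    -- split off the last Jucys-Murphy element, which is `L` between two strings
    have e2 : rowAt (Fin.last p) v' * E * colAt (Fin.last p) u' =
        Matrix.scalar (Fin n) (sigma R q p M (j + 1)) +
          Matrix.scalar (Fin n) (sigma R q p M j) * (N' * M * N) := by
      rw [hE, esymOrd, Matrix.mul_add, Matrix.add_mul]
      congr 1
      · rw [hR.rowLast_mul_esymOrd hp h hRE hj, Matrix.mul_assoc, h.row_mul_col, Matrix.mul_one]
      · rw [← Matrix.mul_assoc, hR.rowLast_mul_esymOrd hp h hRE (by omega), jm_eq_strings]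
        calc Matrix.scalar (Fin n) (sigma R q p M j) * rowAt (Fin.last p) v' *
              (downString g p p * L * upString g p) * colAt (Fin.last p) u'
            = Matrix.scalar (Fin n) (sigma R q p M j) * ((rowAt (Fin.last p) v' *
              downString g p p) * L * (upString g p * colAt (Fin.last p) u')) := by
              simp only [Matrix.mul_assoc]
          _ = Matrix.scalar (Fin n) (sigma R q p M j) * (N' * (rowAt 0 v' * L) *
              colAt 0 u' * N) := by
              rw [hg, h.rowLast_mul_downString hR, h.upString_mul_colLast hR]
              simp only [Matrix.mul_assoc, hN, hN']
          _ = Matrix.scalar (Fin n) (sigma R q p M j) * (N' * M * (rowAt 0 v' *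
              colAt 0 u') * N) := by
              rw [hLdef, h.rowZero_mul_inFirst]
              simp only [Matrix.mul_assoc]
          _ = _ := by rw [h.row_mul_col, Matrix.mul_one]
    -- `E` commutes with the string that relates the two ways of splitting
    have e3 : (D (j + 1) + M * D j) * N = N * (Matrix.scalar (Fin n) (sigma R q p M (j + 1)) +
          Matrix.scalar (Fin n) (sigma R q p M j) * (N' * M * N)) := by
      rw [← e1, ← e2]
      calc rowAt 0 v' * E * colAt 0 u' * N = rowAt 0 v' * E * (colAt 0 u' * N) := by
            rw [Matrix.mul_assoc]
        _ = rowAt 0 v' * (E * upString g p) * colAt (Fin.last p) u' := by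
            rw [hN, ← h.upString_mul_colLast hR]; simp only [Matrix.mul_assoc, hg]
        _ = (rowAt 0 v' * upString g p) * E * colAt (Fin.last p) u' := by
            rw [hcomm.eq]; simp only [Matrix.mul_assoc]
        _ = _ := by
            rw [hg, h.rowZero_mul_upString hR]; simp only [Matrix.mul_assoc, hN]
    have e4 := congrArg (fun X => X * N') e3
    have e5 : N * (Matrix.scalar (Fin n) (sigma R q p M (j + 1)) +
          Matrix.scalar (Fin n) (sigma R q p M j) * (N' * M * N)) * N' =
        Matrix.scalar (Fin n) (sigma R q p M (j + 1)) * (N * N') +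
          Matrix.scalar (Fin n) (sigma R q p M j) * (N * N') * M * (N * N') := by
      rw [Matrix.mul_add, Matrix.add_mul]
      simp only [← Matrix.mul_assoc, ← hNs]
    simp only [e5] at e4
    rw [Matrix.mul_assoc, hNN] at e4
    simp only [Matrix.mul_smul, Matrix.mul_one, Matrix.smul_mul] at e4
    have hq2 : q ^ 2 ≠ 0 := pow_ne_zero _ hR.q_ne_zero
    rw [← smul_add] at e4
    exact smul_right_injective _ hq2 e4
  intro j
  induction j with
  | zero =>
    intro _
    have : sigma R q p M 0 = 1 := by
      rw [hR.sigma_eq h M (Nat.zero_le _), esymOrd_zero, Matrix.one_mulVec, h.dot_eq_one]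
    rw [this, map_one, Matrix.one_mul, Matrix.mul_one]
  | succ j ih =>
    intro hj
    have ih := ih (by omega)
    have h1 := hstep j hj
    have h2 : Matrix.scalar (Fin n) (sigma R q p M (j + 1)) =
        D (j + 1) + M * D j - q ^ 2 • (Matrix.scalar (Fin n) (sigma R q p M j) * M) := by
      rw [h1, add_sub_cancel_right]
    have hDc : ∀ i, Commute (D i) M := fun i => (hD i).symm
    have hs : Commute (Matrix.scalar (Fin n) (sigma R q p M j) * M) M :=
      Commute.mul_left ih (Commute.refl M)
    rw [h2]
    exact ((hDc _).add_left ((Commute.refl M).mul_left (hDc j))).sub_left (hs.smul_left _)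

end Main

/-! ### The quadratic-linear algebras -/

section QL

variable {𝕜 : Type*} [Field 𝕜] {n p : ℕ} {R : Matrix (Fin n × Fin n) (Fin n × Fin n) 𝕜} {q ħ : 𝕜}
  {A : Type*} [Ring A] [Algebra 𝕜 A]

/-- The matrix `M` over `A` satisfies the defining relation of the quadratic-linear algebra. -/
def SatisfiesQL (R : Matrix (Fin n × Fin n) (Fin n × Fin n) 𝕜) (ħ : 𝕜)
    (M : Matrix (Fin n) (Fin n) A) : Prop :=
  R.map (algebraMap 𝕜 A) * (M ⊗ₖ (1 : Matrix (Fin n) (Fin n) A)) *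
      R.map (algebraMap 𝕜 A) * (M ⊗ₖ (1 : Matrix (Fin n) (Fin n) A)) -
    (M ⊗ₖ (1 : Matrix (Fin n) (Fin n) A)) * R.map (algebraMap 𝕜 A) *
      (M ⊗ₖ (1 : Matrix (Fin n) (Fin n) A)) * R.map (algebraMap 𝕜 A) =
    ħ • (R.map (algebraMap 𝕜 A) * (M ⊗ₖ (1 : Matrix (Fin n) (Fin n) A)) -
      (M ⊗ₖ (1 : Matrix (Fin n) (Fin n) A)) * R.map (algebraMap 𝕜 A))

theorem map_kronecker_one {F : Type*} [Ring F] [Algebra 𝕜 F] (f : F →ₐ[𝕜] A)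
    (M : Matrix (Fin n) (Fin n) F) :
    (M ⊗ₖ (1 : Matrix (Fin n) (Fin n) F)).map f = M.map f ⊗ₖ (1 : Matrix (Fin n) (Fin n) A) := by
  ext a b
  simp [Matrix.one_apply, apply_ite f]

theorem map_map_algebraMap {F : Type*} [Ring F] [Algebra 𝕜 F] (f : F →ₐ[𝕜] A) {ι : Type*}
    (T : Matrix ι ι 𝕜) : (T.map (algebraMap 𝕜 F)).map f = T.map (algebraMap 𝕜 A) := by
  ext a b
  simp

theorem map_quadraticPart (f : FreeAlgebra 𝕜 (Fin n × Fin n) →ₐ[𝕜] A)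
    (M : Matrix (Fin n) (Fin n) A) (hM : (freeGen 𝕜 n).map f = M) :
    (quadraticPart R).map f =
      R.map (algebraMap 𝕜 A) * (M ⊗ₖ (1 : Matrix (Fin n) (Fin n) A)) *
        R.map (algebraMap 𝕜 A) * (M ⊗ₖ (1 : Matrix (Fin n) (Fin n) A)) -
      (M ⊗ₖ (1 : Matrix (Fin n) (Fin n) A)) * R.map (algebraMap 𝕜 A) *
        (M ⊗ₖ (1 : Matrix (Fin n) (Fin n) A)) * R.map (algebraMap 𝕜 A) := by
  rw [← hM, ← map_kronecker_one, ← map_map_algebraMap f R, quadraticPart]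
  simp only [← AlgHom.mapMatrix_apply, map_sub, map_mul]

theorem map_linearPart (f : FreeAlgebra 𝕜 (Fin n × Fin n) →ₐ[𝕜] A)
    (M : Matrix (Fin n) (Fin n) A) (hM : (freeGen 𝕜 n).map f = M) :
    (linearPart R).map f =
      R.map (algebraMap 𝕜 A) * (M ⊗ₖ (1 : Matrix (Fin n) (Fin n) A)) -
      (M ⊗ₖ (1 : Matrix (Fin n) (Fin n) A)) * R.map (algebraMap 𝕜 A) := by
  rw [← hM, ← map_kronecker_one, ← map_map_algebraMap f R, linearPart]
  simp only [← AlgHom.mapMatrix_apply, map_sub, map_mul]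

theorem satisfiesQL_genMatrix (R : Matrix (Fin n × Fin n) (Fin n × Fin n) 𝕜) (ħ : 𝕜) :
    SatisfiesQL R ħ (genMatrix R ħ) := by
  rw [SatisfiesQL, ← map_quadraticPart (RingQuot.mkAlgHom 𝕜 (QLRel R ħ)) (genMatrix R ħ) rfl,
    ← map_linearPart (RingQuot.mkAlgHom 𝕜 (QLRel R ħ)) (genMatrix R ħ) rfl]
  ext a b
  have := RingQuot.mkAlgHom_rel 𝕜 (QLRel.entry (R := R) (ħ := ħ) a b)
  rw [map_smul] at this
  exact this

/-- The homomorphism from the quadratic-linear algebra given by a solution of its relation. -/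
def qlLift (M : Matrix (Fin n) (Fin n) A) (hM : SatisfiesQL R ħ M) : QLAlgebra R ħ →ₐ[𝕜] A :=
  RingQuot.liftAlgHom 𝕜 ⟨FreeAlgebra.lift 𝕜 (fun x => M x.1 x.2), by
    have h0 : (freeGen 𝕜 n).map (FreeAlgebra.lift 𝕜 (fun x : Fin n × Fin n => M x.1 x.2)) = M := by
      ext i j
      simp [freeGen]
    rintro _ _ ⟨a, b⟩
    have h1 := congrFun (congrFun hM a) b
    rw [← map_quadraticPart _ M h0, ← map_linearPart _ M h0] at h1
    rw [map_smul]
    exact h1⟩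

theorem genMatrix_map_qlLift (M : Matrix (Fin n) (Fin n) A) (hM : SatisfiesQL R ħ M) :
    (genMatrix R ħ).map (qlLift M hM) = M := by
  ext i j
  simp [genMatrix, qlLift, freeGen]

/-- Homomorphisms from the quadratic-linear algebra are determined by the images of the
generators. -/
theorem qlAlgebra_hom_ext {f g : QLAlgebra R ħ →ₐ[𝕜] A}
    (h : (genMatrix R ħ).map f = (genMatrix R ħ).map g) : f = g := by
  apply RingQuot.ringQuot_ext'
  apply FreeAlgebra.hom_ext
  funext x
  exact congrFun (congrFun h x.1) x.2

/-- An element of the quadratic-linear algebra that commutes with the generators is central. -/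
theorem mem_center_of_commute_gen {x : QLAlgebra R ħ}
    (h : ∀ i j, Commute x (genMatrix R ħ i j)) : x ∈ Subalgebra.center 𝕜 (QLAlgebra R ħ) := by
  rw [Subalgebra.mem_center_iff]
  intro b
  obtain ⟨a, rfl⟩ := RingQuot.mkAlgHom_surjective 𝕜 (QLRel R ħ) b
  refine (?_ : Commute x (RingQuot.mkAlgHom 𝕜 (QLRel R ħ) a)).symm.eq
  induction a using FreeAlgebra.induction with
  | grade0 r => rw [AlgHom.commutes]; exact Algebra.commute_algebraMap_right r x
  | grade1 y => exact h y.1 y.2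
  | mul a b ha hb => rw [map_mul]; exact ha.mul_right hb
  | add a b ha hb => rw [map_add]; exact ha.add_right hb

theorem sub_smul_kronecker_one (M : Matrix (Fin n) (Fin n) A) (c : 𝕜) :
    (M - c • (1 : Matrix (Fin n) (Fin n) A)) ⊗ₖ (1 : Matrix (Fin n) (Fin n) A) =
      M ⊗ₖ (1 : Matrix (Fin n) (Fin n) A) - c • 1 := by
  ext ⟨a, b⟩ ⟨a', b'⟩
  by_cases h1 : a = a' <;> by_cases h2 : b = b' <;>
    simp [h1, h2, Prod.ext_iff]

/-- The shift by a scalar changes the parameter of the relation, by the Hecke condition on `R`. -/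
theorem SatisfiesQL.sub_smul_one (hH : R * R = 1 + (q - q⁻¹) • R) {M : Matrix (Fin n) (Fin n) A}
    (hM : SatisfiesQL R ħ M) (c : 𝕜) :
    SatisfiesQL R (ħ - c * (q - q⁻¹)) (M - c • (1 : Matrix (Fin n) (Fin n) A)) := by
  have hT : R.map (algebraMap 𝕜 A) * R.map (algebraMap 𝕜 A) =
      1 + (q - q⁻¹) • R.map (algebraMap 𝕜 A) := by
    have := congrArg (scalarExt A (Fin n × Fin n)) hH
    rwa [map_mul, map_add, map_one, map_smul] at this
  rw [SatisfiesQL] at hM ⊢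
  rw [sub_smul_kronecker_one]
  generalize R.map (algebraMap 𝕜 A) = T at hM hT ⊢
  generalize M ⊗ₖ (1 : Matrix (Fin n) (Fin n) A) = X at hM ⊢
  have h1 : T * (X - c • 1) * T * (X - c • 1) - (X - c • 1) * T * (X - c • 1) * T =
      (T * X * T * X - X * T * X * T) - c • ((T * T) * X - X * (T * T)) := by
    simp only [mul_sub, sub_mul, smul_mul_assoc, mul_smul_comm, mul_one, one_mul, mul_assoc]
    module
  rw [h1, hM, hT]
  simp only [mul_sub, sub_mul, mul_add, add_mul, smul_mul_assoc, mul_smul_comm, mul_one, one_mul]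
  module

theorem SatisfiesQL.reflection {M : Matrix (Fin n) (Fin n) A} (hM : SatisfiesQL R 0 M) (m : ℕ)
    (hm : 1 < m) : braidOver A R m 0 * inFirst M m * braidOver A R m 0 * inFirst M m =
      inFirst M m * braidOver A R m 0 * inFirst M m * braidOver A R m 0 := by
  refine reflection_inFirst ?_ m hm
  rw [SatisfiesQL, zero_smul, sub_eq_zero] at hM
  exact hM

theorem scalar_algebraMap (c : 𝕜) :
    Matrix.scalar (Fin n) (algebraMap 𝕜 A c) = c • (1 : Matrix (Fin n) (Fin n) A) := by
  ext i j
  by_cases h : i = j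
  · subst h; simp [Algebra.algebraMap_eq_smul_one]
  · simp [h]

theorem map_sub_smul_one {F : Type*} [Ring F] [Algebra 𝕜 F] (f : F →ₐ[𝕜] A)
    (M : Matrix (Fin n) (Fin n) F) (c : 𝕜) : (M - c • 1).map f = M.map f - c • 1 := by
  simp only [← AlgHom.mapMatrix_apply, map_sub, map_smul, map_one]

theorem sub_smul_sub_neg_smul (M : Matrix (Fin n) (Fin n) A) (c : 𝕜) :
    M - c • 1 - (-c) • 1 = M := by
  rw [neg_smul, sub_neg_eq_add, sub_add_cancel]

theorem sub_neg_smul_sub_smul (M : Matrix (Fin n) (Fin n) A) (c : 𝕜) :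
    M - (-c) • 1 - c • 1 = M := by
  rw [neg_smul, sub_neg_eq_add, add_sub_cancel_right]

/-- The shift of the generators, as an isomorphism of algebras. -/
theorem exists_shift_equiv (hH : R * R = 1 + (q - q⁻¹) • R) (hq1 : q - q⁻¹ ≠ 0) (ħ : 𝕜) :
    ∃ φ : QLAlgebra R (0 : 𝕜) ≃ₐ[𝕜] QLAlgebra R ħ,
      (genMatrix R (0 : 𝕜)).map φ = genMatrix R ħ - (ħ / (q - q⁻¹)) • 1 := by
  set c := ħ / (q - q⁻¹) with hc
  have hcq : c * (q - q⁻¹) = ħ := div_mul_cancel₀ _ hq1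
  have h1 := (satisfiesQL_genMatrix R ħ).sub_smul_one hH c
  rw [hcq, sub_self] at h1
  have h2 := (satisfiesQL_genMatrix R 0).sub_smul_one hH (-c)
  rw [zero_sub, neg_mul, neg_neg, hcq] at h2
  refine ⟨AlgEquiv.ofAlgHom (qlLift _ h1) (qlLift _ h2) ?_ ?_, genMatrix_map_qlLift _ h1⟩
  · apply qlAlgebra_hom_ext
    rw [AlgHom.coe_comp, ← Matrix.map_map, genMatrix_map_qlLift, map_sub_smul_one,
      genMatrix_map_qlLift, sub_smul_sub_neg_smul]
    ext i j
    rfl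
  · apply qlAlgebra_hom_ext
    rw [AlgHom.coe_comp, ← Matrix.map_map, genMatrix_map_qlLift, map_sub_smul_one,
      genMatrix_map_qlLift, sub_neg_smul_sub_smul]
    ext i j
    rfl

theorem inFirst_map {F : Type*} [Ring F] [Algebra 𝕜 F] (f : F →ₐ[𝕜] A)
    (M : Matrix (Fin n) (Fin n) F) (m : ℕ) : (inFirst M m).map f = inFirst (M.map f) m := by
  unfold inFirst
  split_ifs
  · ext x y
    simp only [Matrix.map_apply, Matrix.of_apply, apply_ite f, map_zero]
  · exact Matrix.map_one f (map_zero f) (map_one f)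

theorem map_sigma {F : Type*} [Ring F] [Algebra 𝕜 F] (f : F →ₐ[𝕜] A)
    (M : Matrix (Fin n) (Fin n) F) (k : ℕ) :
    f (sigma R q p M k) = sigma R q p (M.map f) k := by
  rw [sigma, sigma, map_smul, ← inFirst_map, ← map_map_algebraMap f, ← map_map_algebraMap f]
  simp only [← AlgHom.mapMatrix_apply, ← map_mul, ← map_pow]
  rw [AlgHom.mapMatrix_apply, Matrix.trace, Matrix.trace, map_sum]
  rfl

/-- For `p = 0` the condition on the antisymmetrizer of one factor, which is the identity, forces
`V = 0`. -/
theorem IsEvenHeckeSymmetry.n_eq_zero (hR : IsEvenHeckeSymmetry R q 0) : n = 0 := by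
  by_contra hn
  have h := hR.skewProj_succ
  rw [zero_add, skewProj] at h
  have := congrFun (congrFun h (fun _ => ⟨0, Nat.pos_of_ne_zero hn⟩))
    (fun _ => ⟨0, Nat.pos_of_ne_zero hn⟩)
  simp at this

theorem IsEvenHeckeSymmetry.sigma_zero (hR : IsEvenHeckeSymmetry R q p)
    (M : Matrix (Fin n) (Fin n) A) : sigma R q p M 0 = 1 := by
  obtain ⟨u, v, huv⟩ := hR.exists_skewPair
  have h := huv.extend A
  rw [hR.sigma_eq h M (Nat.zero_le _), esymOrd_zero, Matrix.one_mulVec, h.dot_eq_one]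

theorem scalar_commute_entries {s : A} {M : Matrix (Fin n) (Fin n) A}
    (h : Matrix.scalar (Fin n) s * M = M * Matrix.scalar (Fin n) s) (i j : Fin n) :
    Commute s (M i j) := by
  have := congrFun (congrFun h i) j
  rw [Matrix.scalar_apply, Matrix.diagonal_mul, Matrix.mul_diagonal] at this
  exact this

/-- The coefficients of the shifted matrix, which satisfies the reflection equation, are central. -/
theorem IsEvenHeckeSymmetry.sigma_shift_mem_center (hR : IsEvenHeckeSymmetry R q p) (ħ : 𝕜)
    {j : ℕ} (hj : j ≤ p) : sigma R q p (genMatrix R ħ - (ħ / (q - q⁻¹)) • 1) j ∈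
      Subalgebra.center 𝕜 (QLAlgebra R ħ) := by
  apply mem_center_of_commute_gen
  intro a b
  have hp : 0 < p := by
    rcases Nat.eq_zero_or_pos p with rfl | hp
    · have := hR.n_eq_zero
      subst this
      exact a.elim0
    · exact hp
  have h1 := (satisfiesQL_genMatrix R ħ).sub_smul_one hR.hecke (ħ / (q - q⁻¹))
  rw [div_mul_cancel₀ _ hR.sub_inv_ne_zero, sub_self] at h1
  have h2 := scalar_commute_entries (hR.sigma_comm hp h1.reflection j hj) a b
  have h3 : genMatrix R ħ a b = (genMatrix R ħ - (ħ / (q - q⁻¹)) • 1) a b +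
      ((ħ / (q - q⁻¹)) • (1 : Matrix (Fin n) (Fin n) (QLAlgebra R ħ))) a b := by
    simp
  rw [h3]
  refine h2.add_right ?_
  rw [← scalar_algebraMap, Matrix.scalar_apply, Matrix.diagonal_apply]
  split_ifs
  · exact Algebra.commute_algebraMap_right _ _
  · exact Commute.zero_right _

theorem IsEvenHeckeSymmetry.sigma_mem_center (hR : IsEvenHeckeSymmetry R q p) (ħ : 𝕜)
    {k : ℕ} (hk : k ≤ p) : sigma R q p (genMatrix R ħ) k ∈
      Subalgebra.center 𝕜 (QLAlgebra R ħ) := by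
  have h := hR.sigma_sub_smul (genMatrix R ħ - (ħ / (q - q⁻¹)) • 1) (-(ħ / (q - q⁻¹))) hk
  rw [sub_smul_sub_neg_smul] at h
  rw [h]
  exact Subalgebra.sum_mem _ fun r _ =>
    Subalgebra.smul_mem _ (hR.sigma_shift_mem_center ħ (by omega)) _

theorem IsEvenHeckeSymmetry.sigmaH_mem_center (hR : IsEvenHeckeSymmetry R q p) (ħ : 𝕜)
    {j : ℕ} (hj : j ≤ p) : sigmaH R q ħ p (genMatrix R ħ) j ∈
      Subalgebra.center 𝕜 (QLAlgebra R ħ) :=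
  Subalgebra.add_mem _ (hR.sigma_mem_center ħ hj) (Subalgebra.sum_mem _ fun r _ =>
    Subalgebra.smul_mem _ (hR.sigma_mem_center ħ (by omega)) _)

end QL

/-! ### The shift of the characteristic polynomial -/

section Coeff

variable {𝕜 : Type*} [Field 𝕜] {n p : ℕ} {R : Matrix (Fin n × Fin n) (Fin n × Fin n) 𝕜} {q : 𝕜}
  {A : Type*} [Ring A] [Algebra 𝕜 A]

theorem qBinom_symm (q : 𝕜) {p k : ℕ} (hk : k ≤ p) : qBinom q p (p - k) = qBinom q p k := by
  rw [qBinom, qBinom, Nat.sub_sub_self hk, mul_comm]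

/-- The sum `ξ`, over the index `m = s - r`; the additional terms with `m < k` vanish. -/
theorem xi_eq_sum (q : 𝕜) {p s k : ℕ} (hks : k ≤ s) (hsp : s ≤ p) :
    xi q p s k = ∑ m ∈ Finset.range (s + 1), (-1) ^ (s - m) * (q ^ ((s - m) * (p - 1)))⁻¹ *
      (m.choose k : 𝕜) * ((p - m).choose (s - m) : 𝕜) * qBinom q p m := by
  rw [xi, ← Finset.sum_range_reflect _ (s + 1)]
  have hsub : Finset.range (s - k + 1) ⊆ Finset.range (s + 1) := by
    intro x hx
    simp only [Finset.mem_range] at hx ⊢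
    omega
  rw [Finset.sum_subset hsub (fun r hr hr' => by
    simp only [Finset.mem_range] at hr hr'
    rw [Nat.choose_eq_zero_of_lt (show s - r < k by omega)]
    simp)]
  refine Finset.sum_congr rfl fun r hr => ?_
  have hr := Finset.mem_range.mp hr
  rw [show s + 1 - 1 - r = s - r by omega, show s - (s - r) = r by omega,
    show p - (s - r) = p - s + r by omega]

theorem omega_self (hqn : ∀ r, qNum q (r + 1) ≠ 0) (p k : ℕ) : omega q p k k = 1 := by
  simp [omega, xi, inv_mul_cancel₀ (qBinom_ne_zero hqn p k)]

/-- The coefficient of `σ_{p-s}` that results from the shift of the matrix, followed by the opposite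
shift of the variable. -/
theorem shift_coeff_sum (q ħ : 𝕜) {s k : ℕ}
    (hks : k ≤ s) (hsp : s ≤ p) :
    ∑ m ∈ Finset.range (s + 1), (m.choose k : 𝕜) * (ħ / (q - q⁻¹)) ^ (m - k) *
      ((-(ħ / (q - q⁻¹))) ^ (s - m) * (q ^ ((s - m) * (p - 1)))⁻¹ * ((p - m).choose (s - m) : 𝕜) *
        (qBinom q p (p - m) / qBinom q p (p - s))) = ħ ^ (s - k) * omega q p s k := by
  rw [omega, xi_eq_sum q hks hsp, ← mul_assoc, Finset.mul_sum]
  refine Finset.sum_congr rfl fun m hm => ?_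
  have hm := Finset.mem_range.mp hm
  rcases Nat.lt_or_ge m k with hmk | hmk
  · rw [Nat.choose_eq_zero_of_lt hmk]
    simp
  · rw [qBinom_symm q (show m ≤ p by omega), qBinom_symm q hsp, neg_pow, div_pow, div_pow]
    have h1 : ħ ^ (s - k) = ħ ^ (m - k) * ħ ^ (s - m) := by
      rw [← pow_add]; congr 1; omega
    have h2 : (q - q⁻¹) ^ (s - k) = (q - q⁻¹) ^ (m - k) * (q - q⁻¹) ^ (s - m) := by
      rw [← pow_add]; congr 1; omega
    rw [h1, h2, mul_inv]
    ring

/-- The deformed coefficients are obtained from the coefficients of the shifted matrix by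
re-expanding powers of a shifted variable. -/
theorem IsEvenHeckeSymmetry.sigmaH_eq_sum (hR : IsEvenHeckeSymmetry R q p)
    (M : Matrix (Fin n) (Fin n) A) (ħ : 𝕜) {k : ℕ} (hk : k ≤ p) :
    sigmaH R q ħ p M (p - k) = ∑ m ∈ Finset.range (p + 1),
      ((m.choose k : 𝕜) * (ħ / (q - q⁻¹)) ^ (m - k)) •
        sigma R q p (M - (ħ / (q - q⁻¹)) • 1) (p - m) := by
  have hqn := hR.qNum_ne_zero
  let F : ℕ → ℕ → A := fun m s => ((m.choose k : 𝕜) * (ħ / (q - q⁻¹)) ^ (m - k) *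
    ((-(ħ / (q - q⁻¹))) ^ (s - m) * (q ^ ((s - m) * (p - 1)))⁻¹ * ((p - m).choose (s - m) : 𝕜) *
      (qBinom q p (p - m) / qBinom q p (p - s)))) • sigma R q p M (p - s)
  have h1 : ∀ m ∈ Finset.range (p + 1), ((m.choose k : 𝕜) * (ħ / (q - q⁻¹)) ^ (m - k)) •
        sigma R q p (M - (ħ / (q - q⁻¹)) • 1) (p - m) = ∑ s ∈ Finset.Ico m (p + 1), F m s := by
    intro m hm
    have hm := Finset.mem_range.mp hm
    rw [hR.sigma_sub_smul M _ (show p - m ≤ p by omega), Finset.smul_sum,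
      Finset.sum_Ico_eq_sum_range, show p + 1 - m = p - m + 1 by omega]
    refine Finset.sum_congr rfl fun r _ => ?_
    simp only [F]
    rw [smul_smul, Nat.add_sub_cancel_left, Nat.sub_sub]
  rw [Finset.sum_congr rfl h1, Finset.range_eq_Ico, Finset.sum_Ico_Ico_comm]
  have h2 : ∑ s ∈ Finset.Ico 0 (p + 1), ∑ m ∈ Finset.Ico 0 (s + 1), F m s =
      ∑ s ∈ Finset.Ico k (p + 1), (ħ ^ (s - k) * omega q p s k) • sigma R q p M (p - s) := by
    rw [← Finset.sum_Ico_consecutive _ (Nat.zero_le k) (show k ≤ p + 1 by omega)]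
    rw [Finset.sum_eq_zero, zero_add]
    · refine Finset.sum_congr rfl fun s hs => ?_
      have hs := Finset.mem_Ico.mp hs
      rw [← shift_coeff_sum q ħ hs.1 (by omega), Finset.sum_smul, Finset.range_eq_Ico]
    · intro s hs
      have hs := Finset.mem_Ico.mp hs
      refine Finset.sum_eq_zero fun m hm => ?_
      have hm := Finset.mem_Ico.mp hm
      simp only [F]
      rw [Nat.choose_eq_zero_of_lt (show m < k by omega)]
      simp
  rw [h2, Finset.sum_Ico_eq_sum_range, show p + 1 - k = p - k + 1 by omega,
    Finset.sum_range_succ', sigmaH, add_comm]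
  congr 1
  · rw [← Finset.Ico_add_one_right_eq_Icc, Finset.sum_Ico_eq_sum_range, Nat.add_sub_cancel]
    refine Finset.sum_congr rfl fun r hr => ?_
    have hr := Finset.mem_range.mp hr
    rw [show p - (p - k) = k by omega, show k + (r + 1) - k = 1 + r by omega,
      show k + (r + 1) = 1 + r + k by omega, show p - (1 + r + k) = p - k - (1 + r) by omega]
  · simp [omega_self hqn]

theorem IsEvenHeckeSymmetry.sigmaH_zero (hR : IsEvenHeckeSymmetry R q p)
    (M : Matrix (Fin n) (Fin n) A) (ħ : 𝕜) : sigmaH R q ħ p M 0 = 1 := by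
  rw [sigmaH, hR.sigma_zero]
  simp

theorem smul_one_sub_pow {T : Type*} [Ring T] [Algebra 𝕜 T] (x : T) (h : 𝕜) {m : ℕ} (hm : m ≤ p) :
    (h • 1 - x) ^ m = ∑ k ∈ Finset.range (p + 1), ((m.choose k : 𝕜) * h ^ (m - k)) • (-x) ^ k := by
  have hc : Commute (-x) (h • (1 : T)) := (Commute.one_right _).smul_right h
  rw [sub_eq_neg_add, hc.add_pow]
  refine (Finset.sum_congr rfl fun k _ => ?_).trans (Finset.sum_subset
    (Finset.range_mono (show m + 1 ≤ p + 1 by omega)) fun k _ hk => ?_)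
  · rw [smul_pow, one_pow, mul_smul_comm, mul_one, smul_mul_assoc, ← Nat.cast_comm,
      ← nsmul_eq_mul, mul_comm, mul_smul, Nat.cast_smul_eq_nsmul]
  · rw [Nat.choose_eq_zero_of_lt (by simpa using hk)]
    simp

/-- The binomial theorem for a polynomial in a shifted variable, with coefficients on the right. -/
theorem sum_shift_pow_mul {T : Type*} [Ring T] [Algebra 𝕜 T] (x : T) (h : 𝕜) (b : ℕ → T) :
    ∑ m ∈ Finset.range (p + 1), (h • 1 - x) ^ m * b (p - m) =
      ∑ k ∈ Finset.range (p + 1), (-x) ^ k *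
        ∑ m ∈ Finset.range (p + 1), ((m.choose k : 𝕜) * h ^ (m - k)) • b (p - m) := by
  simp only [Finset.mul_sum]
  rw [Finset.sum_comm]
  refine Finset.sum_congr rfl fun m hm => ?_
  rw [smul_one_sub_pow x h (Nat.lt_succ_iff.mp (Finset.mem_range.mp hm)), Finset.sum_mul]
  refine Finset.sum_congr rfl fun k _ => ?_
  rw [smul_mul_assoc, mul_smul_comm]

theorem scalar_smul (c : 𝕜) (a : A) :
    Matrix.scalar (Fin n) (c • a) = c • Matrix.scalar (Fin n) a := by
  ext i j
  simp only [Matrix.scalar_apply, Matrix.smul_apply, Matrix.diagonal_apply]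
  split_ifs <;> simp

/-- The Cayley-Hamilton identity for solutions of the quadratic-linear relation. -/
theorem IsEvenHeckeSymmetry.cayleyHamilton_sigmaH (hR : IsEvenHeckeSymmetry R q p) {ħ : 𝕜}
    {M : Matrix (Fin n) (Fin n) A} (hM : SatisfiesQL R ħ M) :
    (-M) ^ p + ∑ k ∈ Finset.range p, (-M) ^ k *
      Matrix.scalar (Fin n) (sigmaH R q ħ p M (p - k)) = 0 := by
  rcases Nat.eq_zero_or_pos p with rfl | hp
  · have := hR.n_eq_zero
    subst this
    exact Subsingleton.elim _ _
  -- the shifted matrix satisfies the reflection equation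
  have h1 := hM.sub_smul_one hR.hecke (ħ / (q - q⁻¹))
  rw [div_mul_cancel₀ _ hR.sub_inv_ne_zero, sub_self] at h1
  have h2 := hR.cayleyHamilton hp h1.reflection
  set h := ħ / (q - q⁻¹) with hh
  have h3 : ∑ m ∈ Finset.range (p + 1), (h • 1 - M) ^ m *
      Matrix.scalar (Fin n) (sigma R q p (M - h • 1) (p - m)) = 0 := by
    rw [← h2]
    refine Finset.sum_congr rfl fun m _ => ?_
    have hc : Commute (Matrix.scalar (Fin n) (sigma R q p (M - h • 1) (p - m))) (M - h • 1) :=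
      hR.sigma_comm hp h1.reflection (p - m) (by omega)
    rw [(hc.neg_right.pow_right m).eq, neg_sub]
  rw [sum_shift_pow_mul M h fun j => Matrix.scalar (Fin n) (sigma R q p (M - h • 1) j)] at h3
  have h4 : ∀ k ∈ Finset.range (p + 1), (-M) ^ k * ∑ m ∈ Finset.range (p + 1),
      ((m.choose k : 𝕜) * h ^ (m - k)) • Matrix.scalar (Fin n) (sigma R q p (M - h • 1) (p - m)) =
      (-M) ^ k * Matrix.scalar (Fin n) (sigmaH R q ħ p M (p - k)) := by
    intro k hk
    rw [hR.sigmaH_eq_sum M ħ (Nat.lt_succ_iff.mp (Finset.mem_range.mp hk)), map_sum]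
    simp only [scalar_smul, hh]
  rw [Finset.sum_congr rfl h4, Finset.sum_range_succ, Nat.sub_self, hR.sigmaH_zero, map_one,
    mul_one, add_comm] at h3
  exact h3

theorem chPoly_eq_sum {c : ℕ → A} (hc : c 0 = 1) : chPoly p c =
    ∑ k ∈ Finset.range (p + 1), (-Polynomial.X) ^ k * Polynomial.C (c (p - k)) := by
  rw [chPoly, Finset.sum_range_succ, Nat.sub_self, hc, map_one, mul_one, add_comm]

theorem map_chPoly {A B : Type*} [Ring A] [Ring B] (f : A →+* B) (p : ℕ) (c : ℕ → A) :
    (chPoly p c).map f = chPoly p fun k => f (c k) := by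
  simp [chPoly, Polynomial.map_sum]

theorem neg_X_pow_mul_C_comp (k : ℕ) (a : A) (h : 𝕜) :
    ((-Polynomial.X) ^ k * Polynomial.C a).comp (Polynomial.X - Polynomial.C (algebraMap 𝕜 A h)) =
      (h • 1 - Polynomial.X) ^ k * Polynomial.C a := by
  have h1 : ((-Polynomial.X) ^ k * Polynomial.C a : Polynomial A) =
      Polynomial.monomial k ((-1) ^ k * a) := by
    rw [neg_pow, ← Polynomial.C_mul_X_pow_eq_monomial, map_mul, map_pow, map_neg, map_one,
      mul_assoc, mul_assoc, Polynomial.X_pow_mul]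
  have h2 : Polynomial.C (algebraMap 𝕜 A h) = h • (1 : Polynomial A) := by
    rw [Algebra.algebraMap_eq_smul_one, ← Polynomial.smul_C, map_one]
  have h3 : Commute (h • (1 : Polynomial A) - Polynomial.X) (Polynomial.C a) :=
    ((Commute.one_left _).smul_left h).sub_left (Polynomial.commute_X _)
  rw [h1, Polynomial.monomial_comp, h2, map_mul, (h3.pow_left k).eq, map_pow, map_neg, map_one,
    ← neg_sub Polynomial.X, neg_pow (Polynomial.X - _) k, mul_assoc, ← mul_assoc, ← mul_assoc]
  congr 1
  exact ((Commute.neg_one_left _).pow_left k).eq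

/-- Substituting the shifted variable into the characteristic polynomial of the shifted matrix gives
the polynomial with the deformed coefficients. -/
theorem IsEvenHeckeSymmetry.chPoly_comp (hR : IsEvenHeckeSymmetry R q p)
    (M : Matrix (Fin n) (Fin n) A) (ħ : 𝕜) :
    (chPoly p (sigma R q p (M - (ħ / (q - q⁻¹)) • 1))).comp
      (Polynomial.X - Polynomial.C (algebraMap 𝕜 A (ħ / (q - q⁻¹)))) =
    chPoly p (sigmaH R q ħ p M) := by
  rw [chPoly_eq_sum (hR.sigma_zero _), chPoly_eq_sum (hR.sigmaH_zero _ _), Polynomial.sum_comp]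
  simp only [neg_X_pow_mul_C_comp]
  rw [sum_shift_pow_mul Polynomial.X (ħ / (q - q⁻¹)) fun j =>
    Polynomial.C (sigma R q p (M - (ħ / (q - q⁻¹)) • 1) j)]
  refine Finset.sum_congr rfl fun k hk => ?_
  rw [hR.sigmaH_eq_sum M ħ (Nat.lt_succ_iff.mp (Finset.mem_range.mp hk)), map_sum]
  simp only [Polynomial.smul_C]

end Coeff

/-! ### The generating function of the numbers `ξ` -/

section Xi

variable {𝕜 : Type*} [Field 𝕜] {p : ℕ} {q : 𝕜} {T : Type*} [CommRing T] [Algebra 𝕜 T]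

/-- The `q`-binomial theorem. -/
theorem gauss_binomial (hq0 : q ≠ 0) (hqn : ∀ r, qNum q (r + 1) ≠ 0) (b : T) : ∀ (p : ℕ) (a : T),
    ∏ k ∈ Finset.range p, (b + algebraMap 𝕜 T (q ^ (2 * k)) * a) =
      ∑ m ∈ Finset.range (p + 1),
        algebraMap 𝕜 T (q ^ (m * p) * (q ^ m)⁻¹ * qBinom q p m) * a ^ m * b ^ (p - m)
  | 0, a => by simp [qBinom_zero hqn]
  | p + 1, a => by
    let F : ℕ → T := fun m =>
      algebraMap 𝕜 T (q ^ (m * p) * q ^ m * qBinom q p m) * a ^ m * b ^ (p - m)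
    have ih := gauss_binomial hq0 hqn b p (algebraMap 𝕜 T (q ^ 2) * a)
    have h1 : ∏ k ∈ Finset.range p,
        (b + algebraMap 𝕜 T (q ^ (2 * k)) * (algebraMap 𝕜 T (q ^ 2) * a)) =
        ∏ k ∈ Finset.range p, (b + algebraMap 𝕜 T (q ^ (2 * (k + 1))) * a) :=
      Finset.prod_congr rfl fun k _ => by
        rw [← mul_assoc, ← map_mul, ← pow_add, mul_add, mul_one]
    have h2 : ∑ m ∈ Finset.range (p + 1), algebraMap 𝕜 T (q ^ (m * p) * (q ^ m)⁻¹ * qBinom q p m) *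
        (algebraMap 𝕜 T (q ^ 2) * a) ^ m * b ^ (p - m) = ∑ m ∈ Finset.range (p + 1), F m := by
      refine Finset.sum_congr rfl fun m _ => ?_
      simp only [F]
      rw [mul_pow, ← map_pow, ← mul_assoc, ← map_mul]
      congr 3
      rw [← pow_mul]
      field_simp
      ring
    rw [Finset.prod_range_succ', ← h1, ih, h2, mul_zero, pow_zero, map_one, one_mul, mul_add,
      Finset.sum_range_succ' _ (p + 1)]
    have h3 : (∑ m ∈ Finset.range (p + 1), F m) * b =
        ∑ m ∈ Finset.range p, F (m + 1) * b + b ^ (p + 1) := by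
      rw [Finset.sum_range_succ', add_mul, Finset.sum_mul]
      simp [F, qBinom_zero hqn, pow_succ]
    rw [h3, Finset.sum_mul, Finset.sum_range_succ, Finset.sum_range_succ _ p]
    have h4 : ∀ m ∈ Finset.range p,
        algebraMap 𝕜 T (q ^ ((m + 1) * (p + 1)) * (q ^ (m + 1))⁻¹ * qBinom q (p + 1) (m + 1)) *
          a ^ (m + 1) * b ^ (p + 1 - (m + 1)) = F (m + 1) * b + F m * a := by
      intro m hm
      have hm := Finset.mem_range.mp hm
      simp only [F]
      rw [qBinom_succ_succ hq0 hqn hm, Nat.add_sub_add_right,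
        show b ^ (p - m) = b ^ (p - (m + 1)) * b by rw [← pow_succ]; congr 1; omega,
        show q ^ ((m + 1) * (p + 1)) * (q ^ (m + 1))⁻¹ * (q ^ (m + 1) * qBinom q p (m + 1) +
          (q ^ (p - m))⁻¹ * qBinom q p m) = q ^ ((m + 1) * p) * q ^ (m + 1) * qBinom q p (m + 1) +
          q ^ (m * p) * q ^ m * qBinom q p m by
            obtain ⟨d, rfl⟩ : ∃ d, p = m + d := ⟨p - m, by omega⟩
            rw [Nat.add_sub_cancel_left]
            field_simp
            ring, map_add]
      ring
    rw [Finset.sum_congr rfl h4, Finset.sum_add_distrib]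
    have h5 : F p * a = algebraMap 𝕜 T (q ^ ((p + 1) * (p + 1)) * (q ^ (p + 1))⁻¹ *
        qBinom q (p + 1) (p + 1)) * a ^ (p + 1) * b ^ (p + 1 - (p + 1)) := by
      simp only [F]
      rw [qBinom_self hqn, qBinom_self hqn, Nat.sub_self, Nat.sub_self,
        show q ^ ((p + 1) * (p + 1)) * (q ^ (p + 1))⁻¹ = q ^ (p * p) * q ^ p by
          field_simp
          ring]
      ring
    rw [h5]
    simp [qBinom_zero hqn]
    ring

theorem sub_inv_mul_qNum (hq0 : q ≠ 0) (hq1 : q - q⁻¹ ≠ 0) (k : ℕ) :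
    (q - q⁻¹) * q ^ k * qNum q k = q ^ (2 * k) - 1 := by
  rw [qNum, mul_comm (q - q⁻¹), mul_assoc, mul_div_cancel₀ _ hq1, mul_sub,
    mul_inv_cancel₀ (pow_ne_zero k hq0), two_mul, pow_add]

/-- Summation of the generating function of the numbers `ξ` over both binomial coefficients. -/
theorem sum_xi_eq_sum (q : 𝕜) (x y : T) :
    ∑ s ∈ Finset.range (p + 1), ∑ k ∈ Finset.range (s + 1),
      (-x) ^ (p - s) * (-y) ^ k * algebraMap 𝕜 T (xi q p s k) =
    ∑ m ∈ Finset.range (p + 1), algebraMap 𝕜 T (qBinom q p m) * (1 - y) ^ m *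
      (-(x + algebraMap 𝕜 T (q ^ (p - 1))⁻¹)) ^ (p - m) := by
  let F : ℕ → ℕ → T := fun m s => (-x) ^ (p - s) * (-algebraMap 𝕜 T (q ^ (p - 1))⁻¹) ^ (s - m) *
    ((p - m).choose (s - m) : T) * (algebraMap 𝕜 T (qBinom q p m) * (1 - y) ^ m)
  have h1 : ∀ s ∈ Finset.range (p + 1), ∑ k ∈ Finset.range (s + 1),
      (-x) ^ (p - s) * (-y) ^ k * algebraMap 𝕜 T (xi q p s k) =
      ∑ m ∈ Finset.range (s + 1), F m s := by
    intro s hs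
    have hs := Finset.mem_range.mp hs
    have h2 : ∀ k ∈ Finset.range (s + 1), (-x) ^ (p - s) * (-y) ^ k * algebraMap 𝕜 T (xi q p s k) =
        ∑ m ∈ Finset.range (s + 1), (-x) ^ (p - s) * (-algebraMap 𝕜 T (q ^ (p - 1))⁻¹) ^ (s - m) *
          ((p - m).choose (s - m) : T) * (algebraMap 𝕜 T (qBinom q p m)) *
          ((-y) ^ k * 1 ^ (m - k) * (m.choose k : T)) := by
      intro k hk
      rw [xi_eq_sum q (Nat.lt_succ_iff.mp (Finset.mem_range.mp hk)) (by omega), map_sum,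
        Finset.mul_sum]
      refine Finset.sum_congr rfl fun m _ => ?_
      rw [neg_pow (algebraMap 𝕜 T _), ← map_pow, inv_pow, ← pow_mul, mul_comm (p - 1)]
      simp only [map_mul, map_pow, map_neg, map_one, map_natCast, one_pow]
      ring
    rw [Finset.sum_congr rfl h2, Finset.sum_comm]
    refine Finset.sum_congr rfl fun m hm => ?_
    have hm := Finset.mem_range.mp hm
    rw [← Finset.mul_sum, ← Finset.sum_subset (Finset.range_mono (show m + 1 ≤ s + 1 by omega))
      (fun k _ hk => by
        rw [Nat.choose_eq_zero_of_lt (by simpa using hk), Nat.cast_zero, mul_zero]),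
      ← add_pow]
    simp only [F]
    ring
  rw [Finset.sum_congr rfl h1]
  simp only [Finset.range_eq_Ico]
  rw [← Finset.sum_Ico_Ico_comm]
  refine Finset.sum_congr rfl fun m hm => ?_
  have hm := Finset.mem_Ico.mp hm
  rw [Finset.sum_Ico_eq_sum_range, show p + 1 - m = p - m + 1 by omega, neg_add_rev, add_pow,
    Finset.mul_sum]
  refine Finset.sum_congr rfl fun r _ => ?_
  simp only [F]
  rw [Nat.add_sub_cancel_left, ← Nat.sub_sub]
  ring

/-- The generating function of the numbers `ξ`, with variables in any commutative algebra. -/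
theorem sum_xi_eq_prod (hq0 : q ≠ 0) (hqn : ∀ r, qNum q (r + 1) ≠ 0) (hq1 : q - q⁻¹ ≠ 0) (x y : T) :
    ∑ s ∈ Finset.range (p + 1), ∑ k ∈ Finset.range (s + 1),
      (-x) ^ (p - s) * (-y) ^ k * algebraMap 𝕜 T (xi q p s k) =
    (-1) ^ p * algebraMap 𝕜 T (q ^ (p * (p - 1)))⁻¹ * ∏ k ∈ Finset.range p,
      (x * algebraMap 𝕜 T (q ^ (p - 1)) + y * algebraMap 𝕜 T (q ^ (2 * k)) -
        algebraMap 𝕜 T ((q - q⁻¹) * q ^ k * qNum q k)) := by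
  rw [sum_xi_eq_sum]
  have hQ : algebraMap 𝕜 T (q ^ (p - 1))⁻¹ * algebraMap 𝕜 T (q ^ (p - 1)) = 1 := by
    rw [← map_mul, inv_mul_cancel₀ (pow_ne_zero _ hq0), map_one]
  have h1 := gauss_binomial hq0 hqn (-(x + algebraMap 𝕜 T (q ^ (p - 1))⁻¹)) p
    (algebraMap 𝕜 T (q ^ (p - 1))⁻¹ * (1 - y))
  have h2 : ∀ m ∈ Finset.range (p + 1),
      algebraMap 𝕜 T (q ^ (m * p) * (q ^ m)⁻¹ * qBinom q p m) *
        (algebraMap 𝕜 T (q ^ (p - 1))⁻¹ * (1 - y)) ^ m *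
        (-(x + algebraMap 𝕜 T (q ^ (p - 1))⁻¹)) ^ (p - m) =
      algebraMap 𝕜 T (qBinom q p m) * (1 - y) ^ m *
        (-(x + algebraMap 𝕜 T (q ^ (p - 1))⁻¹)) ^ (p - m) := by
    intro m hm
    have hm := Finset.mem_range.mp hm
    rw [mul_pow, ← mul_assoc, ← map_pow, ← map_mul]
    congr 3
    rcases p with _ | p
    · obtain rfl : m = 0 := by omega
      simp
    · rw [Nat.add_sub_cancel, inv_pow, ← pow_mul]
      field_simp
      ring
  rw [Finset.sum_congr rfl h2] at h1
  rw [← h1]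
  have h3 : ∀ k ∈ Finset.range p, -(x + algebraMap 𝕜 T (q ^ (p - 1))⁻¹) +
      algebraMap 𝕜 T (q ^ (2 * k)) * (algebraMap 𝕜 T (q ^ (p - 1))⁻¹ * (1 - y)) =
      (-algebraMap 𝕜 T (q ^ (p - 1))⁻¹) * (x * algebraMap 𝕜 T (q ^ (p - 1)) +
        y * algebraMap 𝕜 T (q ^ (2 * k)) - algebraMap 𝕜 T ((q - q⁻¹) * q ^ k * qNum q k)) := by
    intro k _
    rw [sub_inv_mul_qNum hq0 hq1, map_sub, map_one]
    linear_combination x * hQ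
  rw [Finset.prod_congr rfl h3, Finset.prod_mul_distrib, Finset.prod_const, Finset.card_range,
    neg_pow (algebraMap 𝕜 T _), ← map_pow, inv_pow, ← pow_mul, mul_comm (p - 1)]

end Xi

/-! ### The closed form of the numbers `ω` -/

section Omega

variable {𝕜 : Type*} [Field 𝕜] {q : 𝕜} {T : Type*} [CommRing T] [Algebra 𝕜 T]

/-- Expansion of a product of trinomials over pairs of disjoint subsets. -/
theorem prod_one_add_add (I : Finset ℕ) (f g : ℕ → T) :
    ∏ k ∈ I, (1 + f k + g k) = ∑ a ∈ Finset.range (I.card + 1), ∑ b ∈ Finset.range (I.card + 1),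
      ∑ S ∈ I.powersetCard a, ∑ U ∈ I.powersetCard b with Disjoint S U,
        (∏ k ∈ S, f k) * ∏ k ∈ U, g k := by
  have h1 : ∏ k ∈ I, (1 + f k + g k) = ∏ k ∈ I, (f k + (1 + g k)) :=
    Finset.prod_congr rfl fun k _ => by ring
  rw [h1, Finset.prod_add, Finset.sum_powerset]
  refine Finset.sum_congr rfl fun a _ => ?_
  rw [Finset.sum_comm]
  refine Finset.sum_congr rfl fun S hS => ?_
  have hsub : (I \ S).powerset = I.powerset.filter (fun U => Disjoint S U) := by
    ext U
    rw [Finset.mem_powerset, Finset.subset_sdiff, Finset.mem_filter, Finset.mem_powerset,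
      disjoint_comm]
  rw [Finset.prod_one_add, hsub, Finset.sum_filter, Finset.sum_powerset, Finset.mul_sum]
  refine Finset.sum_congr rfl fun b _ => ?_
  rw [← Finset.sum_filter, Finset.mul_sum]

theorem prod_eq_sum_pairSum (q : 𝕜) (P : ℕ) (x y : T) :
    ∏ k ∈ Finset.Icc 1 P, (1 + algebraMap 𝕜 T (q ^ k / qNum q k) * y +
        algebraMap 𝕜 T ((q ^ k)⁻¹ / qNum q k) * x) =
      ∑ a ∈ Finset.range (P + 1), ∑ b ∈ Finset.range (P + 1),
        algebraMap 𝕜 T (pairSum q (P + 1) a b) * y ^ a * x ^ b := by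
  rw [prod_one_add_add, Nat.card_Icc, Nat.add_sub_cancel]
  refine Finset.sum_congr rfl fun a _ => Finset.sum_congr rfl fun b _ => ?_
  rw [pairSum, Nat.add_sub_cancel, map_sum, Finset.sum_mul, Finset.sum_mul]
  refine Finset.sum_congr rfl fun S hS => ?_
  rw [map_sum, Finset.sum_mul, Finset.sum_mul]
  refine Finset.sum_congr rfl fun U hU => ?_
  rw [Finset.prod_mul_distrib, Finset.prod_mul_distrib, Finset.prod_const, Finset.prod_const,
    (Finset.mem_powersetCard.mp hS).2,
    (Finset.mem_powersetCard.mp (Finset.mem_filter.mp hU).1).2, map_mul, map_prod, map_prod]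
  ring

end Omega

section Omega

open Polynomial

variable {𝕜 : Type*} [Field 𝕜] {q : 𝕜}

theorem coeff_coeff_monomial (c : 𝕜) (a b i j : ℕ) :
    (((X : 𝕜[X][X]) ^ a * C X ^ b * algebraMap 𝕜 𝕜[X][X] c).coeff i).coeff j =
      if a = i ∧ b = j then c else 0 := by
  have h1 : (X : 𝕜[X][X]) ^ a * C X ^ b * algebraMap 𝕜 𝕜[X][X] c = C (C c * X ^ b) * X ^ a := by
    rw [Polynomial.algebraMap_apply, Polynomial.algebraMap_apply, Algebra.algebraMap_self,
      RingHom.id_apply, C_mul, C_pow]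
    ring
  rw [h1, coeff_C_mul_X_pow]
  split_ifs with h2 h3 h3
  · rw [coeff_C_mul_X_pow, if_pos h3.2.symm]
  · rw [coeff_C_mul_X_pow, if_neg fun h => h3 ⟨h2.symm, h.symm⟩]
  · exact absurd h3.1.symm h2
  · rw [coeff_zero]

theorem prod_sub_inv_mul_pow_mul_qNum (q : 𝕜) (P : ℕ) :
    ∏ k ∈ Finset.Icc 1 P, ((q - q⁻¹) * q ^ k * qNum q k) =
      (q - q⁻¹) ^ P * q ^ (P * (P + 1) / 2) * qFact q P := by
  induction P with
  | zero => simp [qFact]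
  | succ P ih =>
    have h1 : (P + 1) * (P + 1 + 1) / 2 = P * (P + 1) / 2 + (P + 1) := by
      rw [show (P + 1) * (P + 1 + 1) = P * (P + 1) + (P + 1) * 2 by ring,
        Nat.add_mul_div_right _ _ two_pos]
    rw [Finset.prod_Icc_succ_top (by omega), ih, h1, qFact, qFact, Finset.prod_range_succ]
    ring

/-- The product in the generating function of the numbers `ξ`, after the common constants are
taken out of its factors. -/
theorem prod_eq_sum_pairSum_mul {T : Type*} [CommRing T] [Algebra 𝕜 T] (hq0 : q ≠ 0)
    (hqn : ∀ r, qNum q (r + 1) ≠ 0) (hq1 : q - q⁻¹ ≠ 0) (P : ℕ) (x y : T) :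
    ∏ k ∈ Finset.range (P + 1), (x * algebraMap 𝕜 T (q ^ P) + y * algebraMap 𝕜 T (q ^ (2 * k)) +
        algebraMap 𝕜 T ((q - q⁻¹) * q ^ k * qNum q k)) =
      algebraMap 𝕜 T ((q - q⁻¹) ^ P * q ^ (P * (P + 1) / 2) * qFact q P) *
        (∑ a ∈ Finset.range (P + 1), ∑ b ∈ Finset.range (P + 1),
          algebraMap 𝕜 T (pairSum q (P + 1) a b) * (algebraMap 𝕜 T (q - q⁻¹)⁻¹ * y) ^ a *
            (algebraMap 𝕜 T (q ^ P / (q - q⁻¹)) * x) ^ b) *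
        (x * algebraMap 𝕜 T (q ^ P) + y) := by
  -- the factor for `k = 0` is kept apart, because `qNum q 0 = 0`
  rw [Finset.prod_range_succ', ← prod_eq_sum_pairSum, ← prod_sub_inv_mul_pow_mul_qNum, map_prod,
    ← Finset.prod_mul_distrib]
  congr 1
  · rw [show Finset.Icc 1 P = Finset.Ico 1 (P + 1) by ext; simp,
      Finset.prod_Ico_eq_prod_range, Nat.add_sub_cancel]
    refine Finset.prod_congr rfl fun k _ => ?_
    rw [add_comm 1 k]
    have h := hqn k
    have e1 : q ^ (2 * (k + 1)) = (q - q⁻¹) * q ^ (k + 1) * qNum q (k + 1) *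
        (q ^ (k + 1) / qNum q (k + 1)) * (q - q⁻¹)⁻¹ := by
      generalize q - q⁻¹ = l at hq1 ⊢
      field_simp
      ring
    have e2 : q ^ P = (q - q⁻¹) * q ^ (k + 1) * qNum q (k + 1) *
        ((q ^ (k + 1))⁻¹ / qNum q (k + 1)) * (q ^ P / (q - q⁻¹)) := by
      generalize q - q⁻¹ = l at hq1 ⊢
      field_simp
    nth_rewrite 1 [e1, e2]
    simp only [map_mul]
    ring
  · simp [qNum]

/-- The closed form of `ω`, by comparison of coefficients in the generating function of the
numbers `ξ`. -/
theorem omega_eq (hq0 : q ≠ 0) (hqn : ∀ r, qNum q (r + 1) ≠ 0) (hq1 : q - q⁻¹ ≠ 0) {p s k : ℕ}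
    (hks : k < s) (hs : s ≤ p) :
    omega q p s k = q ^ (((p : ℤ) - 1) * ((p : ℤ) - 2 * (s : ℤ)) / 2) *
      (qFact q (p - 1) / qBinom q p s) *
      ((if k = 0 then 0 else pairSum q p (k - 1) (p - s)) +
        (if s = p then 0 else pairSum q p k (p - s - 1))) := by
  obtain ⟨P, rfl⟩ : ∃ P, p = P + 1 := ⟨p - 1, by omega⟩
  obtain ⟨E, hE⟩ := (Nat.even_mul_succ_self P).two_dvd
  have hE' : P * (P + 1) / 2 = E := by omega
  let D : 𝕜 := (q ^ ((P + 1) * P))⁻¹ * ((q - q⁻¹) ^ P * q ^ E * qFact q P)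
  let G : ℕ → ℕ → 𝕜 := fun a b =>
    D * pairSum q (P + 1) a b * ((q - q⁻¹)⁻¹) ^ a * (q ^ P / (q - q⁻¹)) ^ b
  -- with these variables all signs in the generating function cancel
  have h1 := sum_xi_eq_prod (p := P + 1) hq0 hqn hq1 (-X : 𝕜[X][X]) (-(C X : 𝕜[X][X]))
  have h2 : ∀ k : ℕ, -(X : 𝕜[X][X]) * algebraMap 𝕜 𝕜[X][X] (q ^ (P + 1 - 1)) +
      -(C X : 𝕜[X][X]) * algebraMap 𝕜 𝕜[X][X] (q ^ (2 * k)) -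
        algebraMap 𝕜 𝕜[X][X] ((q - q⁻¹) * q ^ k * qNum q k) =
      (-1) * (X * algebraMap 𝕜 𝕜[X][X] (q ^ P) + C X * algebraMap 𝕜 𝕜[X][X] (q ^ (2 * k)) +
        algebraMap 𝕜 𝕜[X][X] ((q - q⁻¹) * q ^ k * qNum q k)) := fun k => by
    rw [Nat.add_sub_cancel]
    ring
  simp only [h2, neg_neg, Finset.prod_mul_distrib, Finset.prod_const, Finset.card_range] at h1
  rw [prod_eq_sum_pairSum_mul hq0 hqn hq1, hE'] at h1
  have h3 : ∑ s ∈ Finset.range (P + 1 + 1), ∑ k ∈ Finset.range (s + 1),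
      (X : 𝕜[X][X]) ^ (P + 1 - s) * C X ^ k * algebraMap 𝕜 𝕜[X][X] (xi q (P + 1) s k) =
      ∑ a ∈ Finset.range (P + 1), ∑ b ∈ Finset.range (P + 1),
        (X ^ (b + 1) * C X ^ a * algebraMap 𝕜 𝕜[X][X] (q ^ P * G a b) +
          X ^ b * C X ^ (a + 1) * algebraMap 𝕜 𝕜[X][X] (G a b)) := by
    rw [h1, Nat.add_sub_cancel, mul_assoc ((-1) ^ (P + 1)), mul_left_comm _ ((-1) ^ (P + 1)),
      ← mul_assoc ((-1) ^ (P + 1)), ← mul_pow, show (-1 : 𝕜[X][X]) * -1 = 1 by ring, one_pow,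
      one_mul, ← mul_assoc,
      ← mul_assoc, ← map_mul, Finset.mul_sum, Finset.sum_mul]
    refine Finset.sum_congr rfl fun a _ => ?_
    rw [Finset.mul_sum, Finset.sum_mul]
    refine Finset.sum_congr rfl fun b _ => ?_
    simp only [G, D, mul_pow, map_mul, map_pow]
    ring
  -- compare the coefficients of `x ^ (p - s) * y ^ k`
  have h4 := congrArg (fun f => (f.coeff (P + 1 - s)).coeff k) h3
  simp only [finsetSum_coeff, coeff_add, coeff_coeff_monomial] at h4
  rw [Finset.sum_eq_single_of_mem s (Finset.mem_range.mpr (by omega)) fun t ht hts =>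
      Finset.sum_eq_zero fun j _ => if_neg fun h => hts (by
        have := Finset.mem_range.mp ht
        omega),
    Finset.sum_eq_single_of_mem k (Finset.mem_range.mpr (by omega)) fun j _ hj =>
      if_neg fun h => hj h.2, if_pos ⟨rfl, rfl⟩] at h4
  simp only [Finset.sum_add_distrib] at h4
  have h5 : ∑ a ∈ Finset.range (P + 1), ∑ b ∈ Finset.range (P + 1),
      (if b + 1 = P + 1 - s ∧ a = k then q ^ P * G a b else 0) =
      if s = P + 1 then 0 else q ^ P * G k (P + 1 - s - 1) := by
    split_ifs with h
    · exact Finset.sum_eq_zero fun a _ => Finset.sum_eq_zero fun b _ => if_neg fun h' => by omega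
    · rw [Finset.sum_eq_single_of_mem k (Finset.mem_range.mpr (by omega)) fun a _ ha =>
          Finset.sum_eq_zero fun b _ => if_neg fun h' => ha h'.2,
        Finset.sum_eq_single_of_mem (P + 1 - s - 1) (Finset.mem_range.mpr (by omega))
          fun b _ hb => if_neg fun h' => by omega, if_pos (by omega)]
  have h6 : ∑ a ∈ Finset.range (P + 1), ∑ b ∈ Finset.range (P + 1),
      (if b = P + 1 - s ∧ a + 1 = k then G a b else 0) =
      if k = 0 then 0 else G (k - 1) (P + 1 - s) := by
    split_ifs with h
    · exact Finset.sum_eq_zero fun a _ => Finset.sum_eq_zero fun b _ => if_neg fun h' => by omega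
    · rw [Finset.sum_eq_single_of_mem (k - 1) (Finset.mem_range.mpr (by omega)) fun a _ ha =>
          Finset.sum_eq_zero fun b _ => if_neg fun h' => by omega,
        Finset.sum_eq_single_of_mem (P + 1 - s) (Finset.mem_range.mpr (by omega))
          fun b _ hb => if_neg fun h' => by omega, if_pos (by omega)]
  rw [h5, h6] at h4
  have h7 : q ^ ((((P + 1 : ℕ) : ℤ) - 1) * (((P + 1 : ℕ) : ℤ) - 2 * (s : ℤ)) / 2) =
      q ^ E / q ^ (P * s) := by
    have : (((P + 1 : ℕ) : ℤ) - 1) * (((P + 1 : ℕ) : ℤ) - 2 * (s : ℤ)) = (E - (P * s : ℕ)) * 2 := by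
      have : (P : ℤ) * (P + 1) = 2 * E := by exact_mod_cast hE
      push_cast
      linear_combination this
    rw [this, Int.mul_ediv_cancel _ two_ne_zero, zpow_sub₀ hq0, zpow_natCast, zpow_natCast]
  have h8 : q ^ ((P + 1) * P) = q ^ E * q ^ E := by rw [← pow_add]; congr 1; linarith
  obtain ⟨i, hi⟩ : ∃ i, P + 1 = s + i := ⟨P + 1 - s, by omega⟩
  have hi' : P + 1 - s = i := by omega
  have h9 : q ^ (P * s) * q ^ (P * i) = q ^ E * q ^ E := by
    rw [← pow_add, ← pow_add, ← mul_add, ← hi]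
    congr 1
    linarith
  have key : ∀ a b, a + b + (s - k) = P →
      ((q - q⁻¹) ^ (s - k))⁻¹ * G a b = q ^ E / (q ^ E * q ^ E) * qFact q P * q ^ (P * b) *
        pairSum q (P + 1) a b := by
    intro a b hab
    simp only [G, D]
    rw [h8, div_pow, ← pow_mul, inv_pow, ← hab, pow_add, pow_add]
    generalize q - q⁻¹ = l at hq1 ⊢
    field_simp
  have hqE := pow_ne_zero E hq0
  have h10 : ((q - q⁻¹) ^ (s - k))⁻¹ * (if s = P + 1 then 0 else q ^ P * G k (i - 1)) =
      q ^ E / q ^ (P * s) * qFact q P *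
        if s = P + 1 then 0 else pairSum q (P + 1) k (i - 1) := by
    split_ifs with h
    · simp
    · rw [mul_left_comm, key _ _ (by omega), ← h9]
      obtain ⟨j, rfl⟩ : ∃ j, i = j + 1 := ⟨i - 1, by omega⟩
      rw [Nat.add_sub_cancel, mul_add, mul_one, pow_add]
      field_simp
  have h11 : ((q - q⁻¹) ^ (s - k))⁻¹ * (if k = 0 then 0 else G (k - 1) i) =
      q ^ E / q ^ (P * s) * qFact q P *
        if k = 0 then 0 else pairSum q (P + 1) (k - 1) i := by
    split_ifs with h
    · simp
    · rw [key _ _ (by omega), ← h9]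
      field_simp
  rw [omega, h7, h4, hi', Nat.add_sub_cancel, div_mul_eq_mul_div, mul_add, h10, h11]
  ring

end Omega

end QuantumMatrix

theorem mainTheorem2 {𝕜 : Type*} [RCLike 𝕜] {n p : ℕ}
    (R : Matrix (Fin n × Fin n) (Fin n × Fin n) 𝕜) (q : 𝕜)
    (hR : QuantumMatrix.IsEvenHeckeSymmetry R q p) (ħ : 𝕜) :
    -- the coefficients are central
    (∀ k ≤ p, QuantumMatrix.sigma R q p (QuantumMatrix.genMatrix R ħ) k ∈
      Subalgebra.center 𝕜 (QuantumMatrix.QLAlgebra R ħ)) ∧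
    (∀ k < p, QuantumMatrix.sigmaH R q ħ p (QuantumMatrix.genMatrix R ħ) (p - k) ∈
      Subalgebra.center 𝕜 (QuantumMatrix.QLAlgebra R ħ)) ∧
    -- the Cayley-Hamilton identity
    (-QuantumMatrix.genMatrix R ħ) ^ p +
        ∑ k ∈ Finset.range p, (-QuantumMatrix.genMatrix R ħ) ^ k *
          Matrix.scalar (Fin n)
            (QuantumMatrix.sigmaH R q ħ p (QuantumMatrix.genMatrix R ħ) (p - k)) = 0 ∧
    -- the shift of generators carries the identity for `ħ = 0` to the identity for `ħ`
    (∃ φ : QuantumMatrix.QLAlgebra R (0 : 𝕜) ≃ₐ[𝕜] QuantumMatrix.QLAlgebra R ħ,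
      (QuantumMatrix.genMatrix R (0 : 𝕜)).map φ =
        QuantumMatrix.genMatrix R ħ -
          Matrix.scalar (Fin n)
            (algebraMap 𝕜 (QuantumMatrix.QLAlgebra R ħ) (ħ / (q - q⁻¹))) ∧
      (∀ k ≤ p, φ (QuantumMatrix.sigma R q p (QuantumMatrix.genMatrix R (0 : 𝕜)) k) =
        ∑ r ∈ Finset.range (k + 1),
          ((-(ħ / (q - q⁻¹))) ^ r * (q ^ (r * (p - 1)))⁻¹ * (k.choose r : 𝕜) *
              (QuantumMatrix.qBinom q p k / QuantumMatrix.qBinom q p (k - r))) •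
            QuantumMatrix.sigma R q p (QuantumMatrix.genMatrix R ħ) (k - r)) ∧
      ((QuantumMatrix.chPoly p
            (QuantumMatrix.sigma R q p (QuantumMatrix.genMatrix R (0 : 𝕜)))).map
          (φ : QuantumMatrix.QLAlgebra R (0 : 𝕜) →+* QuantumMatrix.QLAlgebra R ħ)).comp
          (Polynomial.X -
            Polynomial.C (algebraMap 𝕜 (QuantumMatrix.QLAlgebra R ħ) (ħ / (q - q⁻¹)))) =
        QuantumMatrix.chPoly p
          (QuantumMatrix.sigmaH R q ħ p (QuantumMatrix.genMatrix R ħ))) ∧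
    -- the generating function of the numbers `ξ_{s,k}`
    (∀ x y : 𝕜,
      ∑ s ∈ Finset.range (p + 1), ∑ k ∈ Finset.range (s + 1),
          (-x) ^ (p - s) * (-y) ^ k * QuantumMatrix.xi q p s k =
        (-1) ^ p * (q ^ (p * (p - 1)))⁻¹ *
          ∏ k ∈ Finset.range p,
            (x * q ^ (p - 1) + y * q ^ (2 * k) -
              (q - q⁻¹) * q ^ k * QuantumMatrix.qNum q k)) ∧
    -- the resulting closed form of the numbers `ω_{s,k}`; the exponent of `q` is an integer
    (∀ s k : ℕ, k < s → s ≤ p →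
      QuantumMatrix.omega q p s k =
        q ^ (((p : ℤ) - 1) * ((p : ℤ) - 2 * (s : ℤ)) / 2) *
          (QuantumMatrix.qFact q (p - 1) / QuantumMatrix.qBinom q p s) *
          ((if k = 0 then 0 else QuantumMatrix.pairSum q p (k - 1) (p - s)) +
            (if s = p then 0 else QuantumMatrix.pairSum q p k (p - s - 1)))) := by
  have hq1 := hR.sub_inv_ne_zero
  refine ⟨fun k hk => hR.sigma_mem_center ħ hk, fun k _ => hR.sigmaH_mem_center ħ (Nat.sub_le p k),
    hR.cayleyHamilton_sigmaH (QuantumMatrix.satisfiesQL_genMatrix R ħ), ?_, fun x y => ?_,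
    fun s k hks hs => QuantumMatrix.omega_eq hR.q_ne_zero hR.qNum_ne_zero hq1 hks hs⟩
  · obtain ⟨φ, hφ⟩ := QuantumMatrix.exists_shift_equiv hR.hecke hq1 ħ
    have hσ : ∀ k, φ (QuantumMatrix.sigma R q p (QuantumMatrix.genMatrix R (0 : 𝕜)) k) =
        QuantumMatrix.sigma R q p (QuantumMatrix.genMatrix R ħ - (ħ / (q - q⁻¹)) • 1) k := by
      intro k
      rw [← hφ]
      exact QuantumMatrix.map_sigma φ.toAlgHom _ k
    refine ⟨φ, ?_, fun k hk => ?_, ?_⟩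
    · rw [hφ, QuantumMatrix.scalar_algebraMap]
    · rw [hσ, hR.sigma_sub_smul _ _ hk]
    · rw [QuantumMatrix.map_chPoly, ← hR.chPoly_comp]
      congr 2
      exact funext hσ
  · have h := QuantumMatrix.sum_xi_eq_prod (p := p) hR.q_ne_zero hR.qNum_ne_zero hq1 x y
    simpa only [Algebra.algebraMap_self, RingHom.id_apply] using h
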